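/- Let $n\ge 3$ and let $p,q\ge 0$ be integers with $p+q+1=n$ and $(p,q)\ne(1,1)$. Let $\mathrm{Riem}^+(S^n)$ be the set of smooth Riemannian metrics of positive scalar curvature on $S^n$, with the $C^k$ topology for some fixed integer $k\ge 2$; two metrics are called isotopic if they lie in the same path component of $\mathrm{Riem}^+(S^n)$. Let $ds_m^2$ denote the round metric of radius one on $S^m$. For $b>0$ let $\mathcal U(0,b)$ be the set of functions $u$, smooth on $[0,b]$ and positive on $(0,b)$, such that $u(0)>0$, $u^{(j)}(0)=0$ for all odd $j$, $\dot u(b)=-1$, $u^{(j)}(b)=0$ for all even $j\ge 0$, $\ddot u\le 0$, $\ddot u(t)<0$ for $t$ near but not at $b$, and $\dddot u(b)>0$. Let $\mathcal V(0,b)$ be the set of functions $v$, smooth on $[0,b]$ and positive on $(0,b)$, such that $v(b)>0$, $v^{(j)}(b)=0$ for all odd $j$, $\dot v(0)=1$, $v^{(j)}(0)=0$ for all even $j\ge0$, $\ddot v\le 0$, $\ddot v(t)<0$ for $t$ near but not at $0$, and $\dddot v(0)<0$. The metric $dt^2+u(t)^2ds_p^2+v(t)^2ds_q^2$ on $(0,b)\times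 S^p\times S^q$ is regarded as a metric on $S^n\subset\mathbb R^{p+1}\times\mathbb R^{q+1}$ by means of the embedding $(t,\phi,\theta)\mapsto\big(\cos(\tfrac{\pi t}{2b})\,\phi,\ \sin(\tfrac{\pi t}{2b})\,\theta\big)$, whose image is dense in $S^n$. 1. For every $b>0$ and all $u\in\mathcal U(0,b)$, $v\in\mathcal V(0,b)$, the metric $dt^2+u(t)^2ds_p^2+v(t)^2ds_q^2$ extends uniquely to a smooth Riemannian metric on $S^n$. The set $\hat{\mathcal W}^{p,q}(0,b)$ of all metrics on $S^n$ so obtained is a path-connected subspace of $\mathrm{Riem}^+(S^n)$, and so is $\bigcup_{b>0}\hat{\mathcal W}^{p,q}(0,b)$. 2. For $\delta>0$ call a smooth function $f_\delta:(0,\infty)\to\mathbb R$ a $\delta$-torpedo function if $f_\delta(t)=\delta\sin(t/\delta)$ for $t$ near $0$, $f_\delta(t)=\delta$ for $t\ge\delta\pi/2$, and $\ddot f_\delta\le 0$. For all $\epsilon,\delta>0$, all torpedo functions $f_\epsilon$, $f_\delta$ and all $b>\max\{\epsilon\pi,\delta\pi\}$, the mixed torpedo metric $g_{Mtor}^{p,q}=dt^2+f_\epsilon(b-t)^2ds_p^2+f_\delta(t)^2ds_q^2$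 extends uniquely to a smooth Riemannian metric on $S^n$, and this metric is isotopic to $ds_n^2$. -/

import Mathlib

open Set Filter Topology Metric
open scoped Manifold ContDiff

noncomputable section

namespace WarpedSphere

/-! ### Riemannian metrics, scalar curvature, and the `C^k` topology -/

section Riemannian

variable (n : ℕ) (M : Type*) [TopologicalSpace M] [ChartedSpace (EuclideanSpace ℝ (Fin n)) M]
  [IsManifold (𝓡 n) ∞ M]

/-- The set `Riem(M)` of all smooth Riemannian metrics on the `n`-manifold `M`. -/
abbrev Riem : Type _ :=
  Bundle.ContMDiffRiemannianMetric (𝓡 n) ∞ (EuclideanSpace ℝ (Fin n))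
    (fun x : M => TangentSpace (𝓡 n) x)

variable {n M}

/-- The metric `g` read in the chart at `c`: the pullback of `g` by the inverse of that chart. -/
def coordMetric (g : Riem n M) (c : M) (y : EuclideanSpace ℝ (Fin n)) :
    EuclideanSpace ℝ (Fin n) →L[ℝ] EuclideanSpace ℝ (Fin n) →L[ℝ] ℝ :=
  let D : EuclideanSpace ℝ (Fin n) →L[ℝ] EuclideanSpace ℝ (Fin n) :=
    mfderiv 𝓘(ℝ, EuclideanSpace ℝ (Fin n)) (𝓡 n) (extChartAt (𝓡 n) c).symm y
  let B : EuclideanSpace ℝ (Fin n) →L[ℝ] EuclideanSpace ℝ (Fin n) →L[ℝ] ℝ :=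
    g.inner ((extChartAt (𝓡 n) c).symm y)
  B.bilinearComp D D

/-- The `C^k` topology on `Riem(M)`: uniform convergence on compact sets, in every chart, of the
coordinate expression of the metric and of its derivatives up to order `k`. -/
@[reducible] def ckTopology (k : ℕ) : TopologicalSpace (Riem n M) :=
  ⨅ (c : M) (i : Fin (k + 1)), TopologicalSpace.induced
    (fun g : Riem n M => UniformOnFun.ofFun {K | IsCompact K ∧ K ⊆ (extChartAt (𝓡 n) c).target}
      (iteratedFDeriv ℝ (i : ℕ) (coordMetric g c))) inferInstance

end Riemannian

section Coordinates

variable {n : ℕ}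

/-- The `i`-th partial derivative of a function on `ℝⁿ`. -/
def partialDeriv (i : Fin n) (f : EuclideanSpace ℝ (Fin n) → ℝ) (y : EuclideanSpace ℝ (Fin n)) :
    ℝ :=
  fderiv ℝ f y (EuclideanSpace.single i 1)

/-- The Christoffel symbol `Γᵏᵢⱼ = ½ gᵏˡ (∂ᵢ gⱼₗ + ∂ⱼ gᵢₗ - ∂ₗ gᵢⱼ)`. -/
def christoffel (G : EuclideanSpace ℝ (Fin n) → Matrix (Fin n) (Fin n) ℝ) (k i j : Fin n)
    (y : EuclideanSpace ℝ (Fin n)) : ℝ :=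
  (1 / 2) * ∑ l, (G y)⁻¹ k l *
    (partialDeriv i (fun z => G z j l) y + partialDeriv j (fun z => G z i l) y
      - partialDeriv l (fun z => G z i j) y)

/-- The Ricci tensor
`Ricⱼₖ = ∂ᵢ Γⁱⱼₖ - ∂ⱼ Γⁱᵢₖ + Γⁱᵢₘ Γᵐⱼₖ - Γⁱⱼₘ Γᵐᵢₖ` (summation over `i` and `m`). -/
def ricci (G : EuclideanSpace ℝ (Fin n) → Matrix (Fin n) (Fin n) ℝ) (j k : Fin n)
    (y : EuclideanSpace ℝ (Fin n)) : ℝ :=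
  ∑ i, (partialDeriv i (christoffel G i j k) y - partialDeriv j (christoffel G i i k) y
    + ∑ m, (christoffel G i i m y * christoffel G m j k y
      - christoffel G i j m y * christoffel G m i k y))

/-- The scalar curvature `gʲᵏ Ricⱼₖ` of a metric given by a field of matrices on `ℝⁿ`. -/
def coordScalarCurvature (G : EuclideanSpace ℝ (Fin n) → Matrix (Fin n) (Fin n) ℝ)
    (y : EuclideanSpace ℝ (Fin n)) : ℝ :=
  ∑ j, ∑ k, (G y)⁻¹ j k * ricci G j k y

end Coordinates

section Curvature

variable {n : ℕ} {M : Type*} [TopologicalSpace M] [ChartedSpace (EuclideanSpace ℝ (Fin n)) M]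
  [IsManifold (𝓡 n) ∞ M]

/-- The matrix `gᵢⱼ` of `g` in the chart at `c`. -/
def coordMatrix (g : Riem n M) (c : M) (y : EuclideanSpace ℝ (Fin n)) :
    Matrix (Fin n) (Fin n) ℝ :=
  Matrix.of fun i j =>
    coordMetric g c y (EuclideanSpace.single i 1) (EuclideanSpace.single j 1)

/-- The scalar curvature `R_g : M → ℝ`; its value at `x` is computed in the chart at `x`. -/
def scalarCurvature (g : Riem n M) (x : M) : ℝ :=
  coordScalarCurvature (coordMatrix g x) (extChartAt (𝓡 n) x x)

variable (n M) in
/-- The set `Riem⁺(M)` of Riemannian metrics of positive scalar curvature. -/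
def RiemPos : Set (Riem n M) := {g | ∀ x, 0 < scalarCurvature g x}

/-- Two metrics are isotopic if they can be joined by a path in `Riem⁺(M)`, where `Riem(M)` carries
the `C^k` topology. -/
def Isotopic (k : ℕ) (g₀ g₁ : Riem n M) : Prop :=
  @JoinedIn (Riem n M) (ckTopology k) (RiemPos n M) g₀ g₁

end Curvature

/-! ### Spheres and the round metric -/

/-- The unit sphere `Sⁿ` in `ℝⁿ⁺¹`. -/
abbrev S (n : ℕ) : Type := sphere (0 : EuclideanSpace ℝ (Fin (n + 1))) 1

/-- The differential of the inclusion `Sⁿ → ℝⁿ⁺¹`. -/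
def dIncl (n : ℕ) (x : S n) : TangentSpace (𝓡 n) x →L[ℝ] EuclideanSpace ℝ (Fin (n + 1)) :=
  mvfderiv (𝓡 n) ((↑) : S n → EuclideanSpace ℝ (Fin (n + 1))) x

theorem dIncl_injective (n : ℕ) (x : S n) : Function.Injective (dIncl n x) := by
  have := Fact.mk (@finrank_euclideanSpace_fin ℝ _ (n + 1))
  exact injective_mvfderiv_subtypeVal_sphere x

/-- The bilinear form `(v, w) ↦ ⟨v, w⟩` on the tangent space of `Sⁿ` at `x`, induced from
`ℝⁿ⁺¹`. -/
def roundInner (n : ℕ) (x : S n) :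
    TangentSpace (𝓡 n) x →L[ℝ] TangentSpace (𝓡 n) x →L[ℝ] ℝ :=
  (ContinuousLinearMap.precomp ℝ (dIncl n x)).comp
    ((innerSL ℝ (E := EuclideanSpace ℝ (Fin (n + 1)))).comp (dIncl n x))

theorem roundInner_apply (n : ℕ) (x : S n) (v w : TangentSpace (𝓡 n) x) :
    roundInner n x v w = inner ℝ (dIncl n x v) (dIncl n x w) := rfl

theorem contMDiff_roundInner (n : ℕ) :
    ContMDiff (𝓡 n) ((𝓡 n).prod
      𝓘(ℝ, EuclideanSpace ℝ (Fin n) →L[ℝ] EuclideanSpace ℝ (Fin n) →L[ℝ] ℝ)) ∞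
      (fun x : S n => Bundle.TotalSpace.mk'
        (EuclideanSpace ℝ (Fin n) →L[ℝ] EuclideanSpace ℝ (Fin n) →L[ℝ] ℝ)
        (E := fun x : S n => TangentSpace (𝓡 n) x →L[ℝ] TangentSpace (𝓡 n) x →L[ℝ] ℝ)
        x (roundInner n x)) := by
  have := Fact.mk (@finrank_euclideanSpace_fin ℝ _ (n + 1))
  intro x₀
  rw [Bundle.contMDiffAt_section]
  have h1 := ContMDiffAt.mfderiv_const (m := ∞) (n := ∞)
    (contMDiff_coe_sphere (n := n) (E := EuclideanSpace ℝ (Fin (n + 1))) x₀) le_rfl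
  generalize hT : inTangentCoordinates (𝓡 n) 𝓘(ℝ, EuclideanSpace ℝ (Fin (n + 1))) id
    (fun x : S n => (x : EuclideanSpace ℝ (Fin (n + 1))))
    (mfderiv (𝓡 n) 𝓘(ℝ, EuclideanSpace ℝ (Fin (n + 1)))
      (fun x : S n => (x : EuclideanSpace ℝ (Fin (n + 1))))) x₀ = T at h1
  have h2 := h1.clm_precomp (F₃ := ℝ)
  let B : EuclideanSpace ℝ (Fin (n + 1)) →L[ℝ] EuclideanSpace ℝ (Fin (n + 1)) →L[ℝ] ℝ :=
    innerSL ℝ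
  have h3 := (contMDiffAt_const (I := 𝓡 n) (x := x₀) (n := ∞)
    (c := B)).clm_comp h1
  have h4 := h2.clm_comp h3
  refine h4.congr_of_eventuallyEq ?_
  filter_upwards [(trivializationAt (EuclideanSpace ℝ (Fin n))
      (TangentSpace (𝓡 n) (M := S n)) x₀).open_baseSet.mem_nhds
      (FiberBundle.mem_baseSet_trivializationAt' x₀)] with x hx
  ext v w
  have key : ∀ v, T x v = dIncl n x ((trivializationAt (EuclideanSpace ℝ (Fin n))
      (TangentSpace (𝓡 n) (M := S n)) x₀).symm x v) := by
    intro v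
    rw [← hT]
    simp [inTangentCoordinates, ContinuousLinearMap.inCoordinates]
    rw [← Bundle.Trivialization.symmL_apply (R := ℝ) _ hx]
    rfl
  rw [hom_trivializationAt_apply]
  refine (inCoordinates_apply_eq₂ hx hx (mem_univ _)).trans ?_
  simp only [roundInner_apply]
  change _ = inner ℝ (T x v) (T x w)
  rw [key, key]
  simp

/-- The round metric `ds_n²` of radius one, induced on `Sⁿ` by the inclusion in `ℝⁿ⁺¹`. -/
def roundMetric (n : ℕ) : Riem n (S n) where
  inner x := roundInner n x
  symm x v w := real_inner_comm (dIncl n x w) (dIncl n x v)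
  pos x v hv := (real_inner_self_pos (x := dIncl n x v)).2 fun h =>
    hv (dIncl_injective n x (by rw [h, map_zero]))
  isVonNBounded x := by
    let D : EuclideanSpace ℝ (Fin n) →L[ℝ] EuclideanSpace ℝ (Fin (n + 1)) := dIncl n x
    obtain ⟨K, hK, hD⟩ := D.toLinearMap.injective_iff_antilipschitz.1 (dIncl_injective n x)
    change Bornology.IsVonNBounded ℝ {v : EuclideanSpace ℝ (Fin n) | inner ℝ (D v) (D v) < (1 : ℝ)}
    refine (NormedSpace.isVonNBounded_closedBall ℝ (EuclideanSpace ℝ (Fin n)) (K : ℝ)).subset ?_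
    intro v hv
    have hv' : ‖D v‖ ^ 2 < 1 := by
      rw [← real_inner_self_eq_norm_sq]; exact hv
    have h1 : ‖D v‖ ≤ 1 := by nlinarith [norm_nonneg (D v)]
    have h2 := hD.le_mul_dist v 0
    simp only [ContinuousLinearMap.coe_coe, map_zero, dist_zero_right] at h2
    rw [mem_closedBall_zero_iff]
    exact h2.trans (mul_le_of_le_one_right K.2 h1)
  contMDiff := contMDiff_roundInner n

/-! ### Doubly warped product metrics on `Sⁿ` -/

/-- The point `(x, y)` of `ℝᵖ⁺¹ × ℝ^{q+1} = ℝⁿ⁺¹`, where `p + q + 1 = n`. -/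
def join {n p q : ℕ} (h : p + q + 1 = n) (x : EuclideanSpace ℝ (Fin (p + 1)))
    (y : EuclideanSpace ℝ (Fin (q + 1))) : EuclideanSpace ℝ (Fin (n + 1)) :=
  WithLp.toLp 2 fun i => Fin.append x.ofLp y.ofLp (Fin.cast (by omega) i)

theorem norm_join_sq {n p q : ℕ} (h : p + q + 1 = n) (x : EuclideanSpace ℝ (Fin (p + 1)))
    (y : EuclideanSpace ℝ (Fin (q + 1))) : ‖join h x y‖ ^ 2 = ‖x‖ ^ 2 + ‖y‖ ^ 2 := by
  rw [EuclideanSpace.norm_sq_eq, EuclideanSpace.norm_sq_eq, EuclideanSpace.norm_sq_eq]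
  have e : n + 1 = (p + 1) + (q + 1) := by omega
  rw [Fintype.sum_equiv (finCongr e) (fun i => ‖(join h x y).ofLp i‖ ^ 2)
    (fun j => ‖Fin.append x.ofLp y.ofLp j‖ ^ 2) (fun i => rfl), Fin.sum_univ_add]
  simp

/-- The map `(t, φ, θ) ↦ (cos (πt/2b) φ, sin (πt/2b) θ)`. It restricts to a diffeomorphism from
`(0, b) × Sᵖ × S^q` onto the complement in `Sⁿ` of the two subspheres `Sᵖ × {0}` and
`{0} × S^q`, and it is used to regard metrics on `(0, b) × Sᵖ × S^q` as metrics on `Sⁿ`. -/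
def warpMap {n p q : ℕ} (h : p + q + 1 = n) (b : ℝ) (z : ℝ × S p × S q) : S n :=
  ⟨join h (Real.cos (Real.pi * z.1 / (2 * b)) • (z.2.1 : EuclideanSpace ℝ (Fin (p + 1))))
      (Real.sin (Real.pi * z.1 / (2 * b)) • (z.2.2 : EuclideanSpace ℝ (Fin (q + 1)))), by
    rw [mem_sphere_zero_iff_norm, ← sq_eq_sq₀ (norm_nonneg _) zero_le_one, norm_join_sq,
      norm_smul, norm_smul, norm_eq_of_mem_sphere, norm_eq_of_mem_sphere]
    simp⟩

/-- The metric `g` on `Sⁿ` is the doubly warped product metric `dt² + u(t)² ds_p² + v(t)² ds_q²`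
on `(0, b) × Sᵖ × S^q`. -/
def IsDoublyWarped {n p q : ℕ} (h : p + q + 1 = n) (b : ℝ) (u v : ℝ → ℝ) (g : Riem n (S n)) :
    Prop :=
  ∀ t ∈ Ioo 0 b, ∀ (φ : S p) (θ : S q),
    ∀ ξ η : TangentSpace (𝓘(ℝ, ℝ).prod ((𝓡 p).prod (𝓡 q))) ((t, φ, θ) : ℝ × S p × S q),
      g.inner (warpMap h b (t, φ, θ))
          (mfderiv (𝓘(ℝ, ℝ).prod ((𝓡 p).prod (𝓡 q))) (𝓡 n) (warpMap h b) (t, φ, θ) ξ)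
          (mfderiv (𝓘(ℝ, ℝ).prod ((𝓡 p).prod (𝓡 q))) (𝓡 n) (warpMap h b) (t, φ, θ) η)
        = ξ.1 * η.1 + u t ^ 2 * (roundMetric p).inner φ ξ.2.1 η.2.1
          + v t ^ 2 * (roundMetric q).inner θ ξ.2.2 η.2.2

/-- The space `U(0, b)` of concave smooth functions `u`, positive on `(0, b)`, with `u(0) > 0`,
all derivatives of odd order zero at `0`, first derivative `-1` at `b`, all derivatives of even
order zero at `b` (in particular `u(b) = 0`), second derivative negative near but not at `b`, and
third derivative positive at `b`. Derivatives at the endpoints are one-sided. -/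
structure MemU (b : ℝ) (u : ℝ → ℝ) : Prop where
  smooth : ContDiffOn ℝ ∞ u (Icc 0 b)
  pos : ∀ t ∈ Ioo 0 b, 0 < u t
  pos_left : 0 < u 0
  odd_left : ∀ j : ℕ, Odd j → iteratedDerivWithin j u (Icc 0 b) 0 = 0
  deriv_right : derivWithin u (Icc 0 b) b = -1
  even_right : ∀ j : ℕ, Even j → iteratedDerivWithin j u (Icc 0 b) b = 0
  concave : ∀ t ∈ Icc 0 b, iteratedDerivWithin 2 u (Icc 0 b) t ≤ 0
  strict : ∀ᶠ t in 𝓝[<] b, iteratedDerivWithin 2 u (Icc 0 b) t < 0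
  third : 0 < iteratedDerivWithin 3 u (Icc 0 b) b

/-- The space `V(0, b)` of concave smooth functions `v`, positive on `(0, b)`, with `v(b) > 0`,
all derivatives of odd order zero at `b`, first derivative `1` at `0`, all derivatives of even
order zero at `0` (in particular `v(0) = 0`), second derivative negative near but not at `0`, and
third derivative negative at `0`. Derivatives at the endpoints are one-sided. -/
structure MemV (b : ℝ) (v : ℝ → ℝ) : Prop where
  smooth : ContDiffOn ℝ ∞ v (Icc 0 b)
  pos : ∀ t ∈ Ioo 0 b, 0 < v t
  pos_right : 0 < v b
  odd_right : ∀ j : ℕ, Odd j → iteratedDerivWithin j v (Icc 0 b) b = 0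
  deriv_left : derivWithin v (Icc 0 b) 0 = 1
  even_left : ∀ j : ℕ, Even j → iteratedDerivWithin j v (Icc 0 b) 0 = 0
  concave : ∀ t ∈ Icc 0 b, iteratedDerivWithin 2 v (Icc 0 b) t ≤ 0
  strict : ∀ᶠ t in 𝓝[>] 0, iteratedDerivWithin 2 v (Icc 0 b) t < 0
  third : iteratedDerivWithin 3 v (Icc 0 b) 0 < 0

/-- The space `Ŵ^{p,q}(0, b)` of doubly warped product metrics on `Sⁿ`, as a set of metrics. -/
def warpedMetrics {n p q : ℕ} (h : p + q + 1 = n) (b : ℝ) : Set (Riem n (S n)) :=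
  {g | ∃ u v : ℝ → ℝ, MemU b u ∧ MemV b v ∧ IsDoublyWarped h b u v g}

/-- `f` is a `δ`-torpedo function on `(0, ∞)`. -/
structure IsTorpedo (δ : ℝ) (f : ℝ → ℝ) : Prop where
  smooth : ContDiffOn ℝ ∞ f (Ioi 0)
  near_zero : ∀ᶠ t in 𝓝[>] 0, f t = δ * Real.sin (t / δ)
  tube : ∀ t, δ * (Real.pi / 2) ≤ t → f t = δ
  concave : ∀ t, 0 < t → iteratedDeriv 2 f t ≤ 0

/-- `g` is the mixed torpedo metric `g_Mtor^{p,q}` on `Sⁿ` given by the torpedo functions `f_ε` and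
`f_δ`, that is `dt² + f_ε(b - t)² ds_p² + f_δ(t)² ds_q²` on `(0, b) × Sᵖ × S^q`. -/
def IsMixedTorpedo {n p q : ℕ} (h : p + q + 1 = n) (b : ℝ) (fε fδ : ℝ → ℝ) (g : Riem n (S n)) :
    Prop :=
  IsDoublyWarped h b (fun t => fε (b - t)) fδ g

end WarpedSphere

end

/-! Smooth extension. Write points of the sphere as (x, y) in ℝᵖ⁺¹ × ℝ^{q+1}, and put S = |y|². A
doubly warped metric is the restriction of A|dx|² + B|dy|² + C(x·dx)² with A, B, C functions of S,
subject to three scalar equations: A(1-S) = u², BS = v² and AS + B(1-S) + CS(1-S) = (2b/π)². The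
last one makes the coefficient of dt² equal to 1. It remains to solve for A, B, C smoothly up to S =
0 and S = 1. With r = t/b = (2/π) arcsin √S, the square r² is smooth in S near 0, and by Whitney's
theorem (`IsEvenAtZero.contDiffOn_sqrt`) an even smooth function of r is a smooth function of r².
Parity of the warping functions gives A and B, and the slope condition makes the numerator of C
vanish where its denominator does. Positivity follows from Cauchy–Schwarz (`ambientForm_pos`), and
uniqueness from density of the image of (0, b) × Sᵖ × S^q.

Connectedness. Rescale the interval to [0, 1], so that u and v become profiles whose end slopes have
absolute value b. The defining conditions are linear equations and convex inequalities, hence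
profiles may be combined convexly, with b combined in the same way (`IsProfile.convex_combination`).
At a fixed point of the sphere the metric is linear in (b², u², v²) (`sum_coordMetric_eq_zero`).
Along a segment of profiles these three quantities are quadratic polynomials in s, so the metric at
time s is the Lagrange interpolation of the metrics at times 0, 1/2 and 1. The path lies in the span
of three fixed smooth metrics, with continuous coefficients, and so it is continuous in the C^k
topology for every k (`exists_path`).

Positive scalar curvature. The scalar curvature is given by `warpScal`. Concavity and the boundary
conditions yield -1 < u' ≤ 0 ≤ v' < 1 and u'', v'' ≤ 0 inside (0, b), so every summand is
nonnegative. Since p or q is at least 2, the corresponding term in 1 - u'² or 1 - v'² is strictly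
positive. On the two singular subspheres scalar curvature is obtained as a limit, and needs a
uniform lower bound nearby. At t = 0 the bound comes from (1 - u'²)/u² if p ≥ 2, and otherwise from
-v''/v, using v'''(0) < 0; the end t = b is symmetric. Relating the formula to the coordinate
definition requires the invariance of curvature under pullback (`IsPullbackNear.curv_eq`) and a
computation in stereographic coordinates.

Torpedo metrics. A mixed torpedo metric belongs to the space for its own b, and the round metric to
the space for b = π/2 with u = cos, v = sin. The path between them runs through spaces of varying b,
all of positive scalar curvature. -/

set_option maxSynthPendingDepth 3
set_option linter.unusedSectionVars false

noncomputable section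

namespace WarpedSphere

/-! ### Christoffel symbols and curvature of a field of bilinear forms, without coordinates -/

section AbstractCurvature

variable {E F : Type*} [NormedAddCommGroup E] [NormedSpace ℝ E] [NormedAddCommGroup F]
  [NormedSpace ℝ F]

/-- The lowered Christoffel symbols of a field of bilinear forms on a vector space. -/
def koszul (G : E → E →L[ℝ] E →L[ℝ] ℝ) (y : E) : E →L[ℝ] E →L[ℝ] E →L[ℝ] ℝ :=
  (1 / 2 : ℝ) • (fderiv ℝ G y + (fderiv ℝ G y).flip
    - ((ContinuousLinearMap.flipₗᵢ ℝ E E ℝ).toContinuousLinearEquiv :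
      (E →L[ℝ] E →L[ℝ] ℝ) →L[ℝ] E →L[ℝ] E →L[ℝ] ℝ).comp
      (fderiv ℝ G y).flip)

theorem koszul_apply (G : E → E →L[ℝ] E →L[ℝ] ℝ) (y ξ η ζ : E) :
    koszul G y ξ η ζ = (1 / 2) * (fderiv ℝ G y ξ η ζ + fderiv ℝ G y η ξ ζ
      - fderiv ℝ G y ζ ξ η) := by
  simp [koszul]

/-- The Christoffel symbols of a field of bilinear forms, as a field of bilinear maps. -/
def chris (G : E → E →L[ℝ] E →L[ℝ] ℝ) (y : E) : E →L[ℝ] E →L[ℝ] E :=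
  (ContinuousLinearMap.compL ℝ E (E →L[ℝ] ℝ) E (G y).inverse).comp (koszul G y)

theorem chris_apply (G : E → E →L[ℝ] E →L[ℝ] ℝ) (y ξ η : E) :
    chris G y ξ η = (G y).inverse (koszul G y ξ η) := rfl

/-- `G` is a smooth symmetric nondegenerate field of bilinear forms near `y`. -/
structure IsMetricNear (G : E → E →L[ℝ] E →L[ℝ] ℝ) (y : E) : Prop where
  smooth : ∀ᶠ z in 𝓝 y, ContDiffAt ℝ ∞ G z
  symm : ∀ᶠ z in 𝓝 y, ∀ ξ η, G z ξ η = G z η ξ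
  pos : ∀ᶠ z in 𝓝 y, ∀ ξ, ξ ≠ 0 → 0 < G z ξ ξ

theorem IsMetricNear.eventually {G : E → E →L[ℝ] E →L[ℝ] ℝ} {y : E} (h : IsMetricNear G y) :
    ∀ᶠ z in 𝓝 y, IsMetricNear G z := by
  filter_upwards [h.smooth.eventually_nhds, h.symm.eventually_nhds,
    h.pos.eventually_nhds] with z h1 h2 h3
  exact ⟨h1, h2, h3⟩

theorem eq_zero_of_form_eq_zero {B : E →L[ℝ] E →L[ℝ] ℝ} (hB : ∀ ξ, ξ ≠ 0 → 0 < B ξ ξ) {ξ : E}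
    (h : ∀ η, B ξ η = 0) : ξ = 0 := by
  by_contra hne
  exact (hB ξ hne).ne' (h ξ)

variable [FiniteDimensional ℝ E] [FiniteDimensional ℝ F]

/-- A positive definite bilinear form as an isomorphism onto the dual space. -/
theorem exists_equiv_of_pos {B : E →L[ℝ] E →L[ℝ] ℝ} (hB : ∀ ξ, ξ ≠ 0 → 0 < B ξ ξ) :
    ∃ e : E ≃L[ℝ] (E →L[ℝ] ℝ), (e : E →L[ℝ] E →L[ℝ] ℝ) = B := by
  have hinj : Function.Injective B.toLinearMap := by
    rw [← LinearMap.ker_eq_bot, LinearMap.ker_eq_bot']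
    intro ξ h
    exact eq_zero_of_form_eq_zero hB fun η => by
      have := congrArg (fun L : E →L[ℝ] ℝ => L η) h
      simpa using this
  have hdim : Module.finrank ℝ E = Module.finrank ℝ (E →L[ℝ] ℝ) := by
    rw [← (LinearMap.toContinuousLinearMap (𝕜 := ℝ) (E := E) (F' := ℝ)).finrank_eq]
    exact (Subspace.dual_finrank_eq (K := ℝ) (V := E)).symm
  refine ⟨(LinearEquiv.ofInjectiveOfFinrankEq B.toLinearMap hinj hdim).toContinuousLinearEquiv,
    ?_⟩
  ext ξ η
  rfl

theorem chris_spec {G : E → E →L[ℝ] E →L[ℝ] ℝ} {y : E} (hG : ∀ ξ, ξ ≠ 0 → 0 < G y ξ ξ)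
    (ξ η ζ : E) : G y (chris G y ξ η) ζ = (1 / 2) * (fderiv ℝ G y ξ η ζ + fderiv ℝ G y η ξ ζ
      - fderiv ℝ G y ζ ξ η) := by
  obtain ⟨e, he⟩ := exists_equiv_of_pos hG
  rw [chris_apply, ← koszul_apply, ← he, ContinuousLinearMap.inverse_equiv]
  simp

theorem chris_unique {G : E → E →L[ℝ] E →L[ℝ] ℝ} {y : E} (hG : ∀ ξ, ξ ≠ 0 → 0 < G y ξ ξ)
    {ξ η w : E} (h : ∀ ζ, G y w ζ = (1 / 2) * (fderiv ℝ G y ξ η ζ + fderiv ℝ G y η ξ ζ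
      - fderiv ℝ G y ζ ξ η)) : chris G y ξ η = w := by
  rw [← sub_eq_zero]
  refine eq_zero_of_form_eq_zero hG fun ζ => ?_
  rw [map_sub, sub_apply, chris_spec hG, h, sub_self]

theorem contDiffAt_chris {G : E → E →L[ℝ] E →L[ℝ] ℝ} {y : E} (h : IsMetricNear G y) :
    ContDiffAt ℝ ∞ (chris G) y := by
  have h1 : ContDiffAt ℝ ∞ (fderiv ℝ G) y := h.smooth.self_of_nhds.fderiv_right (by simp)
  have h2 : ContDiffAt ℝ ∞ (koszul G) y := by
    unfold koszul
    have hf : ContDiffAt ℝ ∞ (fun y => (fderiv ℝ G y).flip) y :=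
      (ContinuousLinearMap.flipₗᵢ ℝ E E (E →L[ℝ] ℝ)).contDiff.contDiffAt.comp y h1
    exact ((h1.add hf).sub (contDiffAt_const.clm_comp hf)).const_smul _
  -- Inversion of operators is smooth at an isomorphism, and positive definiteness in finite
  -- dimension makes G y one.
  obtain ⟨e, he⟩ := exists_equiv_of_pos h.pos.self_of_nhds
  have h3 : ContDiffAt ℝ ∞ (fun y => (G y).inverse) y := by
    have := contDiffAt_map_inverse (𝕜 := ℝ) (n := ∞) e
    rw [he] at this
    exact this.comp y h.smooth.self_of_nhds
  exact ((ContinuousLinearMap.compL ℝ E (E →L[ℝ] ℝ) E).contDiff.contDiffAt.comp y h3).clm_comp h2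

/-- The curvature operator `R(ξ, η) ζ` of a field of bilinear forms. -/
def curv (G : E → E →L[ℝ] E →L[ℝ] ℝ) (y ξ η ζ : E) : E :=
  fderiv ℝ (chris G) y ξ η ζ - fderiv ℝ (chris G) y η ξ ζ
    + (chris G y ξ (chris G y η ζ) - chris G y η (chris G y ξ ζ))

/-- The scalar curvature computed in a frame `e`, which should be orthonormal for `G y`. -/
def scal {ι : Type*} [Fintype ι] (G : E → E →L[ℝ] E →L[ℝ] ℝ) (y : E) (e : ι → E) : ℝ :=
  ∑ a, ∑ b, G y (curv G y (e a) (e b) (e b)) (e a)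

end AbstractCurvature

theorem two_le_infty : (2 : WithTop ℕ∞) ≤ ∞ := by
  exact WithTop.coe_le_coe.2 (le_top : (2 : ℕ∞) ≤ ⊤)

/-! ### Invariance of curvature under pullback -/

section Invariance

variable {E F : Type*} [NormedAddCommGroup E] [NormedSpace ℝ E] [NormedAddCommGroup F]
  [NormedSpace ℝ F] [FiniteDimensional ℝ E] [FiniteDimensional ℝ F]

/-- `H` is, near `z`, the pullback of `G` by the smooth map `ψ`. -/
structure IsPullbackNear (G : E → E →L[ℝ] E →L[ℝ] ℝ) (H : F → F →L[ℝ] F →L[ℝ] ℝ) (ψ : F → E)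
    (z : F) : Prop where
  smooth : ∀ᶠ y in 𝓝 z, ContDiffAt ℝ ∞ ψ y
  eq : ∀ᶠ y in 𝓝 z, ∀ ξ η, H y ξ η = G (ψ y) (fderiv ℝ ψ y ξ) (fderiv ℝ ψ y η)
  target : IsMetricNear G (ψ z)
  source : IsMetricNear H z
  finrank : Module.finrank ℝ F = Module.finrank ℝ E

variable {G : E → E →L[ℝ] E →L[ℝ] ℝ} {H : F → F →L[ℝ] F →L[ℝ] ℝ} {ψ : F → E} {z : F}

theorem IsPullbackNear.eventually (h : IsPullbackNear G H ψ z) :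
    ∀ᶠ y in 𝓝 z, IsPullbackNear G H ψ y := by
  filter_upwards [h.smooth.eventually_nhds, h.eq.eventually_nhds,
    h.smooth.self_of_nhds.continuousAt.eventually h.target.eventually, h.source.eventually]
    with y h1 h2 h3 h4
  exact ⟨h1, h2, h3, h4, h.finrank⟩

/-- A vector killed by dψ is H-orthogonal to everything, so positivity of H gives injectivity; equal
dimensions do the rest. No local inverse of ψ is needed. -/
theorem IsPullbackNear.surjective (h : IsPullbackNear G H ψ z) :
    Function.Surjective (fderiv ℝ ψ z) := by
  have hinj : Function.Injective (fderiv ℝ ψ z).toLinearMap := by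
    rw [← LinearMap.ker_eq_bot, LinearMap.ker_eq_bot']
    intro ξ hξ
    refine eq_zero_of_form_eq_zero h.source.pos.self_of_nhds fun η => ?_
    rw [h.eq.self_of_nhds]
    have : fderiv ℝ ψ z ξ = 0 := hξ
    simp [this]
  exact (LinearMap.injective_iff_surjective_of_finrank_eq_finrank h.finrank).1 hinj

/-- The classical transformation law. Differentiating H = ψ*G produces terms in D²ψ, and in the
Koszul combination all of them cancel by symmetry of D²ψ except the one in D²ψ(ξ, η). Testing
against vectors dψ ζ suffices because dψ is surjective. -/
theorem IsPullbackNear.chris_eq (h : IsPullbackNear G H ψ z) (ξ η : F) :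
    fderiv ℝ ψ z (chris H z ξ η) = chris G (ψ z) (fderiv ℝ ψ z ξ) (fderiv ℝ ψ z η)
      + fderiv ℝ (fderiv ℝ ψ) z ξ η := by
  have hψ := h.smooth.self_of_nhds
  have hd : HasFDerivAt ψ (fderiv ℝ ψ z) z := (hψ.differentiableAt (by simp)).hasFDerivAt
  have hdd : HasFDerivAt (fderiv ℝ ψ) (fderiv ℝ (fderiv ℝ ψ) z) z :=
    ((hψ.fderiv_right (m := ∞) (by simp)).differentiableAt (by simp)).hasFDerivAt
  have hG : HasFDerivAt G (fderiv ℝ G (ψ z)) (ψ z) :=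
    (h.target.smooth.self_of_nhds.differentiableAt (by simp)).hasFDerivAt
  have hsymm : ∀ ξ η, fderiv ℝ (fderiv ℝ ψ) z ξ η = fderiv ℝ (fderiv ℝ ψ) z η ξ := fun ξ η =>
    (hψ.isSymmSndFDerivAt (by simpa using two_le_infty)) ξ η
  have hGs := h.target.symm.self_of_nhds
  have hH : ∀ κ ξ η, fderiv ℝ H z κ ξ η
      = fderiv ℝ G (ψ z) (fderiv ℝ ψ z κ) (fderiv ℝ ψ z ξ) (fderiv ℝ ψ z η)
        + G (ψ z) (fderiv ℝ (fderiv ℝ ψ) z κ ξ) (fderiv ℝ ψ z η)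
        + G (ψ z) (fderiv ℝ ψ z ξ) (fderiv ℝ (fderiv ℝ ψ) z κ η) := by
    intro κ ξ η
    have e1 : fderiv ℝ H z κ ξ η = fderiv ℝ (fun y => H y ξ η) z κ := by
      have := (h.source.smooth.self_of_nhds.differentiableAt (by simp)).hasFDerivAt
      have := (this.clm_apply (hasFDerivAt_const ξ z)).clm_apply (hasFDerivAt_const η z)
      rw [this.fderiv]; simp
    have e2 : (fun y => H y ξ η) =ᶠ[𝓝 z]
        fun y => G (ψ y) (fderiv ℝ ψ y ξ) (fderiv ℝ ψ y η) := h.eq.mono fun y hy => hy ξ η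
    have e3 := ((hG.comp z hd).clm_apply (hdd.clm_apply (hasFDerivAt_const ξ z))).clm_apply
      (hdd.clm_apply (hasFDerivAt_const η z))
    simp only [Function.comp_def] at e3
    rw [e1, e2.fderiv_eq, HasFDerivAt.fderiv e3]
    simp
    ring
  rw [← sub_eq_zero]
  refine eq_zero_of_form_eq_zero h.target.pos.self_of_nhds fun w => ?_
  obtain ⟨ζ, rfl⟩ := h.surjective w
  have k1 := chris_spec h.source.pos.self_of_nhds ξ η ζ
  rw [h.eq.self_of_nhds, hH, hH, hH] at k1
  have k2 := chris_spec h.target.pos.self_of_nhds (fderiv ℝ ψ z ξ) (fderiv ℝ ψ z η)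
    (fderiv ℝ ψ z ζ)
  rw [map_sub, map_add, sub_apply, add_apply, k1, k2, hsymm η ξ, hsymm ζ ξ, hsymm ζ η,
    hGs (fderiv ℝ ψ z η) (fderiv ℝ (fderiv ℝ ψ) z ξ ζ),
    hGs (fderiv ℝ ψ z ξ) (fderiv ℝ (fderiv ℝ ψ) z η ζ)]
  ring

/-- Differentiate the transformation law once more and antisymmetrise. The third derivatives of ψ
cancel by symmetry, and the second derivatives are absorbed by applying the law itself to the
products of Christoffel symbols. -/
theorem IsPullbackNear.curv_eq (h : IsPullbackNear G H ψ z) (ξ η ζ : F) :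
    fderiv ℝ ψ z (curv H z ξ η ζ)
      = curv G (ψ z) (fderiv ℝ ψ z ξ) (fderiv ℝ ψ z η) (fderiv ℝ ψ z ζ) := by
  have hψ := h.smooth.self_of_nhds
  have hψ1 : ContDiffAt ℝ ∞ (fderiv ℝ ψ) z := hψ.fderiv_right (m := ∞) (by simp)
  have hd : HasFDerivAt ψ (fderiv ℝ ψ z) z := (hψ.differentiableAt (by simp)).hasFDerivAt
  have hdd : HasFDerivAt (fderiv ℝ ψ) (fderiv ℝ (fderiv ℝ ψ) z) z :=
    (hψ1.differentiableAt (by simp)).hasFDerivAt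
  have hddd : HasFDerivAt (fderiv ℝ (fderiv ℝ ψ)) (fderiv ℝ (fderiv ℝ (fderiv ℝ ψ)) z) z :=
    ((hψ1.fderiv_right (m := ∞) (by simp)).differentiableAt (by simp)).hasFDerivAt
  have hsymm : ∀ ξ η, fderiv ℝ (fderiv ℝ ψ) z ξ η = fderiv ℝ (fderiv ℝ ψ) z η ξ := fun ξ η =>
    (hψ.isSymmSndFDerivAt (by simpa using two_le_infty)) ξ η
  have hsymm3 : ∀ ξ η, fderiv ℝ (fderiv ℝ (fderiv ℝ ψ)) z ξ η
      = fderiv ℝ (fderiv ℝ (fderiv ℝ ψ)) z η ξ := fun ξ η =>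
    (hψ1.isSymmSndFDerivAt (by simpa using two_le_infty)) ξ η
  have hΓ : HasFDerivAt (chris G) (fderiv ℝ (chris G) (ψ z)) (ψ z) :=
    ((contDiffAt_chris h.target).differentiableAt (by simp)).hasFDerivAt
  have hΓ' : HasFDerivAt (chris H) (fderiv ℝ (chris H) z) z :=
    ((contDiffAt_chris h.source).differentiableAt (by simp)).hasFDerivAt
  have key : ∀ κ ξ η, fderiv ℝ (fderiv ℝ ψ) z κ (chris H z ξ η)
      + fderiv ℝ ψ z (fderiv ℝ (chris H) z κ ξ η)
      = fderiv ℝ (chris G) (ψ z) (fderiv ℝ ψ z κ) (fderiv ℝ ψ z ξ) (fderiv ℝ ψ z η)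
        + chris G (ψ z) (fderiv ℝ (fderiv ℝ ψ) z κ ξ) (fderiv ℝ ψ z η)
        + chris G (ψ z) (fderiv ℝ ψ z ξ) (fderiv ℝ (fderiv ℝ ψ) z κ η)
        + fderiv ℝ (fderiv ℝ (fderiv ℝ ψ)) z κ ξ η := by
    intro κ ξ η
    have e1 := hdd.clm_apply ((hΓ'.clm_apply (hasFDerivAt_const ξ z)).clm_apply
      (hasFDerivAt_const η z))
    have e2 : (fun y => fderiv ℝ ψ y (chris H y ξ η)) =ᶠ[𝓝 z]
        fun y => chris G (ψ y) (fderiv ℝ ψ y ξ) (fderiv ℝ ψ y η)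
          + fderiv ℝ (fderiv ℝ ψ) y ξ η := h.eventually.mono fun y hy => hy.chris_eq ξ η
    have e3 := (((hΓ.comp z hd).clm_apply (hdd.clm_apply (hasFDerivAt_const ξ z))).clm_apply
      (hdd.clm_apply (hasFDerivAt_const η z))).add
      ((hddd.clm_apply (hasFDerivAt_const ξ z)).clm_apply (hasFDerivAt_const η z))
    have e4 := congrArg (fun L : F →L[ℝ] E => L κ)
      (e1.unique (HasFDerivAt.congr_of_eventuallyEq e3 e2))
    simp at e4
    rw [add_comm, e4]
    abel
  have k1 := key ξ η ζ
  have k2 := key η ξ ζ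
  unfold curv
  have c1 := h.chris_eq ξ (chris H z η ζ)
  have c2 := h.chris_eq η (chris H z ξ ζ)
  rw [h.chris_eq η ζ, map_add] at c1
  rw [h.chris_eq ξ ζ, map_add] at c2
  simp only [map_add, map_sub]
  rw [c1, c2]
  rw [hsymm3 η ξ, hsymm η ξ] at k2
  have := congrArg₂ (· - ·) k1 k2
  rw [← sub_eq_zero] at this ⊢
  rw [← this]
  abel

theorem IsPullbackNear.scal_eq {ι : Type*} [Fintype ι] (h : IsPullbackNear G H ψ z) (e : ι → F) :
    scal H z e = scal G (ψ z) (fun i => fderiv ℝ ψ z (e i)) := by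
  simp only [scal, ← h.curv_eq, h.eq.self_of_nhds]

end Invariance

/-! ### Linearity of the curvature operator in each argument -/

section CurvLinear

variable {E : Type*} [NormedAddCommGroup E] [NormedSpace ℝ E] [FiniteDimensional ℝ E]

theorem isLinearMap_curv_left (G : E → E →L[ℝ] E →L[ℝ] ℝ) (y η ζ : E) :
    IsLinearMap ℝ fun ξ => curv G y ξ η ζ where
  map_add _ _ := by simp [curv]; abel
  map_smul _ _ := by simp [curv, smul_sub, smul_add]

theorem isLinearMap_curv_middle (G : E → E →L[ℝ] E →L[ℝ] ℝ) (y ξ ζ : E) :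
    IsLinearMap ℝ fun η => curv G y ξ η ζ where
  map_add _ _ := by simp [curv]; abel
  map_smul _ _ := by simp [curv, smul_sub, smul_add]

theorem isLinearMap_curv_right (G : E → E →L[ℝ] E →L[ℝ] ℝ) (y ξ η : E) :
    IsLinearMap ℝ fun ζ => curv G y ξ η ζ where
  map_add _ _ := by simp [curv]; abel
  map_smul _ _ := by simp [curv, smul_sub, smul_add]

theorem scal_comp_equiv {ι κ : Type*} [Fintype ι] [Fintype κ] (G : E → E →L[ℝ] E →L[ℝ] ℝ) (y : E)
    (e : ι → E) (f : κ ≃ ι) : scal G y (e ∘ f) = scal G y e := by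
  simp only [scal, Function.comp_apply]
  rw [← f.sum_comp]
  exact Finset.sum_congr rfl fun a _ => f.sum_comp
    (fun b => G y (curv G y (e (f a)) (e b) (e b)) (e (f a)))

end CurvLinear

/-! ### Agreement with the coordinate formula for scalar curvature -/

section Coordinates

variable {n : ℕ}


theorem euclidean_eq_sum (w : EuclideanSpace ℝ (Fin n)) : w = ∑ m, w m • EuclideanSpace.single m (1 : ℝ) := by
  ext i
  simp [Finset.sum_apply, Pi.single_apply]

/-- The matrix of a field of bilinear forms on `ℝⁿ`. -/
def formMatrix (G : EuclideanSpace ℝ (Fin n) → EuclideanSpace ℝ (Fin n) →L[ℝ] EuclideanSpace ℝ (Fin n) →L[ℝ] ℝ) (y : EuclideanSpace ℝ (Fin n)) : Matrix (Fin n) (Fin n) ℝ :=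
  Matrix.of fun i j => G y (EuclideanSpace.single i 1) (EuclideanSpace.single j 1)

variable {G : EuclideanSpace ℝ (Fin n) → EuclideanSpace ℝ (Fin n) →L[ℝ] EuclideanSpace ℝ (Fin n) →L[ℝ] ℝ} {y : EuclideanSpace ℝ (Fin n)}

theorem form_eq_dotProduct (v w : EuclideanSpace ℝ (Fin n)) :
    G y v w = dotProduct v.ofLp ((formMatrix G y).mulVec w.ofLp) := by
  conv_lhs => rw [euclidean_eq_sum v, euclidean_eq_sum w]
  simp only [map_sum, map_smul, sum_apply, smul_apply,
    dotProduct, Matrix.mulVec, formMatrix, Matrix.of_apply, smul_eq_mul, Finset.mul_sum]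
  rw [Finset.sum_comm]
  refine Finset.sum_congr rfl fun i _ => Finset.sum_congr rfl fun j _ => by ring

theorem isUnit_det_formMatrix (h : ∀ ξ, ξ ≠ 0 → 0 < G y ξ ξ) : IsUnit (formMatrix G y).det := by
  rw [← Matrix.isUnit_iff_isUnit_det, ← Matrix.mulVec_injective_iff_isUnit]
  refine (injective_iff_map_eq_zero' (Matrix.mulVecLin (formMatrix G y))).2 fun w => ⟨fun hw => ?_, fun hw => ?_⟩
  · by_contra hne
    have hne' : (WithLp.toLp 2 w : EuclideanSpace ℝ (Fin n)) ≠ 0 := fun h0 => hne (congrArg WithLp.ofLp h0)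
    have := h _ hne'
    rw [form_eq_dotProduct] at this
    change (formMatrix G y).mulVec w = 0 at hw
    simp [hw] at this
  · rw [hw]; simp

theorem partialDeriv_formMatrix (hG : DifferentiableAt ℝ G y) (i j l : Fin n) :
    partialDeriv i (fun z => formMatrix G z j l) y
      = fderiv ℝ G y (EuclideanSpace.single i 1) (EuclideanSpace.single j 1)
        (EuclideanSpace.single l 1) := by
  have := (hG.hasFDerivAt.clm_apply (hasFDerivAt_const (EuclideanSpace.single j (1 : ℝ)) y)).clm_apply
    (hasFDerivAt_const (EuclideanSpace.single l (1 : ℝ)) y)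
  simp only [partialDeriv, formMatrix, Matrix.of_apply]
  rw [this.fderiv]
  simp

theorem christoffel_formMatrix (h : IsMetricNear G y) (k i j : Fin n) :
    christoffel (formMatrix G) k i j y
      = chris G y (EuclideanSpace.single i 1) (EuclideanSpace.single j 1) k := by
  have hd : DifferentiableAt ℝ G y := h.smooth.self_of_nhds.differentiableAt (by simp)
  set w := chris G y (EuclideanSpace.single i 1) (EuclideanSpace.single j 1) with hw
  have h1 : ∀ l, (1 / 2) * (partialDeriv i (fun z => formMatrix G z j l) y
      + partialDeriv j (fun z => formMatrix G z i l) y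
      - partialDeriv l (fun z => formMatrix G z i j) y)
      = (formMatrix G y).mulVec w.ofLp l := by
    intro l
    rw [partialDeriv_formMatrix hd, partialDeriv_formMatrix hd, partialDeriv_formMatrix hd,
      ← chris_spec h.pos.self_of_nhds, h.symm.self_of_nhds, form_eq_dotProduct]
    simp [dotProduct, hw]
  have h2 : (formMatrix G y)⁻¹.mulVec ((formMatrix G y).mulVec w.ofLp) = w.ofLp := by
    rw [Matrix.mulVec_mulVec, Matrix.nonsing_inv_mul _ (isUnit_det_formMatrix h.pos.self_of_nhds),
      Matrix.one_mulVec]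
  have h3 := congrFun h2 k
  rw [← h3]
  rw [christoffel, Finset.mul_sum, Matrix.mulVec, dotProduct]
  refine Finset.sum_congr rfl fun l _ => ?_
  rw [← h1 l]
  ring

theorem partialDeriv_christoffel (h : IsMetricNear G y) (a k i j : Fin n) :
    partialDeriv a (christoffel (formMatrix G) k i j) y
      = fderiv ℝ (chris G) y (EuclideanSpace.single a 1) (EuclideanSpace.single i 1)
        (EuclideanSpace.single j 1) k := by
  have e : christoffel (formMatrix G) k i j =ᶠ[𝓝 y] fun z =>
      EuclideanSpace.proj (𝕜 := ℝ) k
        (chris G z (EuclideanSpace.single i 1) (EuclideanSpace.single j 1)) := by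
    filter_upwards [h.eventually] with z hz
    rw [christoffel_formMatrix hz]; rfl
  have hc := ((contDiffAt_chris h).differentiableAt (by simp)).hasFDerivAt
  have h1 := (hc.clm_apply (hasFDerivAt_const (EuclideanSpace.single i (1 : ℝ)) y)).clm_apply
    (hasFDerivAt_const (EuclideanSpace.single j (1 : ℝ)) y)
  have h2 := (EuclideanSpace.proj (𝕜 := ℝ) k : EuclideanSpace ℝ (Fin n) →L[ℝ] ℝ).hasFDerivAt.comp y h1
  simp only [Function.comp_def] at h2
  rw [partialDeriv, e.fderiv_eq, HasFDerivAt.fderiv h2]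
  simp

theorem bilin_apply_coord (Γ : EuclideanSpace ℝ (Fin n) →L[ℝ] EuclideanSpace ℝ (Fin n) →L[ℝ] EuclideanSpace ℝ (Fin n)) (ξ w : EuclideanSpace ℝ (Fin n)) (i : Fin n) :
    Γ ξ w i = ∑ m, w m * Γ ξ (EuclideanSpace.single m 1) i := by
  conv_lhs => rw [euclidean_eq_sum w]
  simp [Finset.sum_apply]

theorem ricci_formMatrix (h : IsMetricNear G y) (j k : Fin n) :
    ricci (formMatrix G) j k y = ∑ i, curv G y (EuclideanSpace.single i 1)
      (EuclideanSpace.single j 1) (EuclideanSpace.single k 1) i := by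
  simp only [ricci, partialDeriv_christoffel h, christoffel_formMatrix h]
  refine Finset.sum_congr rfl fun i _ => ?_
  simp only [curv, PiLp.add_apply, PiLp.sub_apply]
  rw [bilin_apply_coord (chris G y) _ (chris G y (EuclideanSpace.single j 1) _),
    bilin_apply_coord (chris G y) _ (chris G y (EuclideanSpace.single i 1) _),
    Finset.sum_sub_distrib]
  simp only [mul_comm]

/-- The trace of an endomorphism computed in an orthonormal frame. -/
theorem sum_coord_eq_sum_frame {e : Fin n → EuclideanSpace ℝ (Fin n)}
    (he : ∀ a b, G y (e a) (e b) = if a = b then 1 else 0) (L : EuclideanSpace ℝ (Fin n) →ₗ[ℝ] EuclideanSpace ℝ (Fin n)) :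
    (formMatrix G y)⁻¹ = (Matrix.of fun i a => e a i) * (Matrix.of fun i a => e a i).transpose ∧
    ∑ i, L (EuclideanSpace.single i 1) i = ∑ b, G y (L (e b)) (e b) := by
  set P : Matrix (Fin n) (Fin n) ℝ := Matrix.of fun i a => e a i with hP
  set M := formMatrix G y with hM
  have h1 : P.transpose * (M * P) = 1 := by
    ext a b
    have := he a b
    rw [form_eq_dotProduct] at this
    rw [Matrix.one_apply, ← this, Matrix.mul_apply]
    rfl
  -- Orthonormality says PᵀMP = 1. For square matrices a one-sided inverse is two-sided, so the
  -- factors may be rotated, which identifies M⁻¹ with PPᵀ.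
  have h2 : (P * P.transpose) * M = 1 := by
    rw [← Matrix.mul_assoc] at h1
    rw [Matrix.mul_assoc]
    exact mul_eq_one_comm.1 h1
  refine ⟨Matrix.inv_eq_left_inv h2, ?_⟩
  set Q : Matrix (Fin n) (Fin n) ℝ := Matrix.of fun i j => L (EuclideanSpace.single j 1) i with hQ
  have hL : ∀ w : EuclideanSpace ℝ (Fin n), (L w).ofLp = Q.mulVec w.ofLp := by
    intro w
    funext i
    conv_lhs => rw [euclidean_eq_sum w]
    simp [Matrix.mulVec, dotProduct, hQ, Finset.sum_apply, mul_comm]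
  have h3 : ∑ b, G y (L (e b)) (e b) = ((Q * P).transpose * (M * P)).trace := by
    rw [Matrix.trace]
    refine Finset.sum_congr rfl fun b _ => ?_
    rw [form_eq_dotProduct, hL, Matrix.diag_apply, Matrix.mul_apply]
    rfl
  rw [h3, Matrix.transpose_mul, Matrix.mul_assoc, Matrix.trace_mul_comm, Matrix.mul_assoc,
    Matrix.mul_assoc]
  have h4 : M * (P * P.transpose) = 1 := mul_eq_one_comm.1 h2
  rw [h4, Matrix.mul_one, Matrix.trace_transpose]
  rfl

theorem IsLinearMap.apply_coord {V : Type*} [AddCommGroup V] [Module ℝ V]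
    {f : EuclideanSpace ℝ (Fin n) → V} (hf : IsLinearMap ℝ f) (w : EuclideanSpace ℝ (Fin n)) :
    f w = ∑ m, w m • f (EuclideanSpace.single m 1) := by
  refine (congrArg (hf.mk' f) (euclidean_eq_sum w)).trans ?_
  rw [map_sum]
  exact Finset.sum_congr rfl fun j _ => map_smul (hf.mk' f) _ _

theorem sum_mul_sum_rearrange (c T : Fin n → Fin n → Fin n → ℝ) :
    ∑ j, ∑ k, (∑ b, c b j k) * ∑ a, T a j k = ∑ a, ∑ b, ∑ j, ∑ k, c b j k * T a j k := by
  calc _ = ∑ j, ∑ k, ∑ a, ∑ b, c b j k * T a j k := by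
        refine Finset.sum_congr rfl fun j _ => Finset.sum_congr rfl fun k _ => ?_
        rw [Finset.sum_mul_sum, Finset.sum_comm]
    _ = ∑ j, ∑ a, ∑ k, ∑ b, c b j k * T a j k :=
        Finset.sum_congr rfl fun j _ => Finset.sum_comm
    _ = ∑ a, ∑ j, ∑ k, ∑ b, c b j k * T a j k := Finset.sum_comm
    _ = ∑ a, ∑ j, ∑ b, ∑ k, c b j k * T a j k :=
        Finset.sum_congr rfl fun a _ => Finset.sum_congr rfl fun j _ => Finset.sum_comm
    _ = _ := Finset.sum_congr rfl fun a _ => Finset.sum_comm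

/-- Replacing the inverse matrix by PPᵀ turns both contractions in gʲᵏ Ricⱼₖ into sums over the
frame. The index type is left free because the frame of a warped product is naturally indexed by a
disjoint union. -/
theorem coordScalarCurvature_formMatrix {ι : Type*} [Fintype ι] [DecidableEq ι]
    (h : IsMetricNear G y) {e : ι → EuclideanSpace ℝ (Fin n)}
    (hcard : Fintype.card ι = n) (he : ∀ a b, G y (e a) (e b) = if a = b then 1 else 0) :
    coordScalarCurvature (formMatrix G) y = scal G y e := by
  let f : Fin n ≃ ι := (finCongr hcard.symm).trans (Fintype.equivFin ι).symm
  rw [← scal_comp_equiv G y e f]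
  have he' : ∀ a b, G y ((e ∘ f) a) ((e ∘ f) b) = if a = b then 1 else 0 := fun a b => by
    simp [he, f.injective.eq_iff]
  generalize e ∘ f = e at he'
  have hinv := (sum_coord_eq_sum_frame he' LinearMap.id).1
  have htr : ∀ η ζ, ∑ i, curv G y (EuclideanSpace.single i 1) η ζ i
      = ∑ b, G y (curv G y (e b) η ζ) (e b) := fun η ζ =>
    (sum_coord_eq_sum_frame he' (IsLinearMap.mk' _ (isLinearMap_curv_left G y η ζ))).2
  simp only [coordScalarCurvature, ricci_formMatrix h, htr, hinv]
  simp only [Matrix.mul_apply, Matrix.transpose_apply, Matrix.of_apply, scal]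
  rw [sum_mul_sum_rearrange]
  refine Finset.sum_congr rfl fun a _ => Finset.sum_congr rfl fun b _ => ?_
  rw [IsLinearMap.apply_coord (isLinearMap_curv_middle G y (e a) (e b)) (e b), map_sum, sum_apply]
  refine Finset.sum_congr rfl fun j _ => ?_
  rw [IsLinearMap.apply_coord (isLinearMap_curv_right G y (e a) (EuclideanSpace.single j 1)) (e b),
    map_smul, map_sum, smul_apply, sum_apply, Finset.smul_sum]
  refine Finset.sum_congr rfl fun k _ => ?_
  rw [map_smul, smul_apply, smul_eq_mul, smul_eq_mul, mul_assoc]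

end Coordinates

/-! ### Christoffel symbols of a doubly warped product in stereographic coordinates -/

section WarpedCurvature

theorem ContDiffAt.deriv_infty {f : ℝ → ℝ} {x : ℝ} (h : ContDiffAt ℝ ∞ f x) :
    ContDiffAt ℝ ∞ (deriv f) x :=
  (h.fderiv_right (m := ∞) (by simp)).clm_apply (contDiffAt_const (c := (1 : ℝ)))

theorem fderiv_form_apply {E : Type*} [NormedAddCommGroup E] [NormedSpace ℝ E]
    {G : E → E →L[ℝ] E →L[ℝ] ℝ} {z : E} (hG : DifferentiableAt ℝ G z) (γ ξ η : E) :
    fderiv ℝ G z γ ξ η = fderiv ℝ (fun y => G y ξ η) z γ := by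
  have := (hG.hasFDerivAt.clm_apply (hasFDerivAt_const ξ z)).clm_apply (hasFDerivAt_const η z)
  rw [this.fderiv]
  simp

/-- The conformal factor of the round metric in stereographic coordinates. -/
def confFactor {p : ℕ} (ζ : EuclideanSpace ℝ (Fin p)) : ℝ := 4 / (4 + ‖ζ‖ ^ 2)

theorem confFactor_pos {p : ℕ} (ζ : EuclideanSpace ℝ (Fin p)) : 0 < confFactor ζ := by
  unfold confFactor; positivity

theorem contDiff_confFactor {p : ℕ} : ContDiff ℝ ∞ (confFactor (p := p)) := by
  unfold confFactor
  exact contDiff_const.div (contDiff_const.add (contDiff_norm_sq ℝ)) fun ζ => by positivity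

theorem hasFDerivAt_confFactor {p : ℕ} (ζ : EuclideanSpace ℝ (Fin p)) :
    HasFDerivAt confFactor ((-(confFactor ζ) ^ 2 / 2) • innerSL ℝ ζ) ζ := by
  have h1 : HasFDerivAt (fun ζ : EuclideanSpace ℝ (Fin p) => 4 + ‖ζ‖ ^ 2) (2 • innerSL ℝ ζ) ζ :=
    (hasStrictFDerivAt_norm_sq ζ).hasFDerivAt.const_add 4
  have hne : (4 + ‖ζ‖ ^ 2) ≠ 0 := by positivity
  have h2 := ((hasDerivAt_inv hne).comp_hasFDerivAt ζ h1).const_mul 4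
  refine (h2.congr_fderiv ?_).congr_of_eventuallyEq (Eventually.of_forall fun x => ?_)
  · ext α
    simp [confFactor]
    field_simp
    ring
  · simp [confFactor, div_eq_mul_inv]

/-- The model space of the coordinates `(t, ζ, η)` on `(0, b) × Sᵖ × S^q`. -/
abbrev WarpModel (p q : ℕ) : Type :=
  ℝ × EuclideanSpace ℝ (Fin p) × EuclideanSpace ℝ (Fin q)

variable {p q : ℕ}

/-- The form `dt²`. -/
def formT (p q : ℕ) : WarpModel p q →L[ℝ] WarpModel p q →L[ℝ] ℝ :=
  (ContinuousLinearMap.mul ℝ ℝ).bilinearComp (ContinuousLinearMap.fst ℝ _ _)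
    (ContinuousLinearMap.fst ℝ _ _)

/-- The flat form of the first Euclidean factor. -/
def formP (p q : ℕ) : WarpModel p q →L[ℝ] WarpModel p q →L[ℝ] ℝ :=
  (innerSL ℝ).bilinearComp
    ((ContinuousLinearMap.fst ℝ _ _).comp (ContinuousLinearMap.snd ℝ _ _))
    ((ContinuousLinearMap.fst ℝ _ _).comp (ContinuousLinearMap.snd ℝ _ _))

/-- The flat form of the second Euclidean factor. -/
def formQ (p q : ℕ) : WarpModel p q →L[ℝ] WarpModel p q →L[ℝ] ℝ :=
  (innerSL ℝ).bilinearComp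
    ((ContinuousLinearMap.snd ℝ _ _).comp (ContinuousLinearMap.snd ℝ _ _))
    ((ContinuousLinearMap.snd ℝ _ _).comp (ContinuousLinearMap.snd ℝ _ _))

@[simp] theorem formT_apply (ξ η : WarpModel p q) : formT p q ξ η = ξ.1 * η.1 := rfl
@[simp] theorem formP_apply (ξ η : WarpModel p q) : formP p q ξ η = inner ℝ ξ.2.1 η.2.1 := rfl
@[simp] theorem formQ_apply (ξ η : WarpModel p q) : formQ p q ξ η = inner ℝ ξ.2.2 η.2.2 := rfl

/-- The doubly warped product metric `dt² + u² ds_p² + v² ds_q²` in the coordinates given by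
stereographic projections. -/
def warpForm (p q : ℕ) (u v : ℝ → ℝ) (z : WarpModel p q) :
    WarpModel p q →L[ℝ] WarpModel p q →L[ℝ] ℝ :=
  formT p q + (u z.1 * confFactor z.2.1) ^ 2 • formP p q
    + (v z.1 * confFactor z.2.2) ^ 2 • formQ p q

theorem warpForm_apply (u v : ℝ → ℝ) (z ξ η : WarpModel p q) :
    warpForm p q u v z ξ η = ξ.1 * η.1 + (u z.1 * confFactor z.2.1) ^ 2 * inner ℝ ξ.2.1 η.2.1
      + (v z.1 * confFactor z.2.2) ^ 2 * inner ℝ ξ.2.2 η.2.2 := by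
  simp [warpForm]

/-- The conditions on the warping functions near a point. -/
structure IsWarpPair (u v : ℝ → ℝ) (t : ℝ) : Prop where
  smooth_left : ∀ᶠ s in 𝓝 t, ContDiffAt ℝ ∞ u s
  smooth_right : ∀ᶠ s in 𝓝 t, ContDiffAt ℝ ∞ v s
  pos_left : 0 < u t
  pos_right : 0 < v t

theorem IsWarpPair.eventually {u v : ℝ → ℝ} {t : ℝ} (h : IsWarpPair u v t) :
    ∀ᶠ s in 𝓝 t, IsWarpPair u v s := by
  filter_upwards [h.smooth_left.eventually_nhds, h.smooth_right.eventually_nhds,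
    h.smooth_left.self_of_nhds.continuousAt.eventually (lt_mem_nhds h.pos_left),
    h.smooth_right.self_of_nhds.continuousAt.eventually (lt_mem_nhds h.pos_right)]
    with s h1 h2 h3 h4
  exact ⟨h1, h2, h3, h4⟩

variable {u v : ℝ → ℝ}

theorem warpForm_pos {z : WarpModel p q} (hu : 0 < u z.1) (hv : 0 < v z.1) {ξ : WarpModel p q}
    (hξ : ξ ≠ 0) : 0 < warpForm p q u v z ξ ξ := by
  rw [warpForm_apply, real_inner_self_eq_norm_sq, real_inner_self_eq_norm_sq]
  have h1 := mul_pos hu (confFactor_pos z.2.1)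
  have h2 := mul_pos hv (confFactor_pos z.2.2)
  by_contra hle
  have a1 : 0 ≤ ξ.1 * ξ.1 := mul_self_nonneg _
  have a2 : 0 ≤ (u z.1 * confFactor z.2.1) ^ 2 * ‖ξ.2.1‖ ^ 2 := by positivity
  have a3 : 0 ≤ (v z.1 * confFactor z.2.2) ^ 2 * ‖ξ.2.2‖ ^ 2 := by positivity
  have b1 : ξ.1 * ξ.1 = 0 := by linarith
  have b2 : (u z.1 * confFactor z.2.1) ^ 2 * ‖ξ.2.1‖ ^ 2 = 0 := by linarith
  have b3 : (v z.1 * confFactor z.2.2) ^ 2 * ‖ξ.2.2‖ ^ 2 = 0 := by linarith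
  apply hξ
  refine Prod.ext (mul_self_eq_zero.1 b1) (Prod.ext ?_ ?_)
  · simpa [h1.ne'] using b2
  · simpa [h2.ne'] using b3

theorem isMetricNear_warpForm {z : WarpModel p q} (h : IsWarpPair u v z.1) :
    IsMetricNear (warpForm p q u v) z := by
  have hev := continuous_fst.continuousAt.eventually h.eventually
  refine ⟨?_, Eventually.of_forall fun z ξ η => ?_, ?_⟩
  · filter_upwards [hev] with y hy
    have hu := hy.smooth_left.self_of_nhds
    have hv := hy.smooth_right.self_of_nhds
    have h1 : ContDiffAt ℝ ∞ (fun y : WarpModel p q => u y.1) y := hu.comp y contDiffAt_fst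
    have h2 : ContDiffAt ℝ ∞ (fun y : WarpModel p q => v y.1) y := hv.comp y contDiffAt_fst
    have h3 : ContDiffAt ℝ ∞ (fun y : WarpModel p q => confFactor y.2.1) y :=
      (contDiff_confFactor.comp (contDiff_fst.comp contDiff_snd)).contDiffAt
    have h4 : ContDiffAt ℝ ∞ (fun y : WarpModel p q => confFactor y.2.2) y :=
      (contDiff_confFactor.comp (contDiff_snd.comp contDiff_snd)).contDiffAt
    exact (contDiffAt_const.add (((h1.mul h3).pow 2).smul contDiffAt_const)).add
      (((h2.mul h4).pow 2).smul contDiffAt_const)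
  · rw [warpForm_apply, warpForm_apply, real_inner_comm ξ.2.1, real_inner_comm ξ.2.2,
      mul_comm ξ.1]
  · filter_upwards [hev] with y hy ξ hξ using warpForm_pos hy.pos_left hy.pos_right hξ

theorem fderiv_warpForm {z : WarpModel p q} (h : IsWarpPair u v z.1) (γ ξ η : WarpModel p q) :
    fderiv ℝ (warpForm p q u v) z γ ξ η
      = 2 * (u z.1 * confFactor z.2.1 ^ 2) * (deriv u z.1 * γ.1
          - u z.1 * confFactor z.2.1 / 2 * inner ℝ z.2.1 γ.2.1) * inner ℝ ξ.2.1 η.2.1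
        + 2 * (v z.1 * confFactor z.2.2 ^ 2) * (deriv v z.1 * γ.1
          - v z.1 * confFactor z.2.2 / 2 * inner ℝ z.2.2 γ.2.2) * inner ℝ ξ.2.2 η.2.2 := by
  have hu := (h.smooth_left.self_of_nhds.differentiableAt (by simp)).hasDerivAt
  have hv := (h.smooth_right.self_of_nhds.differentiableAt (by simp)).hasDerivAt
  have h1 := hu.comp_hasFDerivAt z (hasFDerivAt_fst (𝕜 := ℝ) (p := z))
  have h2 := hv.comp_hasFDerivAt z (hasFDerivAt_fst (𝕜 := ℝ) (p := z))
  have h3 := (hasFDerivAt_confFactor z.2.1).comp z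
    ((hasFDerivAt_fst (𝕜 := ℝ) (p := z.2)).comp z (hasFDerivAt_snd (𝕜 := ℝ) (p := z)))
  have h4 := (hasFDerivAt_confFactor z.2.2).comp z
    ((hasFDerivAt_snd (𝕜 := ℝ) (p := z.2)).comp z (hasFDerivAt_snd (𝕜 := ℝ) (p := z)))
  have h5 := ((((h1.mul h3).pow 2).mul_const (inner ℝ ξ.2.1 η.2.1)).const_add
    (ξ.1 * η.1)).add (((h2.mul h4).pow 2).mul_const (inner ℝ ξ.2.2 η.2.2))
  rw [fderiv_form_apply ((isMetricNear_warpForm h).smooth.self_of_nhds.differentiableAt (by simp))]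
  simp only [warpForm_apply]
  have h6 : HasFDerivAt (fun y : WarpModel p q => ξ.1 * η.1
      + (u y.1 * confFactor y.2.1) ^ 2 * inner ℝ ξ.2.1 η.2.1
      + (v y.1 * confFactor y.2.2) ^ 2 * inner ℝ ξ.2.2 η.2.2) _ z := h5
  rw [h6.fderiv]
  simp
  ring

/-- The Christoffel symbols of a doubly warped product metric. -/
def warpChris (p q : ℕ) (u v : ℝ → ℝ) (z ξ η : WarpModel p q) : WarpModel p q :=
  (-(u z.1 * deriv u z.1 * confFactor z.2.1 ^ 2 * inner ℝ ξ.2.1 η.2.1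
      + v z.1 * deriv v z.1 * confFactor z.2.2 ^ 2 * inner ℝ ξ.2.2 η.2.2),
    (deriv u z.1 / u z.1) • (ξ.1 • η.2.1 + η.1 • ξ.2.1)
      + (confFactor z.2.1 / 2) • (inner ℝ ξ.2.1 η.2.1 • z.2.1 - inner ℝ z.2.1 ξ.2.1 • η.2.1
        - inner ℝ z.2.1 η.2.1 • ξ.2.1),
    (deriv v z.1 / v z.1) • (ξ.1 • η.2.2 + η.1 • ξ.2.2)
      + (confFactor z.2.2 / 2) • (inner ℝ ξ.2.2 η.2.2 • z.2.2 - inner ℝ z.2.2 ξ.2.2 • η.2.2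
        - inner ℝ z.2.2 η.2.2 • ξ.2.2))

/-- The closed formula is not derived but checked: by nondegeneracy it is enough that it satisfies
the Koszul identity against every vector. -/
theorem chris_warpForm {z : WarpModel p q} (h : IsWarpPair u v z.1) (ξ η : WarpModel p q) :
    chris (warpForm p q u v) z ξ η = warpChris p q u v z ξ η := by
  refine chris_unique (fun ξ hξ => warpForm_pos h.pos_left h.pos_right hξ) fun γ => ?_
  rw [fderiv_warpForm h, fderiv_warpForm h, fderiv_warpForm h, warpForm_apply]
  have hu := h.pos_left.ne'
  have hv := h.pos_right.ne'
  simp only [warpChris, inner_add_left, inner_smul_left, inner_sub_left, RCLike.conj_to_real]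
  field_simp
  ring

/-- Only the points (t, 0, 0) are treated: the stereographic projections can be centred at any given
φ and θ, and at the centre the conformal factors are 1 with vanishing first derivative. -/
theorem fderiv_chris_warpForm {t : ℝ} (h : IsWarpPair u v t) (γ ξ η : WarpModel p q) :
    fderiv ℝ (chris (warpForm p q u v)) (t, 0, 0) γ ξ η
      = (-(γ.1 * ((deriv u t ^ 2 + u t * deriv (deriv u) t) * inner ℝ ξ.2.1 η.2.1
          + (deriv v t ^ 2 + v t * deriv (deriv v) t) * inner ℝ ξ.2.2 η.2.2)),
        (γ.1 * ((deriv (deriv u) t * u t - deriv u t ^ 2) / u t ^ 2)) •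
            (ξ.1 • η.2.1 + η.1 • ξ.2.1)
          + (1 / 2 : ℝ) • (inner ℝ ξ.2.1 η.2.1 • γ.2.1 - inner ℝ γ.2.1 ξ.2.1 • η.2.1
            - inner ℝ γ.2.1 η.2.1 • ξ.2.1),
        (γ.1 * ((deriv (deriv v) t * v t - deriv v t ^ 2) / v t ^ 2)) •
            (ξ.1 • η.2.2 + η.1 • ξ.2.2)
          + (1 / 2 : ℝ) • (inner ℝ ξ.2.2 η.2.2 • γ.2.2 - inner ℝ γ.2.2 ξ.2.2 • η.2.2
            - inner ℝ γ.2.2 η.2.2 • ξ.2.2)) := by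
  set z₀ : WarpModel p q := (t, 0, 0) with hz₀
  have hM : IsMetricNear (warpForm p q u v) z₀ := isMetricNear_warpForm (z := z₀) h
  have hc := ((contDiffAt_chris hM).differentiableAt (by simp)).hasFDerivAt
  -- The Fréchet derivative is known to exist, so it can be read off along the line z₀ + sγ, which
  -- reduces everything to calculus in one variable.
  have hl : HasDerivAt (fun s : ℝ => z₀ + s • γ) γ 0 := by
    simpa using ((hasDerivAt_id (0 : ℝ)).smul_const γ).const_add z₀
  have hz : z₀ + (0 : ℝ) • γ = z₀ := by simp
  rw [← hz] at hc
  have h1 := (((hc.clm_apply (hasFDerivAt_const ξ _)).clm_apply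
    (hasFDerivAt_const η _)).comp_hasDerivAt (0 : ℝ) hl)
  rw [hz] at h1
  have h2 : (fun s : ℝ => chris (warpForm p q u v) (z₀ + s • γ) ξ η) =ᶠ[𝓝 0]
      fun s => warpChris p q u v (z₀ + s • γ) ξ η := by
    have hcont : ContinuousAt (fun s : ℝ => (z₀ + s • γ).1) 0 := by fun_prop
    have : Tendsto (fun s : ℝ => (z₀ + s • γ).1) (𝓝 0) (𝓝 t) := by
      simpa [hz₀] using hcont.tendsto
    filter_upwards [this.eventually h.eventually] with s hs
    exact chris_warpForm hs ξ η
  have h3 := h1.congr_of_eventuallyEq h2.symm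
  have hlt : HasDerivAt (fun s : ℝ => t + s * γ.1) γ.1 0 := by
    simpa using ((hasDerivAt_id (0 : ℝ)).mul_const γ.1).const_add t
  have comp : ∀ {f : ℝ → ℝ} {f' : ℝ}, HasDerivAt f f' t →
      HasDerivAt (fun s : ℝ => f (t + s * γ.1)) (f' * γ.1) 0 := fun {f f'} hf =>
    HasDerivAt.comp_of_eq (h₂ := f) (0 : ℝ) hf hlt (by simp)
  have hu := comp (h.smooth_left.self_of_nhds.differentiableAt (by simp)).hasDerivAt
  have hv := comp (h.smooth_right.self_of_nhds.differentiableAt (by simp)).hasDerivAt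
  have hu' := comp ((ContDiffAt.deriv_infty h.smooth_left.self_of_nhds).differentiableAt
    (by simp)).hasDerivAt
  have hv' := comp ((ContDiffAt.deriv_infty h.smooth_right.self_of_nhds).differentiableAt
    (by simp)).hasDerivAt
  have conf : ∀ {r : ℕ} (α : EuclideanSpace ℝ (Fin r)),
      HasDerivAt (fun s : ℝ => confFactor (s • α)) 0 0 := fun {r} α => by
    have hl : HasDerivAt (fun s : ℝ => s • α) α 0 := by
      simpa using (hasDerivAt_id (0 : ℝ)).smul_const α
    simpa [Function.comp_def] using
      (hasFDerivAt_confFactor ((0 : ℝ) • α)).comp_hasDerivAt (0 : ℝ) hl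
  have lin : ∀ {r : ℕ} (α β γ : EuclideanSpace ℝ (Fin r)),
      HasDerivAt (fun s : ℝ => (confFactor (s • γ) / 2) • (inner ℝ α β • (s • γ)
        - inner ℝ (s • γ) α • β - inner ℝ (s • γ) β • α))
        ((1 / 2 : ℝ) • (inner ℝ α β • γ - inner ℝ γ α • β - inner ℝ γ β • α)) 0 := by
    intro r α β γ
    have e : (fun s : ℝ => (confFactor (s • γ) / 2) • (inner ℝ α β • (s • γ)
        - inner ℝ (s • γ) α • β - inner ℝ (s • γ) β • α)) = fun s : ℝ =>
        (confFactor (s • γ) / 2 * s) • (inner ℝ α β • γ - inner ℝ γ α • β - inner ℝ γ β • α) := by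
      funext s
      simp only [inner_smul_left, RCLike.conj_to_real]
      module
    rw [e]
    have := (((conf γ).div_const 2).mul (hasDerivAt_id (0 : ℝ))).smul_const
      (inner ℝ α β • γ - inner ℝ γ α • β - inner ℝ γ β • α)
    simpa [confFactor] using this
  have hne : ∀ {f : ℝ → ℝ}, 0 < f t → f (t + 0 * γ.1) ≠ 0 := fun hf => by simpa using hf.ne'
  have c1 := ((((hu.mul hu').mul ((conf γ.2.1).pow 2)).mul_const (inner ℝ ξ.2.1 η.2.1)).add
    (((hv.mul hv').mul ((conf γ.2.2).pow 2)).mul_const (inner ℝ ξ.2.2 η.2.2))).neg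
  have c2 := ((hu'.div hu (hne h.pos_left)).smul_const (ξ.1 • η.2.1 + η.1 • ξ.2.1)).add
    (lin ξ.2.1 η.2.1 γ.2.1)
  have c3 := ((hv'.div hv (hne h.pos_right)).smul_const (ξ.1 • η.2.2 + η.1 • ξ.2.2)).add
    (lin ξ.2.2 η.2.2 γ.2.2)
  have h4 := c1.prodMk (c2.prodMk c3)
  have h6 := h3.unique (h4.congr_of_eventuallyEq (Eventually.of_forall fun s => by
    simp only [warpChris, hz₀, Prod.fst_add, Prod.snd_add, Prod.smul_fst, Prod.smul_snd, zero_add,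
      smul_eq_mul]
    rfl))
  simp only [add_apply, ContinuousLinearMap.comp_apply, ContinuousLinearMap.flip_apply,
    zero_apply, map_zero, zero_add] at h6
  rw [h6]
  have hc0 : confFactor (0 : EuclideanSpace ℝ (Fin p)) = 1 := by simp [confFactor]
  have hc1 : confFactor (0 : EuclideanSpace ℝ (Fin q)) = 1 := by simp [confFactor]
  refine Prod.ext ?_ (Prod.ext ?_ ?_)
  · simp [hc0, hc1]
    ring
  · simp only [zero_mul, add_zero]
    module
  · simp only [zero_mul, add_zero]
    module

end WarpedCurvature

/-! ### Scalar curvature of a doubly warped product -/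

section WarpedScalar

variable {p q : ℕ} {u v : ℝ → ℝ}

theorem inner_single_single {r : ℕ} (i j : Fin r) (c : ℝ) :
    inner ℝ (EuclideanSpace.single i c) (EuclideanSpace.single j c) = if i = j then c * c else 0 := by
  rw [EuclideanSpace.inner_single_left, PiLp.single_apply]
  simp

theorem curv_warpForm {t : ℝ} (h : IsWarpPair u v t) (ξ η : WarpModel p q) :
    warpForm p q u v (t, 0, 0) (curv (warpForm p q u v) (t, 0, 0) ξ η η) ξ
      = -(u t * deriv (deriv u) t) * (ξ.1 ^ 2 * inner ℝ η.2.1 η.2.1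
            - 2 * ξ.1 * η.1 * inner ℝ ξ.2.1 η.2.1 + η.1 ^ 2 * inner ℝ ξ.2.1 ξ.2.1)
        - v t * deriv (deriv v) t * (ξ.1 ^ 2 * inner ℝ η.2.2 η.2.2
            - 2 * ξ.1 * η.1 * inner ℝ ξ.2.2 η.2.2 + η.1 ^ 2 * inner ℝ ξ.2.2 ξ.2.2)
        + u t ^ 2 * (1 - deriv u t ^ 2) * (inner ℝ ξ.2.1 ξ.2.1 * inner ℝ η.2.1 η.2.1
            - inner ℝ ξ.2.1 η.2.1 ^ 2)
        + v t ^ 2 * (1 - deriv v t ^ 2) * (inner ℝ ξ.2.2 ξ.2.2 * inner ℝ η.2.2 η.2.2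
            - inner ℝ ξ.2.2 η.2.2 ^ 2)
        - u t * deriv u t * (v t * deriv v t) * (inner ℝ ξ.2.1 ξ.2.1 * inner ℝ η.2.2 η.2.2
            + inner ℝ η.2.1 η.2.1 * inner ℝ ξ.2.2 ξ.2.2
            - 2 * inner ℝ ξ.2.1 η.2.1 * inner ℝ ξ.2.2 η.2.2) := by
  have hch : ∀ ξ η, chris (warpForm p q u v) (t, 0, 0) ξ η = warpChris p q u v (t, 0, 0) ξ η :=
    fun ξ η => chris_warpForm (z := ((t, 0, 0) : WarpModel p q)) h ξ η
  have hc0 : confFactor (0 : EuclideanSpace ℝ (Fin p)) = 1 := by simp [confFactor]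
  have hc1 : confFactor (0 : EuclideanSpace ℝ (Fin q)) = 1 := by simp [confFactor]
  have hu := h.pos_left.ne'
  have hv := h.pos_right.ne'
  simp only [curv, hch, fderiv_chris_warpForm h]
  simp only [warpChris, hc0, hc1, warpForm_apply, Prod.fst_add, Prod.snd_add, Prod.fst_sub,
    Prod.snd_sub, inner_add_left, inner_sub_left, inner_smul_left, inner_add_right,
    inner_smul_right, RCLike.conj_to_real, inner_zero_left,
    smul_zero, zero_smul, add_zero, sub_zero, real_inner_comm ξ.2.1 η.2.1,
    real_inner_comm ξ.2.2 η.2.2]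
  field_simp
  ring

/-- The scalar curvature of the metric `dt² + u² ds_p² + v² ds_q²`. -/
def warpScal (p q : ℕ) (u v : ℝ → ℝ) (t : ℝ) : ℝ :=
  -(2 * p * (deriv (deriv u) t / u t)) - 2 * q * (deriv (deriv v) t / v t)
    + p * (p - 1) * ((1 - deriv u t ^ 2) / u t ^ 2) + q * (q - 1) * ((1 - deriv v t ^ 2) / v t ^ 2)
    - 2 * p * q * (deriv u t * deriv v t / (u t * v t))

/-- The standard orthonormal frame of the doubly warped product metric. -/
def warpFrame (p q : ℕ) (u v : ℝ → ℝ) (t : ℝ) : Unit ⊕ Fin p ⊕ Fin q → WarpModel p q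
  | .inl _ => (1, 0, 0)
  | .inr (.inl i) => (0, EuclideanSpace.single i (u t)⁻¹, 0)
  | .inr (.inr j) => (0, 0, EuclideanSpace.single j (v t)⁻¹)

theorem warpFrame_orthonormal {t : ℝ} (h : IsWarpPair u v t) (a b : Unit ⊕ Fin p ⊕ Fin q) :
    warpForm p q u v (t, 0, 0) (warpFrame p q u v t a) (warpFrame p q u v t b)
      = if a = b then 1 else 0 := by
  have hu := h.pos_left.ne'
  have hv := h.pos_right.ne'
  rw [warpForm_apply]
  rcases a with a | a | a <;> rcases b with b | b | b <;>
    simp [warpFrame, confFactor, inner_single_single] <;> field_simp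

theorem sum_off_diagonal (p : ℕ) (c : ℝ) :
    ∑ i : Fin p, ∑ j : Fin p, (if i = j then 0 else c) = p * (p - 1) * c := by
  have : ∀ i : Fin p, ∑ j : Fin p, (if i = j then 0 else c) = (p - 1) * c := by
    intro i
    have h1 : ∀ j : Fin p, (if i = j then 0 else c) = c - (if i = j then c else 0) := fun j => by
      split_ifs <;> simp
    simp only [h1, Finset.sum_sub_distrib, Finset.sum_const, Finset.sum_ite_eq, Finset.mem_univ,
      if_true, Finset.card_univ, Fintype.card_fin, nsmul_eq_mul]
    ring
  simp only [this, Finset.sum_const, Finset.card_univ, Fintype.card_fin, nsmul_eq_mul]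
  ring

/-- Sum the sectional curvatures over ordered pairs of the frame: -u''/u and -v''/v for the pairs
containing ∂ₜ, (1 - u'²)/u² and (1 - v'²)/v² within a sphere factor, and -u'v'/(uv) across the two
factors. -/
theorem scal_warpForm {t : ℝ} (h : IsWarpPair u v t) :
    scal (warpForm p q u v) (t, 0, 0) (warpFrame p q u v t) = warpScal p q u v t := by
  have hu := h.pos_left.ne'
  have hv := h.pos_right.ne'
  simp only [scal, curv_warpForm h, Fintype.sum_sum_type, warpFrame]
  have hp : ∀ i j : Fin p, u t ^ 2 * (1 - deriv u t ^ 2) *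
      ((u t)⁻¹ * (u t)⁻¹ * ((u t)⁻¹ * (u t)⁻¹) - (if i = j then (u t)⁻¹ * (u t)⁻¹ else 0) ^ 2)
      = if i = j then 0 else (1 - deriv u t ^ 2) / u t ^ 2 := by
    intro i j
    split_ifs
    · ring
    · field_simp; ring
  have hq : ∀ i j : Fin q, v t ^ 2 * (1 - deriv v t ^ 2) *
      ((v t)⁻¹ * (v t)⁻¹ * ((v t)⁻¹ * (v t)⁻¹) - (if i = j then (v t)⁻¹ * (v t)⁻¹ else 0) ^ 2)
      = if i = j then 0 else (1 - deriv v t ^ 2) / v t ^ 2 := by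
    intro i j
    split_ifs
    · ring
    · field_simp; ring
  simp only [inner_single_single, inner_zero_left, inner_zero_right, if_true, mul_zero, zero_mul, sub_zero,
    add_zero, zero_add, mul_one, one_pow, ne_eq, OfNat.ofNat_ne_zero, not_false_eq_true, zero_pow,
    hp, hq, Finset.sum_add_distrib, sum_off_diagonal, Finset.sum_const, Finset.card_univ,
    Fintype.card_fin, nsmul_eq_mul, Fintype.card_unit, Nat.cast_one, one_mul, zero_sub]
  unfold warpScal
  field_simp
  ring

end WarpedScalar

/-! ### Hadamard quotients and Whitney's theorem on even functions -/

section Hadamard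

/-- The integral `∫₀¹ rʲ F(r t) dr`. -/
def moment (j : ℕ) (F : ℝ → ℝ) (t : ℝ) : ℝ := ∫ r in (0 : ℝ)..1, r ^ j * F (r * t)

theorem mul_mem_Icc_of_unit {a t r : ℝ} (ht : t ∈ Icc 0 a) (hr : r ∈ Icc (0 : ℝ) 1) :
    r * t ∈ Icc 0 a :=
  ⟨mul_nonneg hr.1 ht.1, (mul_le_of_le_one_left ht.1 hr.2).trans ht.2⟩

theorem moment_congr {j : ℕ} {a t : ℝ} {F G : ℝ → ℝ} (h : EqOn F G (Icc 0 a))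
    (ht : t ∈ Icc 0 a) : moment j F t = moment j G t := by
  refine intervalIntegral.integral_congr fun r hr => ?_
  rw [uIcc_of_le zero_le_one] at hr
  rw [h (mul_mem_Icc_of_unit ht hr)]

theorem moment_zero (j : ℕ) (F : ℝ → ℝ) : moment j F 0 = F 0 / (j + 1) := by
  simp [moment, integral_pow, div_eq_mul_inv, mul_comm]

variable {a : ℝ}

/-- A `C¹` function on `[0, a]` extends to a differentiable function on `ℝ` with bounded continuous
derivative. -/
theorem exists_hasDerivAt_extension (ha : 0 < a) {F : ℝ → ℝ} (hF : ContDiffOn ℝ 1 F (Icc 0 a)) :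
    ∃ (G G' : ℝ → ℝ), (∀ t, HasDerivAt G (G' t) t) ∧ Continuous G' ∧ (∃ C, ∀ t, |G' t| ≤ C) ∧
      EqOn F G (Icc 0 a) ∧ EqOn (derivWithin F (Icc 0 a)) G' (Icc 0 a) := by
  have hu := uniqueDiffOn_Icc ha
  have hc : ContinuousOn (derivWithin F (Icc 0 a)) (Icc 0 a) :=
    hF.continuousOn_derivWithin hu le_rfl
  -- The derivative is continued by constants outside the interval and then integrated. This lets
  -- theorems about differentiation on open sets be used at the endpoints.
  let G' : ℝ → ℝ := IccExtend ha.le ((Icc 0 a).domRestrict (derivWithin F (Icc 0 a)))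
  have hG' : Continuous G' := (continuousOn_iff_continuous_domRestrict.1 hc).Icc_extend'
  have heq : EqOn (derivWithin F (Icc 0 a)) G' (Icc 0 a) := fun t ht => by
    simp [G', IccExtend_of_mem _ _ ht, domRestrict_apply]
  let G : ℝ → ℝ := fun t => F 0 + ∫ s in (0 : ℝ)..t, G' s
  have hG : ∀ t, HasDerivAt G (G' t) t := fun t =>
    (intervalIntegral.integral_hasDerivAt_right (hG'.intervalIntegrable _ _)
      (hG'.stronglyMeasurableAtFilter _ _) hG'.continuousAt).const_add _
  refine ⟨G, G', hG, hG', ?_, ?_, heq⟩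
  · obtain ⟨C, hC⟩ := isCompact_Icc.exists_bound_of_continuousOn hc
    exact ⟨C, fun t => hC _ (projIcc 0 a ha.le t).2⟩
  · intro t ht
    have h1 : ∀ s ∈ Icc 0 t, HasDerivWithinAt F (G' s) (Icc 0 t) s := fun s hs => by
      have hs' : s ∈ Icc 0 a := ⟨hs.1, hs.2.trans ht.2⟩
      rw [← heq hs']
      exact ((hF.differentiableOn one_ne_zero s hs').hasDerivWithinAt).mono
        (Icc_subset_Icc le_rfl ht.2)
    have h2 : ∫ s in (0 : ℝ)..t, G' s = F t - F 0 := by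
      refine intervalIntegral.integral_eq_sub_of_hasDerivAt_of_le ht.1
        (fun s hs => (h1 s hs).continuousWithinAt) (fun s hs => ?_) (hG'.intervalIntegrable _ _)
      exact (h1 s (Ioo_subset_Icc_self hs)).hasDerivAt (Icc_mem_nhds hs.1 hs.2)
    simp [G, h2]

/-- Differentiation under the integral sign. Each derivative produces a factor r, which is why
moments of all orders j are introduced: they form a family closed under differentiation. -/
theorem hasDerivWithinAt_moment (ha : 0 < a) (j : ℕ) {F : ℝ → ℝ} (hF : ContDiffOn ℝ 1 F (Icc 0 a))
    {t : ℝ} (ht : t ∈ Icc 0 a) :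
    HasDerivWithinAt (moment j F) (moment (j + 1) (derivWithin F (Icc 0 a)) t) (Icc 0 a) t := by
  obtain ⟨G, G', hG, hG', ⟨C, hC⟩, h1, h2⟩ := exists_hasDerivAt_extension ha hF
  have hGc : Continuous G := continuous_iff_continuousAt.2 fun t => (hG t).continuousAt
  rw [moment_congr h2 ht]
  refine HasDerivWithinAt.congr (f := moment j G) ?_ (fun s hs => moment_congr h1 hs)
    (moment_congr h1 ht)
  refine HasDerivAt.hasDerivWithinAt ?_
  refine (intervalIntegral.hasDerivAt_integral_of_dominated_loc_of_deriv_le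
    (F := fun x r => r ^ j * G (r * x)) (F' := fun x r => r ^ (j + 1) * G' (r * x))
    (bound := fun _ => C) (s := univ) univ_mem ?_ ?_ ?_ ?_ ?_ ?_).2
  · exact Eventually.of_forall fun x => Continuous.aestronglyMeasurable (by fun_prop)
  · exact Continuous.intervalIntegrable (by fun_prop) _ _
  · exact Continuous.aestronglyMeasurable (by fun_prop)
  · refine Eventually.of_forall fun r hr x _ => ?_
    rw [uIoc_of_le zero_le_one] at hr
    rw [norm_mul, Real.norm_eq_abs, Real.norm_eq_abs, abs_of_nonneg (pow_nonneg hr.1.le _)]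
    exact (mul_le_of_le_one_left (abs_nonneg _) (pow_le_one₀ hr.1.le hr.2)).trans (hC _)
  · exact Continuous.intervalIntegrable (by fun_prop) _ _
  · refine Eventually.of_forall fun r _ x _ => ?_
    have hl : HasDerivAt (fun x => r * x) r x := by
      simpa using (hasDerivAt_id x).const_mul r
    have := ((hG (r * x)).comp x hl).const_mul (r ^ j)
    refine this.congr_deriv ?_
    ring

theorem ContDiffOn.derivWithin_infty (ha : 0 < a) {F : ℝ → ℝ} (hF : ContDiffOn ℝ ∞ F (Icc 0 a)) :
    ContDiffOn ℝ ∞ (derivWithin F (Icc 0 a)) (Icc 0 a) :=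
  hF.derivWithin (uniqueDiffOn_Icc ha) (by simp)

theorem one_le_infty : (1 : WithTop ℕ∞) ≤ ∞ := WithTop.coe_le_coe.2 (le_top : (1 : ℕ∞) ≤ ⊤)

theorem derivWithin_moment (ha : 0 < a) (j : ℕ) {F : ℝ → ℝ} (hF : ContDiffOn ℝ ∞ F (Icc 0 a)) :
    EqOn (derivWithin (moment j F) (Icc 0 a)) (moment (j + 1) (derivWithin F (Icc 0 a)))
      (Icc 0 a) := fun _ ht =>
  (hasDerivWithinAt_moment ha j (hF.of_le one_le_infty) ht).derivWithin (uniqueDiffOn_Icc ha _ ht)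

theorem contDiffOn_moment (ha : 0 < a) (j : ℕ) {F : ℝ → ℝ} (hF : ContDiffOn ℝ ∞ F (Icc 0 a)) :
    ContDiffOn ℝ ∞ (moment j F) (Icc 0 a) := by
  rw [contDiffOn_infty]
  intro n
  induction n generalizing j F with
  | zero =>
    exact contDiffOn_zero.2 fun t ht =>
      (hasDerivWithinAt_moment ha j (hF.of_le one_le_infty) ht).continuousWithinAt
  | succ n ih =>
    push_cast
    rw [contDiffOn_succ_iff_derivWithin (uniqueDiffOn_Icc ha)]
    refine ⟨fun t ht => (hasDerivWithinAt_moment ha j (hF.of_le one_le_infty)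
      ht).differentiableWithinAt, by simp, ?_⟩
    exact (ih (j + 1) (ContDiffOn.derivWithin_infty ha hF)).congr (derivWithin_moment ha j hF)

theorem iteratedDerivWithin_moment (ha : 0 < a) (k j : ℕ) {F : ℝ → ℝ}
    (hF : ContDiffOn ℝ ∞ F (Icc 0 a)) {t : ℝ} (ht : t ∈ Icc 0 a) :
    iteratedDerivWithin k (moment j F) (Icc 0 a) t
      = moment (j + k) (iteratedDerivWithin k F (Icc 0 a)) t := by
  induction k generalizing j F with
  | zero => simp
  | succ k ih =>
    rw [iteratedDerivWithin_succ', iteratedDerivWithin_congr (derivWithin_moment ha j hF) ht,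
      ih (j + 1) (ContDiffOn.derivWithin_infty ha hF), iteratedDerivWithin_succ',
      add_right_comm, add_assoc]

/-- The quotient `(F(t) - F(0)) / t`, as a smooth function on `[0, a]`. -/
def hadamard (a : ℝ) (F : ℝ → ℝ) : ℝ → ℝ := moment 0 (derivWithin F (Icc 0 a))

theorem contDiffOn_hadamard (ha : 0 < a) {F : ℝ → ℝ} (hF : ContDiffOn ℝ ∞ F (Icc 0 a)) :
    ContDiffOn ℝ ∞ (hadamard a F) (Icc 0 a) :=
  contDiffOn_moment ha 0 (ContDiffOn.derivWithin_infty ha hF)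

/-- The fundamental theorem of calculus for r ↦ F(rt) on [0, 1]. -/
theorem hadamard_spec (ha : 0 < a) {F : ℝ → ℝ} (hF : ContDiffOn ℝ ∞ F (Icc 0 a)) {t : ℝ}
    (ht : t ∈ Icc 0 a) : F t = F 0 + t * hadamard a F t := by
  obtain ⟨G, G', hG, hG', -, h1, h2⟩ := exists_hasDerivAt_extension ha (hF.of_le one_le_infty)
  rw [hadamard, moment_congr h2 ht, h1 ht, h1 ⟨le_rfl, ha.le⟩]
  have h3 : ∫ r in (0 : ℝ)..1, t * G' (r * t) = G (1 * t) - G (0 * t) := by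
    refine intervalIntegral.integral_eq_sub_of_hasDerivAt (f := fun r => G (r * t)) (fun r _ => ?_)
      (Continuous.intervalIntegrable (by fun_prop) _ _)
    have hl : HasDerivAt (fun r => r * t) t r := by simpa using (hasDerivAt_id r).mul_const t
    exact ((hG (r * t)).comp r hl).congr_deriv (mul_comm _ _)
  rw [intervalIntegral.integral_const_mul, one_mul, zero_mul] at h3
  simp only [moment, pow_zero, one_mul]
  linarith

/-- The factor 1/(k + 1) is ∫₀¹ rᵏ dr. The shift of order by one is what makes the Hadamard quotient
exchange the odd and even conditions at 0. -/
theorem iteratedDerivWithin_hadamard_zero (ha : 0 < a) (k : ℕ) {F : ℝ → ℝ}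
    (hF : ContDiffOn ℝ ∞ F (Icc 0 a)) :
    iteratedDerivWithin k (hadamard a F) (Icc 0 a) 0
      = iteratedDerivWithin (k + 1) F (Icc 0 a) 0 / (k + 1) := by
  rw [hadamard, iteratedDerivWithin_moment ha k 0 (ContDiffOn.derivWithin_infty ha hF)
    ⟨le_rfl, ha.le⟩, moment_zero, iteratedDerivWithin_succ']
  simp

/-- The functions on `[0, a]` that extend to even smooth functions near `0`. -/
structure IsEvenAtZero (a : ℝ) (F : ℝ → ℝ) : Prop where
  smooth : ContDiffOn ℝ ∞ F (Icc 0 a)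
  odd : ∀ j : ℕ, Odd j → iteratedDerivWithin j F (Icc 0 a) 0 = 0

theorem IsEvenAtZero.hadamard_deriv (ha : 0 < a) {F : ℝ → ℝ} (hF : IsEvenAtZero a F) :
    IsEvenAtZero a (hadamard a (derivWithin F (Icc 0 a))) := by
  have h1 := ContDiffOn.derivWithin_infty ha hF.smooth
  refine ⟨contDiffOn_hadamard ha h1, fun j hj => ?_⟩
  rw [iteratedDerivWithin_hadamard_zero ha j h1, ← iteratedDerivWithin_succ',
    hF.odd _ (by rw [add_assoc]; exact hj.add_even even_two), zero_div]

theorem sqrt_mem_Icc {s : ℝ} (ha : 0 < a) (hs : s ∈ Icc 0 (a ^ 2)) : √s ∈ Icc 0 a :=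
  ⟨Real.sqrt_nonneg _, Real.sqrt_le_iff.2 ⟨ha.le, hs.2⟩⟩

/-- For s > 0 the derivative of F(√s) is F'(√s)/(2√s), and since F'(0) = 0 the quotient F'(t)/t is a
Hadamard quotient, defined and smooth also at t = 0. -/
theorem IsEvenAtZero.hasDerivWithinAt_sqrt (ha : 0 < a) {F : ℝ → ℝ} (hF : IsEvenAtZero a F) {s : ℝ}
    (hs : s ∈ Icc 0 (a ^ 2)) :
    HasDerivWithinAt (fun s => F √s) (hadamard a (derivWithin F (Icc 0 a)) √s / 2)
      (Icc 0 (a ^ 2)) s := by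
  have h0 : (0 : ℝ) ∈ Icc 0 a := ⟨le_rfl, ha.le⟩
  have hF1 : derivWithin F (Icc 0 a) 0 = 0 := by
    have := hF.odd 1 odd_one
    rwa [iteratedDerivWithin_one] at this
  have hsm := ContDiffOn.derivWithin_infty ha hF.smooth
  rcases hs.1.eq_or_lt with rfl | hpos
  · have hH := contDiffOn_hadamard ha hF.smooth
    have hHH := contDiffOn_hadamard ha hH
    have hH0 : hadamard a F 0 = 0 := by
      have := iteratedDerivWithin_hadamard_zero ha 0 hF.smooth
      simpa [iteratedDerivWithin_one, hF1] using this
    -- At s = 0 the difference quotient is the twice iterated Hadamard quotient of F at √s, because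
    -- F(t) = F(0) + t² times that quotient. Its value at 0 and the claimed derivative are both
    -- F''(0)/2.
    have hval : hadamard a (derivWithin F (Icc 0 a)) √0 / 2 = hadamard a (hadamard a F) √0 := by
      have e1 := iteratedDerivWithin_hadamard_zero ha 0 hH
      have e2 := iteratedDerivWithin_hadamard_zero ha 1 hF.smooth
      have e3 := iteratedDerivWithin_hadamard_zero ha 0 hsm
      rw [← iteratedDerivWithin_succ'] at e3
      simp only [iteratedDerivWithin_zero, zero_add, Nat.cast_zero, Nat.cast_one, div_one] at e1 e2 e3
      rw [Real.sqrt_zero, e1, e2, e3]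
      norm_num
    rw [hval, hasDerivWithinAt_iff_tendsto_slope]
    have hc : Tendsto (fun s => hadamard a (hadamard a F) √s) (𝓝[Icc 0 (a ^ 2) \ {0}] 0)
        (𝓝 (hadamard a (hadamard a F) √0)) := by
      have hcs : ContinuousWithinAt (fun s => hadamard a (hadamard a F) √s) (Icc 0 (a ^ 2)) 0 := by
        refine ContinuousWithinAt.comp (t := Icc 0 a) ?_ Real.continuous_sqrt.continuousWithinAt
          fun s hs => sqrt_mem_Icc ha hs
        rw [Real.sqrt_zero]
        exact hHH.continuousOn 0 h0
      exact hcs.mono sdiff_subset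
    refine hc.congr' ?_
    filter_upwards [self_mem_nhdsWithin] with s hs
    have hs' := sqrt_mem_Icc ha hs.1
    rw [slope_def_field, Real.sqrt_zero, hadamard_spec ha hF.smooth hs', hadamard_spec ha hH hs', hH0]
    have : s ≠ 0 := hs.2
    have hss := Real.mul_self_sqrt hs.1.1
    field_simp
    linear_combination (-hadamard a (hadamard a F) √s) * hss
  · have hs' := sqrt_mem_Icc ha hs
    have h1 : HasDerivWithinAt F (derivWithin F (Icc 0 a) √s) (Icc 0 a) √s :=
      (hF.smooth.differentiableOn (by simp) _ hs').hasDerivWithinAt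
    have h2 := h1.comp s (Real.hasDerivAt_sqrt hpos.ne').hasDerivWithinAt
      fun s hs => sqrt_mem_Icc ha hs
    refine h2.congr_deriv ?_
    rw [hadamard_spec ha hsm hs', hF1]
    have : √s ≠ 0 := (Real.sqrt_pos.2 hpos).ne'
    field_simp
    ring

/-- Whitney's theorem on even functions. -/
theorem IsEvenAtZero.contDiffOn_sqrt (ha : 0 < a) {F : ℝ → ℝ} (hF : IsEvenAtZero a F) :
    ContDiffOn ℝ ∞ (fun s => F √s) (Icc 0 (a ^ 2)) := by
  have ha2 : 0 < a ^ 2 := by positivity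
  rw [contDiffOn_infty]
  intro n
  induction n generalizing F with
  | zero => exact contDiffOn_zero.2 fun t ht => (hF.hasDerivWithinAt_sqrt ha ht).continuousWithinAt
  | succ n ih =>
    push_cast
    rw [contDiffOn_succ_iff_derivWithin (uniqueDiffOn_Icc ha2)]
    refine ⟨fun t ht => (hF.hasDerivWithinAt_sqrt ha ht).differentiableWithinAt, by simp, ?_⟩
    -- The derivative of F(√s) is again an even function evaluated at √s, up to the factor 1/2, so
    -- the induction over all even F closes.
    exact ((ih (hF.hadamard_deriv ha)).div_const 2).congr fun t ht =>
      (hF.hasDerivWithinAt_sqrt ha ht).derivWithin (uniqueDiffOn_Icc ha2 _ ht)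

end Hadamard

/-! ### Smooth coefficients A, B, C from the warping functions -/

section Coefficients

variable {a : ℝ}

/-- The functions on `[0, a]` that extend to odd smooth functions near `0`. -/
structure IsOddAtZero (a : ℝ) (F : ℝ → ℝ) : Prop where
  smooth : ContDiffOn ℝ ∞ F (Icc 0 a)
  even : ∀ j : ℕ, Even j → iteratedDerivWithin j F (Icc 0 a) 0 = 0

theorem IsOddAtZero.isEvenAtZero_hadamard (ha : 0 < a) {F : ℝ → ℝ} (hF : IsOddAtZero a F) :
    IsEvenAtZero a (hadamard a F) := by
  refine ⟨contDiffOn_hadamard ha hF.smooth, fun j hj => ?_⟩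
  rw [iteratedDerivWithin_hadamard_zero ha j hF.smooth, hF.even _ hj.add_one, zero_div]

theorem IsOddAtZero.eq_mul_hadamard (ha : 0 < a) {F : ℝ → ℝ} (hF : IsOddAtZero a F) {t : ℝ}
    (ht : t ∈ Icc 0 a) : F t = t * hadamard a F t := by
  have h0 : F 0 = 0 := by simpa using hF.even 0 (by simp)
  rw [hadamard_spec ha hF.smooth ht, h0, zero_add]

theorem hadamard_zero (ha : 0 < a) {F : ℝ → ℝ} (hF : ContDiffOn ℝ ∞ F (Icc 0 a)) :
    hadamard a F 0 = derivWithin F (Icc 0 a) 0 := by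
  simpa [iteratedDerivWithin_one] using iteratedDerivWithin_hadamard_zero ha 0 hF

/-- The bound a < 1 keeps away from the endpoint where arcsin fails to be differentiable; this is
why the two ends of the sphere are treated separately and then glued. -/
theorem isOddAtZero_arcsin (ha : 0 < a) (ha1 : a < 1) : IsOddAtZero a Real.arcsin := by
  have hsm : ∀ t ∈ Icc 0 a, ContDiffAt ℝ ∞ Real.arcsin t := fun t ht =>
    Real.contDiffAt_arcsin (by linarith [ht.1]) (by linarith [ht.2])
  have h0 : (0 : ℝ) ∈ Icc 0 a := ⟨le_rfl, ha.le⟩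
  refine ⟨fun t ht => (hsm t ht).contDiffWithinAt, fun j hj => ?_⟩
  rw [iteratedDerivWithin_eq_iteratedDeriv (uniqueDiffOn_Icc ha)
    ((hsm 0 h0).of_le (by exact_mod_cast le_top)) h0]
  have h1 := iteratedDeriv_comp_neg j Real.arcsin 0
  have h2 : (fun x => Real.arcsin (-x)) = -Real.arcsin := by
    funext x; simp [Real.arcsin_neg]
  rw [h2, iteratedDeriv_neg, neg_zero, hj.neg_one_pow, one_smul] at h1
  linarith

/-- The normalised radial coordinate of a point of `Sⁿ`, as a function of the square of the norm
of its second component. -/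
def radial (S : ℝ) : ℝ := 2 / Real.pi * Real.arcsin √S

theorem radial_mem_Icc (S : ℝ) : radial S ∈ Icc 0 1 := by
  have hpi := Real.pi_pos
  refine ⟨mul_nonneg (by positivity) (Real.arcsin_nonneg.2 (Real.sqrt_nonneg _)), ?_⟩
  calc radial S ≤ 2 / Real.pi * (Real.pi / 2) := by
        unfold radial; gcongr; exact Real.arcsin_le_pi_div_two _
    _ = 1 := by field_simp

theorem radial_mem_Ioo {S : ℝ} (hS : S ∈ Ioo 0 1) : radial S ∈ Ioo 0 1 := by
  have hpi := Real.pi_pos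
  refine ⟨mul_pos (by positivity) (Real.arcsin_pos.2 (Real.sqrt_pos.2 hS.1)), ?_⟩
  calc radial S < 2 / Real.pi * (Real.pi / 2) := by
        unfold radial; gcongr
        exact Real.arcsin_lt_pi_div_two.2 ((Real.sqrt_lt' one_pos).2 (by simpa using hS.2))
    _ = 1 := by field_simp

/-- From arccos √S = arcsin √(1 - S). This is the symmetry exchanging the two sphere factors. -/
theorem radial_one_sub {S : ℝ} (hS : S ∈ Icc 0 1) : radial (1 - S) = 1 - radial S := by
  have hpi := Real.pi_pos.ne'
  have h := Real.arccos_eq_arcsin (Real.sqrt_nonneg S)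
  rw [Real.sq_sqrt hS.1, Real.arccos] at h
  rw [radial, ← h, radial]
  field_simp

theorem radial_lt_one {S : ℝ} (hS : S < 1) : radial S < 1 := by
  rcases lt_or_ge 0 S with h | h
  · exact (radial_mem_Ioo ⟨h, hS⟩).2
  · simp [radial, Real.sqrt_eq_zero_of_nonpos h]

/-- Smooth coefficients of a doubly warped product metric on `0 ≤ S ≤ a²`. -/
theorem exists_coefficients_near_zero {f h : ℝ → ℝ} {b : ℝ} (hb : 0 < b) (hf : IsEvenAtZero 1 f)
    (hfpos : ∀ r ∈ Ico (0 : ℝ) 1, 0 < f r) (hh : IsOddAtZero 1 h)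
    (hhpos : ∀ r ∈ Ioo (0 : ℝ) 1, 0 < h r) (hh' : derivWithin h (Icc 0 1) 0 = b)
    (ha : 0 < a) (ha1 : a < 1) :
    ∃ A B C : ℝ → ℝ, ContDiffOn ℝ ∞ A (Icc 0 (a ^ 2)) ∧ ContDiffOn ℝ ∞ B (Icc 0 (a ^ 2)) ∧
      ContDiffOn ℝ ∞ C (Icc 0 (a ^ 2)) ∧ ∀ S ∈ Icc 0 (a ^ 2), 0 < A S ∧ 0 < B S ∧
        A S * S + B S * (1 - S) + C S * (S * (1 - S)) = (2 * b / Real.pi) ^ 2 ∧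
        A S * (1 - S) = f (radial S) ^ 2 ∧ B S * S = h (radial S) ^ 2 := by
  have hpi := Real.pi_pos
  have ha2 : 0 < a ^ 2 := by positivity
  have ha21 : a ^ 2 < 1 := by nlinarith
  have hodd := isOddAtZero_arcsin ha ha1
  set w : ℝ → ℝ := hadamard a Real.arcsin
  set H : ℝ → ℝ := hadamard 1 h
  have hw : IsEvenAtZero a w := hodd.isEvenAtZero_hadamard ha
  have hH : IsEvenAtZero 1 H := hh.isEvenAtZero_hadamard one_pos
  have hw0 : w 0 = 1 := by
    change hadamard a Real.arcsin 0 = 1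
    rw [hadamard_zero ha hodd.smooth]
    have : HasDerivAt Real.arcsin 1 0 := by
      simpa using Real.hasDerivAt_arcsin (x := 0) (by norm_num) (by norm_num)
    exact this.hasDerivWithinAt.derivWithin (uniqueDiffOn_Icc ha _ ⟨le_rfl, ha.le⟩)
  have hH0 : H 0 = b := by
    change hadamard 1 h 0 = b
    rw [hadamard_zero one_pos hh.smooth, hh']
  -- Here ρ = r² and ρ₁ = r²/S. The function arcsin(x)/x is even, so both are smooth in S, although
  -- r itself is not.
  let ρ₁ : ℝ → ℝ := fun S => (2 / Real.pi) ^ 2 * w √S ^ 2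
  let ρ : ℝ → ℝ := fun S => S * ρ₁ S
  have hρ₁ : ContDiffOn ℝ ∞ ρ₁ (Icc 0 (a ^ 2)) :=
    contDiffOn_const.mul ((hw.contDiffOn_sqrt ha).pow 2)
  have hρ : ContDiffOn ℝ ∞ ρ (Icc 0 (a ^ 2)) := contDiffOn_id.mul hρ₁
  have hρeq : ∀ S ∈ Icc 0 (a ^ 2), ρ S = radial S ^ 2 := fun S hS => by
    simp only [ρ, ρ₁, radial]
    rw [hodd.eq_mul_hadamard ha (sqrt_mem_Icc ha hS)]
    have := Real.sq_sqrt hS.1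
    linear_combination (-(2 / Real.pi) ^ 2 * w √S ^ 2) * this
  have hmaps : MapsTo ρ (Icc 0 (a ^ 2)) (Icc 0 (1 ^ 2)) := fun S hS => by
    rw [hρeq S hS]
    have := radial_mem_Icc S
    exact ⟨by positivity, pow_le_pow_left₀ this.1 this.2 2⟩
  have hsqrt : ∀ S ∈ Icc 0 (a ^ 2), √(ρ S) = radial S := fun S hS => by
    rw [hρeq S hS, Real.sqrt_sq (radial_mem_Icc S).1]
  let A : ℝ → ℝ := fun S => f √(ρ S) ^ 2 / (1 - S)
  let B : ℝ → ℝ := fun S => ρ₁ S * H √(ρ S) ^ 2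
  have h1S : ∀ S ∈ Icc 0 (a ^ 2), 0 < 1 - S := fun S hS => by linarith [hS.2]
  have hA : ContDiffOn ℝ ∞ A (Icc 0 (a ^ 2)) :=
    (((hf.contDiffOn_sqrt one_pos).comp hρ hmaps).pow 2).div (contDiffOn_const.sub contDiffOn_id)
      fun S hS => (h1S S hS).ne'
  have hB : ContDiffOn ℝ ∞ B (Icc 0 (a ^ 2)) :=
    hρ₁.mul (((hH.contDiffOn_sqrt one_pos).comp hρ hmaps).pow 2)
  -- The equation for the coefficient of dt² forces C = N/(S(1 - S)). The slope of h at 0 being b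
  -- gives B(0) = (2b/π)², hence N(0) = 0, and the Hadamard quotient of N makes C smooth.
  let N : ℝ → ℝ := fun S => (2 * b / Real.pi) ^ 2 - A S * S - B S * (1 - S)
  have hN : ContDiffOn ℝ ∞ N (Icc 0 (a ^ 2)) :=
    (contDiffOn_const.sub (hA.mul contDiffOn_id)).sub (hB.mul (contDiffOn_const.sub contDiffOn_id))
  have hN0 : N 0 = 0 := by
    simp [N, B, ρ, ρ₁, hw0, hH0]
    ring
  have hBS : ∀ S ∈ Icc 0 (a ^ 2), B S * S = h (radial S) ^ 2 := fun S hS => by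
    rw [hh.eq_mul_hadamard one_pos (radial_mem_Icc S), mul_pow, ← hρeq S hS]
    simp only [B, hsqrt S hS, ρ]
    ring
  refine ⟨A, B, fun S => hadamard (a ^ 2) N S / (1 - S), hA, hB,
    (contDiffOn_hadamard ha2 hN).div (contDiffOn_const.sub contDiffOn_id)
      fun S hS => (h1S S hS).ne', fun S hS => ⟨?_, ?_, ?_, ?_, hBS S hS⟩⟩
  · simp only [A, hsqrt S hS]
    have := hfpos (radial S) ⟨(radial_mem_Icc S).1, radial_lt_one (by linarith [hS.2])⟩
    have := h1S S hS
    positivity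
  · rcases hS.1.eq_or_lt with rfl | hpos
    · simp [B, ρ, ρ₁, hw0, hH0]
      positivity
    · have h2 := hhpos _ (radial_mem_Ioo ⟨hpos, by linarith [hS.2]⟩)
      have h3 := hBS S hS
      have h4 : 0 < B S * S := by rw [h3]; positivity
      exact pos_of_mul_pos_left h4 hpos.le
  · have h5 := hadamard_spec ha2 hN hS
    rw [hN0, zero_add] at h5
    have := (h1S S hS).ne'
    have h6 : hadamard (a ^ 2) N S / (1 - S) * (S * (1 - S)) = N S := by
      rw [h5]; field_simp
    rw [h6]
    simp only [N]
    ring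
  · have := (h1S S hS).ne'
    simp only [A, hsqrt S hS]
    field_simp

/-- The two branches agree on a neighbourhood of the switching point 1/2, so smoothness is local to
one branch at a time. -/
theorem contDiffOn_ite_half {A A' : ℝ → ℝ} {a : ℝ} (ha : 1 / 2 < a)
    (hA : ContDiffOn ℝ ∞ A (Icc 0 a)) (hA' : ContDiffOn ℝ ∞ A' (Icc 0 a))
    (heq : ∀ S ∈ Ioo (1 - a) a, A S = A' (1 - S)) :
    ContDiffOn ℝ ∞ (fun S => if S ≤ 1 / 2 then A S else A' (1 - S)) (Icc 0 1) := by
  intro S hS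
  rcases lt_or_ge S a with h | h
  · have h1 : ContDiffWithinAt ℝ ∞ A (Icc 0 1) S := by
      refine (hA S ⟨hS.1, h.le⟩).mono_of_mem_nhdsWithin ?_
      filter_upwards [self_mem_nhdsWithin, mem_nhdsWithin_of_mem_nhds (Iio_mem_nhds h)]
        with x hx hx' using ⟨hx.1, le_of_lt hx'⟩
    have key : ∀ x < a, (if x ≤ 1 / 2 then A x else A' (1 - x)) = A x := fun x hxa => by
      split_ifs with hx'
      · rfl
      · exact (heq x ⟨by linarith, hxa⟩).symm
    refine h1.congr_of_eventuallyEq ?_ (key S h)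
    filter_upwards [mem_nhdsWithin_of_mem_nhds (Iio_mem_nhds h)] with x hx using key x hx
  · have hS2 : 1 / 2 < S := by linarith
    have h1 : ContDiffWithinAt ℝ ∞ (fun x => A' (1 - x)) (Icc 0 1 ∩ Ioi (1 / 2)) S := by
      refine ContDiffWithinAt.comp S (hA' (1 - S) ⟨by linarith [hS.2], by linarith⟩)
        (contDiffWithinAt_const.sub contDiffWithinAt_id) fun x hx => ?_
      exact ⟨by linarith [hx.1.2], by linarith [mem_Ioi.1 hx.2]⟩
    have h2 : ContDiffWithinAt ℝ ∞ (fun x => A' (1 - x)) (Icc 0 1) S :=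
      h1.mono_of_mem_nhdsWithin (inter_mem self_mem_nhdsWithin
        (mem_nhdsWithin_of_mem_nhds (Ioi_mem_nhds hS2)))
    refine h2.congr_of_eventuallyEq ?_ (if_neg (not_le.2 hS2))
    filter_upwards [mem_nhdsWithin_of_mem_nhds (Ioi_mem_nhds hS2)] with x hx
      using if_neg (not_le.2 hx)

/-- The normalised warping functions of a metric in `Ŵ(0, b)`, on the unit interval. -/
structure IsNormalizedPair (b : ℝ) (f h : ℝ → ℝ) : Prop where
  even_left : IsEvenAtZero 1 f
  odd_right : IsOddAtZero 1 h
  even_reflect : IsEvenAtZero 1 (fun r => h (1 - r))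
  odd_reflect : IsOddAtZero 1 (fun r => f (1 - r))
  pos_left : ∀ r ∈ Ico (0 : ℝ) 1, 0 < f r
  pos_right : ∀ r ∈ Ioc (0 : ℝ) 1, 0 < h r
  deriv_right : derivWithin h (Icc 0 1) 0 = b
  deriv_left : derivWithin (fun r => f (1 - r)) (Icc 0 1) 0 = b

theorem IsNormalizedPair.reflect {b : ℝ} {f h : ℝ → ℝ} (hp : IsNormalizedPair b f h) :
    IsNormalizedPair b (fun r => h (1 - r)) (fun r => f (1 - r)) where
  even_left := hp.even_reflect
  odd_right := hp.odd_reflect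
  even_reflect := by simpa using hp.even_left
  odd_reflect := by simpa using hp.odd_right
  pos_left r hr := hp.pos_right _ ⟨by linarith [hr.2], by linarith [hr.1]⟩
  pos_right r hr := hp.pos_left _ ⟨by linarith [hr.2], by linarith [hr.1]⟩
  deriv_right := hp.deriv_left
  deriv_left := by simpa using hp.deriv_right

/-- Smooth coefficients of a doubly warped product metric. -/
theorem IsNormalizedPair.exists_coefficients {f h : ℝ → ℝ} {b : ℝ} (hb : 0 < b)
    (hp : IsNormalizedPair b f h) :
    ∃ A B C : ℝ → ℝ, ContDiffOn ℝ ∞ A (Icc 0 1) ∧ ContDiffOn ℝ ∞ B (Icc 0 1) ∧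
      ContDiffOn ℝ ∞ C (Icc 0 1) ∧ ∀ S ∈ Icc (0 : ℝ) 1, 0 < A S ∧ 0 < B S ∧
        A S * S + B S * (1 - S) + C S * (S * (1 - S)) = (2 * b / Real.pi) ^ 2 ∧
        A S * (1 - S) = f (radial S) ^ 2 ∧ B S * S = h (radial S) ^ 2 := by
  -- Any a < 1 with a² > 1/2 would do: the intervals S ≤ a² and 1 - S ≤ a² must cover [0, 1] and
  -- overlap around 1/2.
  have ha2 : ((4 / 5 : ℝ)) ^ 2 = 16 / 25 := by norm_num
  obtain ⟨A, B, C, hA, hB, hC, hspec⟩ := exists_coefficients_near_zero hb hp.even_left hp.pos_left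
    hp.odd_right (fun r hr => hp.pos_right r ⟨hr.1, hr.2.le⟩) hp.deriv_right
    (a := 4 / 5) (by norm_num) (by norm_num)
  have hr := hp.reflect
  -- Reflection exchanges the sphere factors, so the first coefficient of the reflected pair plays
  -- the role of B and the second that of A.
  obtain ⟨B', A', C', hB', hA', hC', hspec'⟩ := exists_coefficients_near_zero hb hr.even_left
    hr.pos_left hr.odd_right (fun r h => hr.pos_right r ⟨h.1, h.2.le⟩) hr.deriv_right
    (a := 4 / 5) (by norm_num) (by norm_num)
  rw [ha2] at hA hB hC hspec hA' hB' hC' hspec'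
  have hrel : ∀ S ∈ Icc 0 1, 1 - S ∈ Icc 0 (16 / 25) → 0 < A' (1 - S) ∧ 0 < B' (1 - S) ∧
      A' (1 - S) * S + B' (1 - S) * (1 - S) + C' (1 - S) * (S * (1 - S)) = (2 * b / Real.pi) ^ 2 ∧
        A' (1 - S) * (1 - S) = f (radial S) ^ 2 ∧ B' (1 - S) * S = h (radial S) ^ 2 := by
    intro S hS hS'
    obtain ⟨h1, h2, h3, h4, h5⟩ := hspec' (1 - S) hS'
    simp only [radial_one_sub hS, sub_sub_cancel] at h4 h5
    exact ⟨h2, h1, by linarith, h5, h4⟩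
  -- For 0 < S < 1 the three equations determine A, B and C, so the two constructions agree on the
  -- overlap.
  have heq : ∀ S ∈ Ioo (1 - 16 / 25 : ℝ) (16 / 25), A S = A' (1 - S) ∧ B S = B' (1 - S) ∧
      C S = C' (1 - S) := by
    intro S hS
    have hS0 : 0 < S := by linarith [hS.1]
    have hS1 : 0 < 1 - S := by linarith [hS.2]
    obtain ⟨-, -, h3, h4, h5⟩ := hspec S ⟨hS0.le, hS.2.le⟩
    obtain ⟨-, -, h3', h4', h5'⟩ := hrel S ⟨hS0.le, by linarith⟩ ⟨hS1.le, by linarith [hS.1]⟩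
    have e1 : A S = A' (1 - S) := mul_right_cancel₀ hS1.ne' (h4.trans h4'.symm)
    have e2 : B S = B' (1 - S) := mul_right_cancel₀ hS0.ne' (h5.trans h5'.symm)
    refine ⟨e1, e2, mul_right_cancel₀ (mul_pos hS0 hS1).ne' ?_⟩
    rw [e1, e2] at h3
    linarith
  refine ⟨_, _, _, contDiffOn_ite_half (by norm_num) hA hA' fun S hS => (heq S hS).1,
    contDiffOn_ite_half (by norm_num) hB hB' fun S hS => (heq S hS).2.1,
    contDiffOn_ite_half (by norm_num) hC hC' fun S hS => (heq S hS).2.2,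
    fun S hS => ?_⟩
  by_cases hS2 : S ≤ 1 / 2
  · simp only [if_pos hS2]
    exact hspec S ⟨hS.1, by linarith⟩
  · simp only [if_neg hS2]
    exact hrel S hS ⟨by linarith [hS.2], by linarith⟩

end Coefficients

/-! ### Linear algebra in ℝᵖ⁺¹ × ℝ^{q+1} and the ambient form -/

section Ambient

variable {n p q : ℕ} (h : p + q + 1 = n)

/-- The first component of a point of `ℝⁿ⁺¹ = ℝᵖ⁺¹ × ℝ^{q+1}`. -/
def projP : EuclideanSpace ℝ (Fin (n + 1)) →L[ℝ] EuclideanSpace ℝ (Fin (p + 1)) :=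
  LinearMap.toContinuousLinearMap
    { toFun := fun z => WithLp.toLp 2 fun i => z (Fin.cast (by omega) (Fin.castAdd (q + 1) i))
      map_add' := fun _ _ => rfl
      map_smul' := fun _ _ => rfl }

/-- The second component of a point of `ℝⁿ⁺¹ = ℝᵖ⁺¹ × ℝ^{q+1}`. -/
def projQ : EuclideanSpace ℝ (Fin (n + 1)) →L[ℝ] EuclideanSpace ℝ (Fin (q + 1)) :=
  LinearMap.toContinuousLinearMap
    { toFun := fun z => WithLp.toLp 2 fun i => z (Fin.cast (by omega) (Fin.natAdd (p + 1) i))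
      map_add' := fun _ _ => rfl
      map_smul' := fun _ _ => rfl }

theorem projP_apply (z : EuclideanSpace ℝ (Fin (n + 1))) (i : Fin (p + 1)) :
    projP h z i = z (Fin.cast (by omega) (Fin.castAdd (q + 1) i)) := rfl

theorem projQ_apply (z : EuclideanSpace ℝ (Fin (n + 1))) (i : Fin (q + 1)) :
    projQ h z i = z (Fin.cast (by omega) (Fin.natAdd (p + 1) i)) := rfl

theorem join_apply (x : EuclideanSpace ℝ (Fin (p + 1))) (y : EuclideanSpace ℝ (Fin (q + 1)))
    (i : Fin (n + 1)) : join h x y i = Fin.append x.ofLp y.ofLp (Fin.cast (by omega) i) := rfl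

@[simp] theorem projP_join (x : EuclideanSpace ℝ (Fin (p + 1)))
    (y : EuclideanSpace ℝ (Fin (q + 1))) : projP h (join h x y) = x := by
  ext i
  simp [projP_apply, join_apply]

@[simp] theorem projQ_join (x : EuclideanSpace ℝ (Fin (p + 1)))
    (y : EuclideanSpace ℝ (Fin (q + 1))) : projQ h (join h x y) = y := by
  ext i
  simp [projQ_apply, join_apply]

theorem join_proj (z : EuclideanSpace ℝ (Fin (n + 1))) :
    join h (projP h z) (projQ h z) = z := by
  ext i
  have key : ∀ j : Fin ((p + 1) + (q + 1)),
      Fin.append (projP h z).ofLp (projQ h z).ofLp j = z (Fin.cast (by omega) j) := by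
    intro j
    refine Fin.addCases (fun j => ?_) (fun j => ?_) j
    · simp [projP_apply]
    · simp [projQ_apply]
  exact key _

theorem norm_proj_sq (z : EuclideanSpace ℝ (Fin (n + 1))) :
    ‖projP h z‖ ^ 2 + ‖projQ h z‖ ^ 2 = ‖z‖ ^ 2 := by
  rw [← norm_join_sq h, join_proj]

theorem join_add (x x' : EuclideanSpace ℝ (Fin (p + 1))) (y y' : EuclideanSpace ℝ (Fin (q + 1))) :
    join h (x + x') (y + y') = join h x y + join h x' y' := by
  rw [← join_proj h (join h x y + join h x' y')]
  simp

theorem join_smul (c : ℝ) (x : EuclideanSpace ℝ (Fin (p + 1)))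
    (y : EuclideanSpace ℝ (Fin (q + 1))) :
    join h (c • x) (c • y) = c • join h x y := by
  rw [← join_proj h (c • join h x y)]
  simp

/-- The map `join` as a continuous linear map. -/
def joinL : EuclideanSpace ℝ (Fin (p + 1)) × EuclideanSpace ℝ (Fin (q + 1)) →L[ℝ]
    EuclideanSpace ℝ (Fin (n + 1)) :=
  LinearMap.toContinuousLinearMap
    { toFun := fun z => join h z.1 z.2
      map_add' := fun z w => join_add h z.1 w.1 z.2 w.2
      map_smul' := fun c z => join_smul h c z.1 z.2 }

@[simp] theorem joinL_apply (z : EuclideanSpace ℝ (Fin (p + 1)) × EuclideanSpace ℝ (Fin (q + 1))) :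
    joinL h z = join h z.1 z.2 := rfl

/-- The form `|dx|²` on `ℝᵖ⁺¹ × ℝ^{q+1}`. -/
def ambientP : EuclideanSpace ℝ (Fin (n + 1)) →L[ℝ] EuclideanSpace ℝ (Fin (n + 1)) →L[ℝ] ℝ :=
  (innerSL ℝ).bilinearComp (projP h) (projP h)

/-- The form `|dy|²` on `ℝᵖ⁺¹ × ℝ^{q+1}`. -/
def ambientQ : EuclideanSpace ℝ (Fin (n + 1)) →L[ℝ] EuclideanSpace ℝ (Fin (n + 1)) →L[ℝ] ℝ :=
  (innerSL ℝ).bilinearComp (projQ h) (projQ h)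

/-- The symmetric bilinear form `A |dx|² + B |dy|² + C (x · dx)²` on `ℝᵖ⁺¹ × ℝ^{q+1}` at `z`. -/
def ambientForm (A B C : ℝ) (z : EuclideanSpace ℝ (Fin (n + 1))) :
    EuclideanSpace ℝ (Fin (n + 1)) →L[ℝ] EuclideanSpace ℝ (Fin (n + 1)) →L[ℝ] ℝ :=
  A • ambientP h + B • ambientQ h + C • (ambientP h z).smulRight (ambientP h z)

@[simp] theorem ambientP_apply (ξ η : EuclideanSpace ℝ (Fin (n + 1))) :
    ambientP h ξ η = inner ℝ (projP h ξ) (projP h η) := rfl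

@[simp] theorem ambientQ_apply (ξ η : EuclideanSpace ℝ (Fin (n + 1))) :
    ambientQ h ξ η = inner ℝ (projQ h ξ) (projQ h η) := rfl

theorem ambientForm_apply (A B C : ℝ) (z ξ η : EuclideanSpace ℝ (Fin (n + 1))) :
    ambientForm h A B C z ξ η = A * inner ℝ (projP h ξ) (projP h η)
      + B * inner ℝ (projQ h ξ) (projQ h η)
      + C * (inner ℝ (projP h z) (projP h ξ) * inner ℝ (projP h z) (projP h η)) := by
  simp [ambientForm]

/-- The computation behind the normal form. Here k and s stand for the cosine and sine of the angle,
and m, m' for its rates of change. Orthogonality of φ to α and of θ to β removes all cross terms. -/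
theorem ambientForm_warped {A B C k s m m' : ℝ} {φ α α' : EuclideanSpace ℝ (Fin (p + 1))}
    {θ β β' : EuclideanSpace ℝ (Fin (q + 1))} (hφ : ‖φ‖ = 1) (hθ : ‖θ‖ = 1)
    (hα : inner ℝ φ α = 0) (hα' : inner ℝ φ α' = 0) (hβ : inner ℝ θ β = 0)
    (hβ' : inner ℝ θ β' = 0) :
    ambientForm h A B C (join h (k • φ) (s • θ)) (join h (-(s * m) • φ + k • α) ((k * m) • θ + s • β))
        (join h (-(s * m') • φ + k • α') ((k * m') • θ + s • β'))
      = m * m' * (A * s ^ 2 + B * k ^ 2 + C * (s ^ 2 * k ^ 2)) + A * k ^ 2 * inner ℝ α α'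
        + B * s ^ 2 * inner ℝ β β' := by
  have h1 : inner ℝ φ φ = (1 : ℝ) := by rw [real_inner_self_eq_norm_sq, hφ]; norm_num
  have h2 : inner ℝ θ θ = (1 : ℝ) := by rw [real_inner_self_eq_norm_sq, hθ]; norm_num
  have h3 : inner ℝ α φ = 0 := by rw [real_inner_comm]; exact hα
  have h4 : inner ℝ β θ = 0 := by rw [real_inner_comm]; exact hβ
  rw [ambientForm_apply]
  simp only [projP_join, projQ_join, inner_add_left, inner_add_right, inner_smul_left,
    inner_smul_right, RCLike.conj_to_real, h1, h2, h3, h4, hα, hα', hβ']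
  ring

/-- The ambient version of `warpMap`. -/
def warpJoin (b : ℝ) (z : ℝ × EuclideanSpace ℝ (Fin (p + 1)) × EuclideanSpace ℝ (Fin (q + 1))) :
    EuclideanSpace ℝ (Fin (n + 1)) :=
  join h (Real.cos (Real.pi * z.1 / (2 * b)) • z.2.1) (Real.sin (Real.pi * z.1 / (2 * b)) • z.2.2)

theorem contDiff_warpJoin (b : ℝ) : ContDiff ℝ ∞ (warpJoin h b) := by
  have h1 : ContDiff ℝ ∞ fun z : ℝ × EuclideanSpace ℝ (Fin (p + 1)) × EuclideanSpace ℝ (Fin (q + 1)) =>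
      (Real.cos (Real.pi * z.1 / (2 * b)) • z.2.1, Real.sin (Real.pi * z.1 / (2 * b)) • z.2.2) := by
    fun_prop
  exact (joinL h).contDiff.comp h1

theorem fderiv_warpJoin (b : ℝ)
    (z w : ℝ × EuclideanSpace ℝ (Fin (p + 1)) × EuclideanSpace ℝ (Fin (q + 1))) :
    fderiv ℝ (warpJoin h b) z w
      = join h (-(Real.sin (Real.pi * z.1 / (2 * b)) * (Real.pi / (2 * b) * w.1)) • z.2.1
            + Real.cos (Real.pi * z.1 / (2 * b)) • w.2.1)
          ((Real.cos (Real.pi * z.1 / (2 * b)) * (Real.pi / (2 * b) * w.1)) • z.2.2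
            + Real.sin (Real.pi * z.1 / (2 * b)) • w.2.2) := by
  have h1 : HasFDerivAt (fun z : ℝ × EuclideanSpace ℝ (Fin (p + 1)) × EuclideanSpace ℝ (Fin (q + 1)) =>
      Real.pi * z.1 / (2 * b)) ((Real.pi / (2 * b)) • ContinuousLinearMap.fst ℝ _ _) z := by
    have := (hasFDerivAt_fst (𝕜 := ℝ) (p := z)).const_mul (Real.pi / (2 * b))
    refine this.congr_of_eventuallyEq (Eventually.of_forall fun x => ?_)
    simp only
    ring
  have h2 := hasFDerivAt_snd (𝕜 := ℝ) (p := z)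
  have h3 := (h1.cos.smul ((hasFDerivAt_fst (𝕜 := ℝ) (p := z.2)).comp z h2)).prodMk
    (h1.sin.smul ((hasFDerivAt_snd (𝕜 := ℝ) (p := z.2)).comp z h2))
  have h4 := (joinL h).hasFDerivAt.comp z h3
  have h5 : HasFDerivAt (warpJoin h b) _ z := h4
  rw [h5.fderiv]
  simp only [ContinuousLinearMap.comp_apply, joinL_apply]
  congr 1
  · simp
    module
  · simp
    module

theorem ambientForm_warpJoin {A B C b : ℝ}
    {z ξ η : ℝ × EuclideanSpace ℝ (Fin (p + 1)) × EuclideanSpace ℝ (Fin (q + 1))}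
    (hφ : ‖z.2.1‖ = 1) (hθ : ‖z.2.2‖ = 1)
    (hα : inner ℝ z.2.1 ξ.2.1 = 0) (hα' : inner ℝ z.2.1 η.2.1 = 0) (hβ : inner ℝ z.2.2 ξ.2.2 = 0)
    (hβ' : inner ℝ z.2.2 η.2.2 = 0) :
    ambientForm h A B C (warpJoin h b z) (fderiv ℝ (warpJoin h b) z ξ) (fderiv ℝ (warpJoin h b) z η)
      = (Real.pi / (2 * b)) ^ 2 * (ξ.1 * η.1) * (A * Real.sin (Real.pi * z.1 / (2 * b)) ^ 2
          + B * Real.cos (Real.pi * z.1 / (2 * b)) ^ 2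
          + C * (Real.sin (Real.pi * z.1 / (2 * b)) ^ 2 * Real.cos (Real.pi * z.1 / (2 * b)) ^ 2))
        + A * Real.cos (Real.pi * z.1 / (2 * b)) ^ 2 * inner ℝ ξ.2.1 η.2.1
        + B * Real.sin (Real.pi * z.1 / (2 * b)) ^ 2 * inner ℝ ξ.2.2 η.2.2 := by
  rw [fderiv_warpJoin, fderiv_warpJoin, warpJoin, ambientForm_warped h hφ hθ hα hα' hβ hβ']
  ring

end Ambient

/-! ### Differentials of the warped parametrisation -/

section Differentials

theorem inner_dIncl (n : ℕ) (x : S n) (ξ : TangentSpace (𝓡 n) x) :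
    inner ℝ (x : EuclideanSpace ℝ (Fin (n + 1))) (dIncl n x ξ) = 0 := by
  have := Fact.mk (@finrank_euclideanSpace_fin ℝ _ (n + 1))
  have h1 : dIncl n x ξ ∈ (mvfderiv (𝓡 n) ((↑) : S n → EuclideanSpace ℝ (Fin (n + 1))) x).range :=
    ⟨ξ, rfl⟩
  rw [range_mvfderiv_subtypeVal] at h1
  exact Submodule.mem_orthogonal_singleton_iff_inner_right.1 h1

variable {n p q : ℕ} (h : p + q + 1 = n)

theorem coe_warpMap (b : ℝ) (z : ℝ × S p × S q) :
    (warpMap h b z : EuclideanSpace ℝ (Fin (n + 1)))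
      = warpJoin h b (z.1, (z.2.1 : EuclideanSpace ℝ (Fin (p + 1))), (z.2.2 : EuclideanSpace ℝ (Fin (q + 1)))) :=
  rfl

/-- The inclusion of `ℝ × Sᵖ × S^q` in `ℝ × ℝᵖ⁺¹ × ℝ^{q+1}`. -/
def prodIncl (p q : ℕ) (z : ℝ × S p × S q) :
    ℝ × EuclideanSpace ℝ (Fin (p + 1)) × EuclideanSpace ℝ (Fin (q + 1)) :=
  (z.1, (z.2.1 : EuclideanSpace ℝ (Fin (p + 1))), (z.2.2 : EuclideanSpace ℝ (Fin (q + 1))))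

theorem contMDiff_prodIncl (p q : ℕ) :
    ContMDiff (𝓘(ℝ, ℝ).prod ((𝓡 p).prod (𝓡 q)))
      𝓘(ℝ, ℝ × EuclideanSpace ℝ (Fin (p + 1)) × EuclideanSpace ℝ (Fin (q + 1))) ∞
      (prodIncl p q) := by
  have := Fact.mk (@finrank_euclideanSpace_fin ℝ _ (p + 1))
  have := Fact.mk (@finrank_euclideanSpace_fin ℝ _ (q + 1))
  exact contMDiff_fst.prodMk_space (((contMDiff_coe_sphere (n := p)).comp
    (contMDiff_fst.comp contMDiff_snd)).prodMk_space ((contMDiff_coe_sphere (n := q)).comp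
      (contMDiff_snd.comp contMDiff_snd)))

theorem contMDiff_warpMap (b : ℝ) :
    ContMDiff (𝓘(ℝ, ℝ).prod ((𝓡 p).prod (𝓡 q))) (𝓡 n) ∞ (warpMap h b) := by
  have := Fact.mk (@finrank_euclideanSpace_fin ℝ _ (n + 1))
  exact ContMDiff.codRestrict_sphere (n := n)
    ((contDiff_warpJoin h b).contMDiff.comp (contMDiff_prodIncl p q)) fun z => (warpMap h b z).2

/-- A product of vector spaces carries both the product model and its own self model; the rewriting
identifies the two. -/
theorem HasMFDerivAt.prodMk_normed {E H M E' E'' : Type*} [NormedAddCommGroup E] [NormedSpace ℝ E]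
    [TopologicalSpace H] {I : ModelWithCorners ℝ E H} [TopologicalSpace M] [ChartedSpace H M]
    [NormedAddCommGroup E'] [NormedSpace ℝ E'] [NormedAddCommGroup E''] [NormedSpace ℝ E'']
    {f : M → E'} {g : M → E''} {x : M} {f' : E →L[ℝ] E'} {g' : E →L[ℝ] E''}
    (hf : HasMFDerivAt I 𝓘(ℝ, E') f x f') (hg : HasMFDerivAt I 𝓘(ℝ, E'') g x g') :
    HasMFDerivAt I 𝓘(ℝ, E' × E'') (fun x => (f x, g x)) x (f'.prod g') := by
  rw [modelWithCornersSelf_prod, ← chartedSpaceSelf_prod]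
  exact hf.prodMk hg

theorem mfderiv_prodIncl (z : ℝ × S p × S q)
    (ξ : TangentSpace (𝓘(ℝ, ℝ).prod ((𝓡 p).prod (𝓡 q))) z) :
    mfderiv (𝓘(ℝ, ℝ).prod ((𝓡 p).prod (𝓡 q)))
      𝓘(ℝ, ℝ × EuclideanSpace ℝ (Fin (p + 1)) × EuclideanSpace ℝ (Fin (q + 1))) (prodIncl p q) z ξ
      = (ξ.1, dIncl p z.2.1 ξ.2.1, dIncl q z.2.2 ξ.2.2) := by
  have := Fact.mk (@finrank_euclideanSpace_fin ℝ _ (p + 1))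
  have := Fact.mk (@finrank_euclideanSpace_fin ℝ _ (q + 1))
  have hp : HasMFDerivAt (𝓡 p) 𝓘(ℝ, EuclideanSpace ℝ (Fin (p + 1)))
      ((↑) : S p → EuclideanSpace ℝ (Fin (p + 1))) z.2.1 (dIncl p z.2.1) :=
    ((contMDiff_coe_sphere (m := ∞) z.2.1).mdifferentiableAt (by simp)).hasMFDerivAt
  have hq : HasMFDerivAt (𝓡 q) 𝓘(ℝ, EuclideanSpace ℝ (Fin (q + 1)))
      ((↑) : S q → EuclideanSpace ℝ (Fin (q + 1))) z.2.2 (dIncl q z.2.2) :=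
    ((contMDiff_coe_sphere (m := ∞) z.2.2).mdifferentiableAt (by simp)).hasMFDerivAt
  have h2 : HasMFDerivAt (𝓘(ℝ, ℝ).prod ((𝓡 p).prod (𝓡 q))) ((𝓡 p).prod (𝓡 q))
      (Prod.snd : ℝ × S p × S q → S p × S q) z _ := hasMFDerivAt_snd z
  have h1 : HasMFDerivAt (𝓘(ℝ, ℝ).prod ((𝓡 p).prod (𝓡 q))) 𝓘(ℝ, ℝ)
      (Prod.fst : ℝ × S p × S q → ℝ) z _ := hasMFDerivAt_fst z
  have hp' := (hp.comp z.2 (hasMFDerivAt_fst z.2)).comp z h2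
  have hq' := (hq.comp z.2 (hasMFDerivAt_snd z.2)).comp z h2
  have key := HasMFDerivAt.prodMk_normed h1 (HasMFDerivAt.prodMk_normed hp' hq')
  have key' : HasMFDerivAt (𝓘(ℝ, ℝ).prod ((𝓡 p).prod (𝓡 q)))
      𝓘(ℝ, ℝ × EuclideanSpace ℝ (Fin (p + 1)) × EuclideanSpace ℝ (Fin (q + 1))) (prodIncl p q) z _ :=
    key
  rw [key'.mfderiv]
  rfl

/-- The chain rule for the commuting square formed by the inclusions and the ambient map. It moves
every computation with tangent vectors of Sⁿ into a vector space. -/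
theorem dIncl_mfderiv_warpMap (b : ℝ) (z : ℝ × S p × S q)
    (ξ : TangentSpace (𝓘(ℝ, ℝ).prod ((𝓡 p).prod (𝓡 q))) z) :
    dIncl n (warpMap h b z) (mfderiv (𝓘(ℝ, ℝ).prod ((𝓡 p).prod (𝓡 q))) (𝓡 n) (warpMap h b) z ξ)
      = fderiv ℝ (warpJoin h b) (prodIncl p q z)
          (ξ.1, dIncl p z.2.1 ξ.2.1, dIncl q z.2.2 ξ.2.2) := by
  have := Fact.mk (@finrank_euclideanSpace_fin ℝ _ (n + 1))
  have h1 : MDifferentiableAt (𝓡 n) 𝓘(ℝ, EuclideanSpace ℝ (Fin (n + 1)))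
      ((↑) : S n → EuclideanSpace ℝ (Fin (n + 1))) (warpMap h b z) :=
    (contMDiff_coe_sphere (m := ∞) _).mdifferentiableAt (by simp)
  have h2 := ((contMDiff_warpMap h b) z).mdifferentiableAt (by simp)
  have h3 := (contMDiff_prodIncl p q z).mdifferentiableAt (by simp)
  have h4 := ((contDiff_warpJoin h b).contMDiff (prodIncl p q z)).mdifferentiableAt (by simp)
  have e1 := mfderiv_comp z h1 h2
  have e2 := mfderiv_comp z h4 h3
  have e3 : ((↑) : S n → EuclideanSpace ℝ (Fin (n + 1))) ∘ warpMap h b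
      = warpJoin h b ∘ prodIncl p q := rfl
  rw [e3, e2] at e1
  have e4 := congrArg (fun L => L ξ) e1
  rw [mfderiv_eq_fderiv] at e4
  rw [← mfderiv_prodIncl]
  exact e4.symm

end Differentials

/-! ### Metrics in charts -/

section Charts

variable {n : ℕ} {M : Type*} [TopologicalSpace M] [ChartedSpace (EuclideanSpace ℝ (Fin n)) M]
  [IsManifold (𝓡 n) ∞ M]

theorem contMDiffOn_chartSymm (c : M) :
    ContMDiffOn 𝓘(ℝ, EuclideanSpace ℝ (Fin n)) (𝓡 n) ∞ (extChartAt (𝓡 n) c).symm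
      (extChartAt (𝓡 n) c).target := contMDiffOn_extChartAt_symm c

theorem mdifferentiableAt_chartSymm {c : M} {y : EuclideanSpace ℝ (Fin n)}
    (hy : y ∈ (extChartAt (𝓡 n) c).target) :
    MDifferentiableAt 𝓘(ℝ, EuclideanSpace ℝ (Fin n)) (𝓡 n) (extChartAt (𝓡 n) c).symm y :=
  ((contMDiffOn_chartSymm c).contMDiffAt
    ((isOpen_extChartAt_target c).mem_nhds hy)).mdifferentiableAt (by simp)

theorem isInvertible_mfderiv_chartSymm {c : M} {y : EuclideanSpace ℝ (Fin n)}
    (hy : y ∈ (extChartAt (𝓡 n) c).target) :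
    (mfderiv 𝓘(ℝ, EuclideanSpace ℝ (Fin n)) (𝓡 n) (extChartAt (𝓡 n) c).symm y).IsInvertible := by
  have := IsManifold.of_le (I := 𝓡 n) (M := M) (m := 1) (n := ∞) one_le_infty
  have h1 := isInvertible_mfderivWithin_extChartAt_symm (I := 𝓡 n) hy
  rwa [show range (𝓡 n) = univ by simp, mfderivWithin_univ] at h1

theorem coordMetric_apply (g : Riem n M) (c : M) (y ξ η : EuclideanSpace ℝ (Fin n)) :
    coordMetric g c y ξ η = g.inner ((extChartAt (𝓡 n) c).symm y)
      (mfderiv 𝓘(ℝ, EuclideanSpace ℝ (Fin n)) (𝓡 n) (extChartAt (𝓡 n) c).symm y ξ)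
      (mfderiv 𝓘(ℝ, EuclideanSpace ℝ (Fin n)) (𝓡 n) (extChartAt (𝓡 n) c).symm y η) := rfl

theorem contMDiffOn_chartVector (c : M) (ξ : EuclideanSpace ℝ (Fin n)) :
    ContMDiffOn 𝓘(ℝ, EuclideanSpace ℝ (Fin n)) (𝓡 n).tangent ∞
      (fun y => (Bundle.TotalSpace.mk' (EuclideanSpace ℝ (Fin n)) ((extChartAt (𝓡 n) c).symm y)
        (mfderiv 𝓘(ℝ, EuclideanSpace ℝ (Fin n)) (𝓡 n) (extChartAt (𝓡 n) c).symm y ξ) :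
          TangentBundle (𝓡 n) M)) (extChartAt (𝓡 n) c).target := by
  have := IsManifold.of_le (I := 𝓡 n) (M := M) (m := 1) (n := ∞) one_le_infty
  have h1 := (contMDiffOn_chartSymm (n := n) c).contMDiffOn_tangentMapWithin (m := ∞) le_rfl
    (isOpen_extChartAt_target c).uniqueMDiffOn
  have h2 : ContMDiffOn 𝓘(ℝ, EuclideanSpace ℝ (Fin n))
      𝓘(ℝ, EuclideanSpace ℝ (Fin n)).tangent ∞
      (fun y => (⟨y, ξ⟩ : TangentBundle 𝓘(ℝ, EuclideanSpace ℝ (Fin n)) (EuclideanSpace ℝ (Fin n))))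
      (extChartAt (𝓡 n) c).target := fun y hy =>
    contMDiffWithinAt_vectorSpace_iff_contDiffWithinAt.2 contDiffWithinAt_const
  refine (h1.comp h2 fun y hy => hy).congr fun y hy => ?_
  simp only [Function.comp_apply, tangentMapWithin]
  rw [mfderivWithin_of_isOpen (isOpen_extChartAt_target c) hy]

/-- Smoothness of an operator-valued map may be tested on fixed vectors, and these correspond to
smooth coordinate vector fields, on which the smooth metric is evaluated. -/
theorem contDiffOn_coordMetric (g : Riem n M) (c : M) :
    ContDiffOn ℝ ∞ (coordMetric g c) (extChartAt (𝓡 n) c).target := by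
  rw [contDiffOn_clm_apply]
  intro ξ
  rw [contDiffOn_clm_apply]
  intro η
  have h1 : ContMDiffOn 𝓘(ℝ, EuclideanSpace ℝ (Fin n)) ((𝓡 n).prod 𝓘(ℝ)) ∞
      (fun y => Bundle.TotalSpace.mk' ℝ (E := Bundle.Trivial M ℝ) ((extChartAt (𝓡 n) c).symm y)
        (coordMetric g c y ξ η)) (extChartAt (𝓡 n) c).target :=
    ContMDiffOn.clm_bundle_apply₂ (F₁ := EuclideanSpace ℝ (Fin n)) (F₂ := EuclideanSpace ℝ (Fin n))
      (g.contMDiff.comp_contMDiffOn (contMDiffOn_chartSymm c))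
      (contMDiffOn_chartVector c ξ) (contMDiffOn_chartVector c η)
  intro y hy
  have h2 := h1 y hy
  simp only [Bundle.contMDiffWithinAt_totalSpace] at h2
  exact h2.2.contDiffWithinAt

theorem coordMetric_symm (g : Riem n M) (c : M) (y ξ η : EuclideanSpace ℝ (Fin n)) :
    coordMetric g c y ξ η = coordMetric g c y η ξ := g.symm _ _ _

theorem coordMetric_pos (g : Riem n M) {c : M} {y ξ : EuclideanSpace ℝ (Fin n)}
    (hy : y ∈ (extChartAt (𝓡 n) c).target) (hξ : ξ ≠ 0) : 0 < coordMetric g c y ξ ξ := by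
  refine g.pos _ _ fun h0 => hξ ?_
  exact (isInvertible_mfderiv_chartSymm hy).injective (h0.trans (map_zero _).symm)

theorem isMetricNear_coordMetric (g : Riem n M) {c : M} {y : EuclideanSpace ℝ (Fin n)}
    (hy : y ∈ (extChartAt (𝓡 n) c).target) : IsMetricNear (coordMetric g c) y where
  smooth := by
    filter_upwards [(isOpen_extChartAt_target c).mem_nhds hy] with z hz
    exact (contDiffOn_coordMetric g c).contDiffAt ((isOpen_extChartAt_target c).mem_nhds hz)
  symm := Eventually.of_forall fun z => coordMetric_symm g c z
  pos := by
    filter_upwards [(isOpen_extChartAt_target c).mem_nhds hy] with z hz ξ hξ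
    exact coordMetric_pos g hz hξ

theorem riem_ext {g g' : Riem n M} (h : ∀ x, g.inner x = g'.inner x) : g = g' := by
  cases g
  cases g'
  congr
  exact funext h

/-- A Riemannian metric is determined by its coordinate expressions. -/
theorem eq_of_coordMetric_eq {g g' : Riem n M}
    (h : ∀ c, ∀ y ∈ (extChartAt (𝓡 n) c).target, coordMetric g c y = coordMetric g' c y) :
    g = g' := by
  refine riem_ext fun x => ?_
  have hy := mem_extChartAt_target (I := 𝓡 n) x
  have hx := extChartAt_to_inv (I := 𝓡 n) x
  have key : g.inner ((extChartAt (𝓡 n) x).symm (extChartAt (𝓡 n) x x))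
      = g'.inner ((extChartAt (𝓡 n) x).symm (extChartAt (𝓡 n) x x)) := by
    have hs := (isInvertible_mfderiv_chartSymm hy).surjective
    ext v w
    obtain ⟨ξ, rfl⟩ := hs v
    obtain ⟨η, rfl⟩ := hs w
    exact congrArg (fun L => L ξ η) (h x _ hy)
  rwa [hx] at key

/-- If a linear relation between Riemannian metrics holds on a dense set, it holds between
their coordinate expressions everywhere. -/
theorem sum_coordMetric_eq_zero_of_dense {ι : Type*} [Fintype ι] (a : ι → ℝ) (g : ι → Riem n M)
    {D : Set M} (hD : Dense D)
    (h : ∀ x ∈ D, ∀ ξ η, ∑ i, a i * (g i).inner x ξ η = 0) (c : M) {y : EuclideanSpace ℝ (Fin n)}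
    (hy : y ∈ (extChartAt (𝓡 n) c).target) : ∑ i, a i • coordMetric (g i) c y = 0 := by
  have hcont : ContinuousOn (fun y => ∑ i, a i • coordMetric (g i) c y)
      (extChartAt (𝓡 n) c).target :=
    continuousOn_finsetSum _ fun i _ => ContinuousOn.const_smul
      (g := fun y => coordMetric (g i) c y) (contDiffOn_coordMetric (g i) c).continuousOn (a i)
  have ho := isOpen_extChartAt_target (I := 𝓡 n) c
  -- Being nonzero is an open condition on the continuous left-hand side, so a failure at y would
  -- persist on an open set of M, which meets D.
  by_contra hne
  have h1 : ∀ᶠ z in 𝓝 y, z ∈ (extChartAt (𝓡 n) c).target ∧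
      ∑ i, a i • coordMetric (g i) c z ≠ 0 :=
    ((ho.eventually_mem hy)).and ((hcont.continuousAt (ho.mem_nhds hy)).eventually_ne hne)
  obtain ⟨U, hU, hUo, hyU⟩ := _root_.eventually_nhds_iff.1 h1
  have h2 : IsOpen ((extChartAt (𝓡 n) c).source ∩ (extChartAt (𝓡 n) c) ⁻¹' U) :=
    (continuousOn_extChartAt c).isOpen_inter_preimage (isOpen_extChartAt_source c) hUo
  obtain ⟨x, ⟨hx1, hx2⟩, hxD⟩ := hD.inter_open_nonempty _ h2
    ⟨(extChartAt (𝓡 n) c).symm y, (extChartAt (𝓡 n) c).map_target hy, by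
      rw [mem_preimage, (extChartAt (𝓡 n) c).right_inv hy]; exact hyU⟩
  refine (hU _ hx2).2 ?_
  have hx := (extChartAt (𝓡 n) c).left_inv hx1
  ext ξ η
  have := h ((extChartAt (𝓡 n) c).symm (extChartAt (𝓡 n) c x)) (by rwa [hx])
    (mfderiv 𝓘(ℝ, EuclideanSpace ℝ (Fin n)) (𝓡 n) (extChartAt (𝓡 n) c).symm _ ξ)
    (mfderiv 𝓘(ℝ, EuclideanSpace ℝ (Fin n)) (𝓡 n) (extChartAt (𝓡 n) c).symm _ η)
  rw [_root_.sum_apply, _root_.sum_apply]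
  exact this

end Charts

/-! ### Metrics on the sphere induced by ambient bilinear forms -/

section TangentForm

variable {n : ℕ}

/-- The restriction to the tangent space of `Sⁿ` at `x` of a bilinear form on `ℝⁿ⁺¹`. -/
def tangentForm (x : S n)
    (B : EuclideanSpace ℝ (Fin (n + 1)) →L[ℝ] EuclideanSpace ℝ (Fin (n + 1)) →L[ℝ] ℝ) :
    TangentSpace (𝓡 n) x →L[ℝ] TangentSpace (𝓡 n) x →L[ℝ] ℝ :=
  (ContinuousLinearMap.precomp ℝ (dIncl n x)).comp (B.comp (dIncl n x))

theorem tangentForm_apply (x : S n)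
    (B : EuclideanSpace ℝ (Fin (n + 1)) →L[ℝ] EuclideanSpace ℝ (Fin (n + 1)) →L[ℝ] ℝ)
    (v w : TangentSpace (𝓡 n) x) : tangentForm x B v w = B (dIncl n x v) (dIncl n x w) := rfl

/-- In a trivialisation the form is Φ precomposed in both arguments with T, the differential of the
inclusion read in tangent coordinates, and T is smooth. -/
theorem contMDiff_tangentForm
    {Φ : S n → EuclideanSpace ℝ (Fin (n + 1)) →L[ℝ] EuclideanSpace ℝ (Fin (n + 1)) →L[ℝ] ℝ}
    (hΦ : ContMDiff (𝓡 n) 𝓘(ℝ, EuclideanSpace ℝ (Fin (n + 1)) →L[ℝ]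
      EuclideanSpace ℝ (Fin (n + 1)) →L[ℝ] ℝ) ∞ Φ) :
    ContMDiff (𝓡 n) ((𝓡 n).prod
      𝓘(ℝ, EuclideanSpace ℝ (Fin n) →L[ℝ] EuclideanSpace ℝ (Fin n) →L[ℝ] ℝ)) ∞
      (fun x : S n => Bundle.TotalSpace.mk'
        (EuclideanSpace ℝ (Fin n) →L[ℝ] EuclideanSpace ℝ (Fin n) →L[ℝ] ℝ)
        (E := fun x : S n => TangentSpace (𝓡 n) x →L[ℝ] TangentSpace (𝓡 n) x →L[ℝ] ℝ)
        x (tangentForm x (Φ x))) := by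
  have := Fact.mk (@finrank_euclideanSpace_fin ℝ _ (n + 1))
  intro x₀
  rw [Bundle.contMDiffAt_section]
  have h1 := ContMDiffAt.mfderiv_const (m := ∞) (n := ∞)
    (contMDiff_coe_sphere (n := n) (E := EuclideanSpace ℝ (Fin (n + 1))) x₀) le_rfl
  generalize hT : inTangentCoordinates (𝓡 n) 𝓘(ℝ, EuclideanSpace ℝ (Fin (n + 1))) id
    (fun x : S n => (x : EuclideanSpace ℝ (Fin (n + 1))))
    (mfderiv (𝓡 n) 𝓘(ℝ, EuclideanSpace ℝ (Fin (n + 1)))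
      (fun x : S n => (x : EuclideanSpace ℝ (Fin (n + 1))))) x₀ = T at h1
  have h2 := h1.clm_precomp (F₃ := ℝ)
  have h4 := h2.clm_comp ((hΦ x₀).clm_comp h1)
  refine h4.congr_of_eventuallyEq ?_
  filter_upwards [(trivializationAt (EuclideanSpace ℝ (Fin n))
      (TangentSpace (𝓡 n) (M := S n)) x₀).open_baseSet.mem_nhds
      (FiberBundle.mem_baseSet_trivializationAt' x₀)] with x hx
  ext v w
  have key : ∀ v, T x v = dIncl n x ((trivializationAt (EuclideanSpace ℝ (Fin n))
      (TangentSpace (𝓡 n) (M := S n)) x₀).symm x v) := by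
    intro v
    rw [← hT]
    simp [inTangentCoordinates, ContinuousLinearMap.inCoordinates]
    rw [← Bundle.Trivialization.symmL_apply (R := ℝ) _ hx]
    rfl
  rw [hom_trivializationAt_apply]
  refine (inCoordinates_apply_eq₂ hx hx (mem_univ _)).trans ?_
  simp only [tangentForm_apply]
  change _ = Φ x (T x v) (T x w)
  rw [key, key]
  simp

/-- By compactness B is bounded below by some c > 0 on the unit sphere, so B v v < 1 forces ‖v‖² ≤
1/c. The unit sphere is empty when F is zero-dimensional, hence the case split. -/
theorem isVonNBounded_of_pos {F : Type*} [NormedAddCommGroup F] [NormedSpace ℝ F]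
    [FiniteDimensional ℝ F] (B : F →L[ℝ] F →L[ℝ] ℝ) (hB : ∀ v, v ≠ 0 → 0 < B v v) :
    Bornology.IsVonNBounded ℝ {v : F | B v v < 1} := by
  have hcont : Continuous fun v : F => B v v := by fun_prop
  obtain ⟨c, hc, hBc⟩ : ∃ c : ℝ, 0 < c ∧ ∀ v : F, ‖v‖ = 1 → c ≤ B v v := by
    rcases (sphere (0 : F) 1).eq_empty_or_nonempty with he | hne
    · exact ⟨1, one_pos, fun v hv => absurd (mem_sphere_zero_iff_norm.2 hv) (by rw [he]; simp)⟩
    · obtain ⟨v₀, hv₀, hmin⟩ := (isCompact_sphere (0 : F) 1).exists_isMinOn hne hcont.continuousOn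
      refine ⟨B v₀ v₀, hB v₀ ?_, fun v hv => hmin (mem_sphere_zero_iff_norm.2 hv)⟩
      rintro rfl
      simp at hv₀
  refine (NormedSpace.isVonNBounded_closedBall ℝ F (√(1 / c))).subset fun v hv => ?_
  rw [mem_closedBall_zero_iff]
  rcases eq_or_ne v 0 with rfl | hv0
  · simp
  have hn : 0 < ‖v‖ := norm_pos_iff.2 hv0
  have h1 := hBc (‖v‖⁻¹ • v) (by rw [norm_smul, norm_inv, norm_norm, inv_mul_cancel₀ hn.ne'])
  simp only [map_smul, smul_apply, smul_eq_mul] at h1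
  refine Real.le_sqrt_of_sq_le ?_
  have hv' : B v v < 1 := hv
  rw [le_div_iff₀ hc]
  have h2 : c * ‖v‖ ^ 2 ≤ B v v := by
    have := mul_le_mul_of_nonneg_right h1 (sq_nonneg ‖v‖)
    calc c * ‖v‖ ^ 2 ≤ _ := this
      _ = B v v := by field_simp
  linarith

/-- The Riemannian metric on `Sⁿ` induced by a field of bilinear forms on `ℝⁿ⁺¹`. -/
def inducedMetric
    (Φ : S n → EuclideanSpace ℝ (Fin (n + 1)) →L[ℝ] EuclideanSpace ℝ (Fin (n + 1)) →L[ℝ] ℝ)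
    (hΦ : ContMDiff (𝓡 n) 𝓘(ℝ, EuclideanSpace ℝ (Fin (n + 1)) →L[ℝ]
      EuclideanSpace ℝ (Fin (n + 1)) →L[ℝ] ℝ) ∞ Φ)
    (hsymm : ∀ x v w, Φ x v w = Φ x w v)
    (hpos : ∀ (x : S n) v, inner ℝ (x : EuclideanSpace ℝ (Fin (n + 1))) v = 0 → v ≠ 0 →
      0 < Φ x v v) : Riem n (S n) where
  inner x := tangentForm x (Φ x)
  symm x v w := hsymm x _ _
  pos x v hv := hpos x _ (inner_dIncl n x v) fun h =>
    hv (dIncl_injective n x (h.trans (map_zero _).symm))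
  isVonNBounded x := by
    let B : EuclideanSpace ℝ (Fin n) →L[ℝ] EuclideanSpace ℝ (Fin n) →L[ℝ] ℝ :=
      tangentForm x (Φ x)
    exact isVonNBounded_of_pos B fun v hv => hpos x _ (inner_dIncl n x v) fun h =>
      hv (dIncl_injective n x (h.trans (map_zero _).symm))
  contMDiff := contMDiff_tangentForm hΦ

end TangentForm

/-! ### The latitude function and positivity of the ambient form -/

section Latitude

variable {n p q : ℕ} (h : p + q + 1 = n)

/-- The function `|y|²` on `Sⁿ ⊆ ℝᵖ⁺¹ × ℝ^{q+1}`. -/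
def latitude (x : S n) : ℝ := ‖projQ h (x : EuclideanSpace ℝ (Fin (n + 1)))‖ ^ 2

theorem norm_projP_sq (x : S n) :
    ‖projP h (x : EuclideanSpace ℝ (Fin (n + 1)))‖ ^ 2 = 1 - latitude h x := by
  have := norm_proj_sq h (x : EuclideanSpace ℝ (Fin (n + 1)))
  rw [norm_eq_of_mem_sphere] at this
  rw [latitude]
  linarith

theorem latitude_mem_Icc (x : S n) : latitude h x ∈ Icc (0 : ℝ) 1 :=
  ⟨sq_nonneg _, by have := norm_projP_sq h x; nlinarith [sq_nonneg ‖projP h (x : EuclideanSpace ℝ (Fin (n + 1)))‖]⟩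

theorem contMDiff_coeSphere (n : ℕ) : ContMDiff (𝓡 n) 𝓘(ℝ, EuclideanSpace ℝ (Fin (n + 1))) ∞
    ((↑) : S n → EuclideanSpace ℝ (Fin (n + 1))) := by
  have := Fact.mk (@finrank_euclideanSpace_fin ℝ _ (n + 1))
  exact contMDiff_coe_sphere

theorem contMDiff_latitude : ContMDiff (𝓡 n) 𝓘(ℝ) ∞ (latitude h) := by
  have h1 : ContDiff ℝ ∞ fun x : EuclideanSpace ℝ (Fin (n + 1)) => ‖projQ h x‖ ^ 2 :=
    (projQ h).contDiff.norm_sq ℝ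
  exact h1.contMDiff.comp (contMDiff_coeSphere n)

theorem contMDiff_comp_latitude {A : ℝ → ℝ} (hA : ContDiffOn ℝ ∞ A (Icc 0 1)) :
    ContMDiff (𝓡 n) 𝓘(ℝ) ∞ fun x => A (latitude h x) :=
  hA.contMDiffOn.comp_contMDiff (contMDiff_latitude h) (latitude_mem_Icc h)

theorem contMDiff_ambientForm {A B C : ℝ → ℝ} (hA : ContDiffOn ℝ ∞ A (Icc 0 1))
    (hB : ContDiffOn ℝ ∞ B (Icc 0 1)) (hC : ContDiffOn ℝ ∞ C (Icc 0 1)) :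
    ContMDiff (𝓡 n) 𝓘(ℝ, EuclideanSpace ℝ (Fin (n + 1)) →L[ℝ]
      EuclideanSpace ℝ (Fin (n + 1)) →L[ℝ] ℝ) ∞
      fun x : S n => ambientForm h (A (latitude h x)) (B (latitude h x)) (C (latitude h x)) x := by
  have hL : ContDiff ℝ ∞ fun x : EuclideanSpace ℝ (Fin (n + 1)) =>
      (ambientP h x).smulRight (ambientP h x) :=
    (ambientP h).contDiff.smulRight (ambientP h).contDiff
  exact (((contMDiff_comp_latitude h hA).smul contMDiff_const).add
    ((contMDiff_comp_latitude h hB).smul contMDiff_const)).add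
    ((contMDiff_comp_latitude h hC).smul (hL.contMDiff.comp (contMDiff_coeSphere n)))

theorem ambientForm_symm (A B C : ℝ) (z ξ η : EuclideanSpace ℝ (Fin (n + 1))) :
    ambientForm h A B C z ξ η = ambientForm h A B C z η ξ := by
  rw [ambientForm_apply, ambientForm_apply, real_inner_comm, real_inner_comm (projQ h η)]
  ring

theorem inner_proj_add (x y : EuclideanSpace ℝ (Fin (n + 1))) :
    inner ℝ (projP h x) (projP h y) + inner ℝ (projQ h x) (projQ h y) = inner ℝ x y := by
  have h1 := norm_proj_sq h (x + y)
  have h2 := norm_proj_sq h x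
  have h3 := norm_proj_sq h y
  rw [map_add, map_add, norm_add_sq_real, norm_add_sq_real, norm_add_sq_real] at h1
  linarith

/-- The coefficient C may be negative. Let s be the latitude, X and Y the squared norms of the
components of v, and m the value of x·dx on v. Tangency makes m, up to sign, also the value of y·dy,
so Cauchy–Schwarz gives m² ≤ (1 - s)X and m² ≤ sY. Therefore s(1 - s) times the form is at least
cm². If m = 0 the C-term is absent and A, B > 0 suffice. -/
theorem ambientForm_pos {A B C c : ℝ} (x : S n) {v : EuclideanSpace ℝ (Fin (n + 1))}
    (hv : inner ℝ (x : EuclideanSpace ℝ (Fin (n + 1))) v = 0) (hv0 : v ≠ 0) (hA : 0 < A)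
    (hB : 0 < B) (hc : 0 < c) (hC : A * latitude h x + B * (1 - latitude h x)
      + C * (latitude h x * (1 - latitude h x)) = c) : 0 < ambientForm h A B C x v v := by
  have hx := inner_proj_add h (x : EuclideanSpace ℝ (Fin (n + 1))) v
  rw [hv] at hx
  rw [ambientForm_apply, real_inner_self_eq_norm_sq, real_inner_self_eq_norm_sq]
  have hP := norm_projP_sq h x
  have hS : ‖projQ h (x : EuclideanSpace ℝ (Fin (n + 1)))‖ ^ 2 = latitude h x := rfl
  have h1 : (inner ℝ (projP h (x : EuclideanSpace ℝ (Fin (n + 1)))) (projP h v)) ^ 2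
      ≤ (1 - latitude h x) * ‖projP h v‖ ^ 2 := by
    rw [← hP, ← mul_pow]
    exact sq_le_sq.2 ((abs_real_inner_le_norm _ _).trans (le_abs_self _))
  have h2 : (inner ℝ (projP h (x : EuclideanSpace ℝ (Fin (n + 1)))) (projP h v)) ^ 2
      ≤ latitude h x * ‖projQ h v‖ ^ 2 := by
    rw [← hS, ← mul_pow, show inner ℝ (projP h (x : EuclideanSpace ℝ (Fin (n + 1)))) (projP h v)
      = -inner ℝ (projQ h (x : EuclideanSpace ℝ (Fin (n + 1)))) (projQ h v) by linarith, neg_sq]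
    exact sq_le_sq.2 ((abs_real_inner_le_norm _ _).trans (le_abs_self _))
  have hn : 0 < ‖projP h v‖ ^ 2 + ‖projQ h v‖ ^ 2 := by
    rw [norm_proj_sq]
    positivity
  obtain ⟨hS0, hS1⟩ := latitude_mem_Icc h x
  generalize inner ℝ (projP h (x : EuclideanSpace ℝ (Fin (n + 1)))) (projP h v) = m at *
  generalize latitude h x = s at *
  have hP0 := sq_nonneg ‖projP h v‖
  have hQ0 := sq_nonneg ‖projQ h v‖
  generalize ‖projP h v‖ ^ 2 = X at *
  generalize ‖projQ h v‖ ^ 2 = Y at *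
  rcases eq_or_ne m 0 with rfl | hm
  · simp only [mul_zero, add_zero]
    rcases hP0.eq_or_lt with hX | hX
    · have : 0 < Y := by linarith
      have := mul_pos hB this
      rw [← hX]
      linarith
    · have := mul_pos hA hX
      nlinarith
  · have hm2 : 0 < m ^ 2 := by positivity
    have hs0 : 0 < s := by
      rcases hS0.eq_or_lt with h0 | h0
      · rw [← h0] at h2
        linarith
      · exact h0
    have hs1 : 0 < 1 - s := by
      rcases (sub_nonneg.2 hS1).eq_or_lt with h0 | h0
      · rw [← h0] at h1
        linarith
      · exact h0
    have hk : 0 < s * (1 - s) * (A * X + B * Y + C * (m * m)) := by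
      have e1 := mul_le_mul_of_nonneg_left h1 (mul_pos hA hs0).le
      have e2 := mul_le_mul_of_nonneg_left h2 (mul_pos hB hs1).le
      have e3 : c * m ^ 2 > 0 := by positivity
      rw [← hC] at e3
      nlinarith
    exact pos_of_mul_pos_right hk (mul_pos hs0 hs1).le

theorem exists_riem_ambientForm {A B C : ℝ → ℝ} {c : ℝ} (hA : ContDiffOn ℝ ∞ A (Icc 0 1))
    (hB : ContDiffOn ℝ ∞ B (Icc 0 1)) (hC : ContDiffOn ℝ ∞ C (Icc 0 1)) (hc : 0 < c)
    (hpos : ∀ s ∈ Icc (0 : ℝ) 1, 0 < A s ∧ 0 < B s ∧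
      A s * s + B s * (1 - s) + C s * (s * (1 - s)) = c) :
    ∃ g : Riem n (S n), ∀ x ξ η, g.inner x ξ η
      = ambientForm h (A (latitude h x)) (B (latitude h x)) (C (latitude h x)) x
          (dIncl n x ξ) (dIncl n x η) :=
  ⟨inducedMetric _ (contMDiff_ambientForm h hA hB hC) (fun _ => ambientForm_symm h _ _ _ _)
    fun x _ hv hv0 =>
      have H := hpos _ (latitude_mem_Icc h x)
      ambientForm_pos h x hv hv0 H.1 H.2.1 hc H.2.2, fun _ _ _ => rfl⟩

end Latitude

/-! ### Normal form and uniqueness of doubly warped metrics -/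

section NormalForm

variable {n p q : ℕ} (h : p + q + 1 = n)

theorem latitude_warpMap (b : ℝ) (z : ℝ × S p × S q) :
    latitude h (warpMap h b z) = Real.sin (Real.pi * z.1 / (2 * b)) ^ 2 := by
  rw [latitude, coe_warpMap, warpJoin, projQ_join, norm_smul, norm_eq_of_mem_sphere, mul_one,
    Real.norm_eq_abs, sq_abs]

theorem radial_sin_sq {a : ℝ} (ha : a ∈ Icc 0 (Real.pi / 2)) :
    radial (Real.sin a ^ 2) = 2 / Real.pi * a := by
  rw [radial, Real.sqrt_sq (Real.sin_nonneg_of_nonneg_of_le_pi ha.1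
    (ha.2.trans (by linarith [Real.pi_pos]))), Real.arcsin_sin (by linarith [ha.1, Real.pi_pos]) ha.2]

theorem angle_mem_Icc {b t : ℝ} (hb : 0 < b) (ht : t ∈ Icc 0 b) :
    Real.pi * t / (2 * b) ∈ Icc 0 (Real.pi / 2) := by
  have := Real.pi_pos
  refine ⟨by have := ht.1; positivity, ?_⟩
  rw [div_le_div_iff₀ (by positivity) two_pos]
  nlinarith [ht.2]

theorem angle_mem_Ioo {b t : ℝ} (hb : 0 < b) (ht : t ∈ Ioo 0 b) :
    Real.pi * t / (2 * b) ∈ Ioo 0 (Real.pi / 2) := by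
  have := Real.pi_pos
  refine ⟨by have := ht.1; positivity, ?_⟩
  rw [div_lt_div_iff₀ (by positivity) two_pos]
  nlinarith [ht.2]

theorem radial_latitude_warpMap {b : ℝ} (hb : 0 < b) {z : ℝ × S p × S q} (hz : z.1 ∈ Icc 0 b) :
    b * radial (latitude h (warpMap h b z)) = z.1 := by
  have := Real.pi_pos
  rw [latitude_warpMap, radial_sin_sq (angle_mem_Icc hb hz)]
  field_simp

theorem exists_eq_norm_smul {m : ℕ} (v : EuclideanSpace ℝ (Fin (m + 1))) :
    ∃ φ : S m, ‖v‖ • (φ : EuclideanSpace ℝ (Fin (m + 1))) = v := by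
  rcases eq_or_ne v 0 with rfl | hv
  · exact ⟨⟨EuclideanSpace.single 0 1, by simp⟩, by simp⟩
  · have hn : ‖v‖ ≠ 0 := norm_ne_zero_iff.2 hv
    refine ⟨⟨‖v‖⁻¹ • v, ?_⟩, ?_⟩
    · rw [mem_sphere_zero_iff_norm, norm_smul, norm_inv, norm_norm, inv_mul_cancel₀ hn]
    · simp [smul_smul, hn]

theorem exists_warpMap_eq {b : ℝ} (hb : 0 < b) (x : S n) :
    ∃ φ θ, warpMap h b (b * radial (latitude h x), φ, θ) = x := by
  obtain ⟨φ, hφ⟩ := exists_eq_norm_smul (projP h (x : EuclideanSpace ℝ (Fin (n + 1))))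
  obtain ⟨θ, hθ⟩ := exists_eq_norm_smul (projQ h (x : EuclideanSpace ℝ (Fin (n + 1))))
  refine ⟨φ, θ, Subtype.ext ?_⟩
  have hπ := Real.pi_pos
  have ha : Real.pi * (b * radial (latitude h x)) / (2 * b)
      = Real.arcsin ‖projQ h (x : EuclideanSpace ℝ (Fin (n + 1)))‖ := by
    rw [radial, latitude, Real.sqrt_sq (norm_nonneg _)]
    field_simp
  have hQ : ‖projQ h (x : EuclideanSpace ℝ (Fin (n + 1)))‖ ≤ 1 := by
    have := (latitude_mem_Icc h x).2
    exact (sq_le_one_iff₀ (norm_nonneg _)).1 this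
  rw [coe_warpMap, warpJoin]
  simp only [ha]
  rw [Real.sin_arcsin (by linarith [norm_nonneg (projQ h (x : EuclideanSpace ℝ (Fin (n + 1))))]) hQ,
    Real.cos_arcsin]
  have hP := norm_projP_sq h x
  rw [latitude] at hP
  rw [← hP, Real.sqrt_sq (norm_nonneg _), hφ, hθ, join_proj]

theorem warpForm_identity {b : ℝ} (hb : 0 < b) {A B C f k : ℝ} {z : ℝ × S p × S q}
    (hsum : A * latitude h (warpMap h b z) + B * (1 - latitude h (warpMap h b z))
      + C * (latitude h (warpMap h b z) * (1 - latitude h (warpMap h b z))) = (2 * b / Real.pi) ^ 2)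
    (hA : A * (1 - latitude h (warpMap h b z)) = f ^ 2)
    (hB : B * latitude h (warpMap h b z) = k ^ 2)
    (ξ η : TangentSpace (𝓘(ℝ, ℝ).prod ((𝓡 p).prod (𝓡 q))) z) :
    ambientForm h A B C (warpMap h b z)
        (dIncl n (warpMap h b z)
          (mfderiv (𝓘(ℝ, ℝ).prod ((𝓡 p).prod (𝓡 q))) (𝓡 n) (warpMap h b) z ξ))
        (dIncl n (warpMap h b z)
          (mfderiv (𝓘(ℝ, ℝ).prod ((𝓡 p).prod (𝓡 q))) (𝓡 n) (warpMap h b) z η))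
      = ξ.1 * η.1 + f ^ 2 * (roundMetric p).inner z.2.1 ξ.2.1 η.2.1
          + k ^ 2 * (roundMetric q).inner z.2.2 ξ.2.2 η.2.2 := by
  have hπ := Real.pi_pos
  rw [dIncl_mfderiv_warpMap, dIncl_mfderiv_warpMap, coe_warpMap]
  have h1 := ambientForm_warpJoin h (A := A) (B := B) (C := C) (b := b) (z := prodIncl p q z)
    (ξ := (ξ.1, dIncl p z.2.1 ξ.2.1, dIncl q z.2.2 ξ.2.2))
    (η := (η.1, dIncl p z.2.1 η.2.1, dIncl q z.2.2 η.2.2))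
    (norm_eq_of_mem_sphere z.2.1) (norm_eq_of_mem_sphere z.2.2)
    (inner_dIncl p _ _) (inner_dIncl p _ _) (inner_dIncl q _ _) (inner_dIncl q _ _)
  refine h1.trans ?_
  rw [latitude_warpMap] at hsum hA hB
  change _ = _ + f ^ 2 * inner ℝ (dIncl p z.2.1 ξ.2.1) (dIncl p z.2.1 η.2.1)
    + k ^ 2 * inner ℝ (dIncl q z.2.2 ξ.2.2) (dIncl q z.2.2 η.2.2)
  have hc : Real.cos (Real.pi * z.1 / (2 * b)) ^ 2 = 1 - Real.sin (Real.pi * z.1 / (2 * b)) ^ 2 := by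
    rw [Real.cos_sq']
  change (Real.pi / (2 * b)) ^ 2 * (ξ.1 * η.1) * (A * Real.sin (Real.pi * z.1 / (2 * b)) ^ 2
          + B * Real.cos (Real.pi * z.1 / (2 * b)) ^ 2
          + C * (Real.sin (Real.pi * z.1 / (2 * b)) ^ 2 * Real.cos (Real.pi * z.1 / (2 * b)) ^ 2))
        + A * Real.cos (Real.pi * z.1 / (2 * b)) ^ 2 * inner ℝ _ _
        + B * Real.sin (Real.pi * z.1 / (2 * b)) ^ 2 * inner ℝ _ _ = _
  rw [hc, hsum, hA, hB]
  congr 2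
  field_simp

theorem isDoublyWarped_of_ambientForm {b : ℝ} (hb : 0 < b) {A B C f k : ℝ → ℝ} {g : Riem n (S n)}
    (hg : ∀ x ξ η, g.inner x ξ η
      = ambientForm h (A (latitude h x)) (B (latitude h x)) (C (latitude h x)) x
          (dIncl n x ξ) (dIncl n x η))
    (hABC : ∀ s ∈ Icc (0 : ℝ) 1, A s * s + B s * (1 - s) + C s * (s * (1 - s))
      = (2 * b / Real.pi) ^ 2 ∧ A s * (1 - s) = f (b * radial s) ^ 2 ∧
        B s * s = k (b * radial s) ^ 2) :
    IsDoublyWarped h b f k g := by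
  intro t ht φ θ ξ η
  obtain ⟨h1, h2, h3⟩ := hABC _ (latitude_mem_Icc h (warpMap h b (t, φ, θ)))
  rw [radial_latitude_warpMap h hb (Ioo_subset_Icc_self ht)] at h2 h3
  rw [hg]
  exact warpForm_identity h hb h1 h2 h3 ξ η

/-- By dimension it is enough to prove injectivity, and a kernel vector has length zero for any form
pulled back along the map. -/
theorem mfderiv_warpMap_surjective {b : ℝ} (hb : 0 < b) {z : ℝ × S p × S q} (hz : z.1 ∈ Ioo 0 b) :
    Function.Surjective (mfderiv (𝓘(ℝ, ℝ).prod ((𝓡 p).prod (𝓡 q))) (𝓡 n) (warpMap h b) z) := by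
  let L : (ℝ × EuclideanSpace ℝ (Fin p) × EuclideanSpace ℝ (Fin q)) →L[ℝ]
    EuclideanSpace ℝ (Fin n) :=
      mfderiv (𝓘(ℝ, ℝ).prod ((𝓡 p).prod (𝓡 q))) (𝓡 n) (warpMap h b) z
  change Function.Surjective L.toLinearMap
  rw [← LinearMap.injective_iff_surjective_of_finrank_eq_finrank (by simp; omega)]
  rw [injective_iff_map_eq_zero]
  intro ξ hξ
  have ha := angle_mem_Ioo hb hz
  have hs : 0 < Real.sin (Real.pi * z.1 / (2 * b)) ^ 2 :=
    pow_pos (Real.sin_pos_of_pos_of_lt_pi ha.1 (by linarith [ha.2, Real.pi_pos])) 2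
  have hc : 0 < Real.cos (Real.pi * z.1 / (2 * b)) ^ 2 :=
    pow_pos (Real.cos_pos_of_mem_Ioo ⟨by linarith [ha.1, Real.pi_pos], ha.2⟩) 2
  have hsc := Real.sin_sq_add_cos_sq (Real.pi * z.1 / (2 * b))
  have hl := latitude_warpMap h b z
  set s := latitude h (warpMap h b z)
  have hs0 : 0 < s := by rw [hl]; exact hs
  have hs1 : 0 < 1 - s := by rw [hl]; linarith
  -- These coefficients solve the three equations with both warping functions equal to 1, so the
  -- pullback is the product metric dt² + ds_p² + ds_q², which is positive definite.
  have h1 := warpForm_identity h hb (A := 1 / (1 - s)) (B := 1 / s)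
    (C := ((2 * b / Real.pi) ^ 2 - 1 / (1 - s) * s - 1 / s * (1 - s)) / (s * (1 - s))) (f := 1)
    (k := 1) (by field_simp; ring) (by field_simp; ring) (by field_simp; ring) ξ ξ
  have h0 : mfderiv (𝓘(ℝ, ℝ).prod ((𝓡 p).prod (𝓡 q))) (𝓡 n) (warpMap h b) z ξ = 0 := hξ
  rw [h0, map_zero, map_zero] at h1
  have h2 : (roundMetric p).inner z.2.1 ξ.2.1 ξ.2.1 = ‖dIncl p z.2.1 ξ.2.1‖ ^ 2 :=
    real_inner_self_eq_norm_sq (dIncl p z.2.1 ξ.2.1)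
  have h3 : (roundMetric q).inner z.2.2 ξ.2.2 ξ.2.2 = ‖dIncl q z.2.2 ξ.2.2‖ ^ 2 :=
    real_inner_self_eq_norm_sq (dIncl q z.2.2 ξ.2.2)
  rw [h2, h3] at h1
  have e1 : (0 : ℝ) = ξ.1 * ξ.1 + 1 ^ 2 * ‖dIncl p z.2.1 ξ.2.1‖ ^ 2
    + 1 ^ 2 * ‖dIncl q z.2.2 ξ.2.2‖ ^ 2 := h1
  have n1 := mul_self_nonneg ξ.1
  have n2 := sq_nonneg ‖dIncl p z.2.1 ξ.2.1‖
  have n3 := sq_nonneg ‖dIncl q z.2.2 ξ.2.2‖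
  have k1 : ξ.1 = 0 := mul_self_eq_zero.1 (by linarith)
  have k2 : dIncl p z.2.1 ξ.2.1 = 0 := norm_eq_zero.1 (pow_eq_zero_iff two_ne_zero |>.1 (by linarith))
  have k3 : dIncl q z.2.2 ξ.2.2 = 0 := norm_eq_zero.1 (pow_eq_zero_iff two_ne_zero |>.1 (by linarith))
  have k4 : ξ.2.1 = 0 := dIncl_injective p _ (k2.trans (map_zero _).symm)
  have k5 : ξ.2.2 = 0 := dIncl_injective q _ (k3.trans (map_zero _).symm)
  exact Prod.ext k1 (Prod.ext k4 k5)

/-- The normal form of a doubly warped product metric at the regular points of `Sⁿ`. -/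
theorem IsDoublyWarped.inner_eq {b : ℝ} (hb : 0 < b) {f k : ℝ → ℝ} {g : Riem n (S n)}
    (hg : IsDoublyWarped h b f k g) {x : S n} (hx : latitude h x ∈ Ioo 0 1)
    (ξ η : TangentSpace (𝓡 n) x) :
    g.inner x ξ η = ambientForm h (f (b * radial (latitude h x)) ^ 2 / (1 - latitude h x))
      (k (b * radial (latitude h x)) ^ 2 / latitude h x)
      (((2 * b / Real.pi) ^ 2
        - f (b * radial (latitude h x)) ^ 2 / (1 - latitude h x) * latitude h x
        - k (b * radial (latitude h x)) ^ 2 / latitude h x * (1 - latitude h x))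
          / (latitude h x * (1 - latitude h x))) x (dIncl n x ξ) (dIncl n x η) := by
  obtain ⟨φ, θ, hx'⟩ := exists_warpMap_eq h hb x
  have ht : b * radial (latitude h x) ∈ Ioo 0 b := by
    have := radial_mem_Ioo hx
    exact ⟨mul_pos hb this.1, by nlinarith [this.2]⟩
  have hs0 := hx.1
  have hs1 := sub_pos.2 hx.2
  generalize hT : b * radial (latitude h x) = t at *
  subst hx'
  obtain ⟨ξ, rfl⟩ := mfderiv_warpMap_surjective h hb (z := (t, φ, θ)) ht ξ
  obtain ⟨η, rfl⟩ := mfderiv_warpMap_surjective h hb (z := (t, φ, θ)) ht η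
  refine (hg t ht φ θ ξ η).trans (Eq.symm ?_)
  exact warpForm_identity h hb (by field_simp; ring) (by field_simp) (by field_simp) ξ η

/-- Every point lies on a curve t ↦ `warpMap h 1 (t, φ, θ)` with t in the closed interval, and the
interior times are regular. -/
theorem dense_latitude : Dense {x : S n | latitude h x ∈ Ioo (0 : ℝ) 1} := by
  intro x
  obtain ⟨φ, θ, hx⟩ := exists_warpMap_eq h one_pos x
  have hr := radial_mem_Icc (latitude h x)
  rw [one_mul] at hx
  have hcont : Continuous fun t : ℝ => warpMap h 1 (t, φ, θ) :=
    (contMDiff_warpMap h 1).continuous.comp (by fun_prop)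
  have h1 : radial (latitude h x) ∈ closure (Ioo (0 : ℝ) 1) := by
    rw [closure_Ioo zero_ne_one]
    exact hr
  have h2 := map_mem_closure hcont h1 (t := {x : S n | latitude h x ∈ Ioo (0 : ℝ) 1}) ?_
  · rwa [hx] at h2
  · intro t ht
    rw [mem_ofPred_eq, latitude_warpMap]
    have ha := angle_mem_Ioo one_pos ht
    have hs : 0 < Real.sin (Real.pi * t / (2 * 1)) :=
      Real.sin_pos_of_pos_of_lt_pi ha.1 (by linarith [ha.2, Real.pi_pos])
    have hc : 0 < Real.cos (Real.pi * t / (2 * 1)) :=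
      Real.cos_pos_of_mem_Ioo ⟨by linarith [ha.1, Real.pi_pos], ha.2⟩
    have hsc := Real.sin_sq_add_cos_sq (Real.pi * t / (2 * 1))
    exact ⟨pow_pos hs 2, by nlinarith⟩

/-- A linear relation between `b²`, `u²` and `v²` gives a linear relation between doubly warped
product metrics. -/
theorem sum_coordMetric_eq_zero {ι : Type*} [Fintype ι] (a b : ι → ℝ) (hb : ∀ i, 0 < b i)
    (f k : ι → ℝ → ℝ) (g : ι → Riem n (S n)) (hg : ∀ i, IsDoublyWarped h (b i) (f i) (k i) (g i))
    (h0 : ∑ i, a i * b i ^ 2 = 0)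
    (h1 : ∀ r ∈ Ioo (0 : ℝ) 1, ∑ i, a i * f i (b i * r) ^ 2 = 0)
    (h2 : ∀ r ∈ Ioo (0 : ℝ) 1, ∑ i, a i * k i (b i * r) ^ 2 = 0) (c : S n)
    {y : EuclideanSpace ℝ (Fin n)} (hy : y ∈ (extChartAt (𝓡 n) c).target) :
    ∑ i, a i • coordMetric (g i) c y = 0 := by
  refine sum_coordMetric_eq_zero_of_dense a g (dense_latitude h) (fun x hx ξ η => ?_) c hy
  have hr := radial_mem_Ioo hx
  have hs0 : latitude h x ≠ 0 := hx.1.ne'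
  have hs1 : 1 - latitude h x ≠ 0 := (sub_pos.2 hx.2).ne'
  specialize h1 _ hr
  specialize h2 _ hr
  -- The normal form is linear in b², f² and k²: the remaining factors depend on x, ξ and η only,
  -- not on i.
  have key : ∀ i, a i * (g i).inner x ξ η
      = a i * b i ^ 2 * ((2 / Real.pi) ^ 2 / (latitude h x * (1 - latitude h x))
          * (inner ℝ (projP h (x : EuclideanSpace ℝ (Fin (n + 1)))) (projP h (dIncl n x ξ))
            * inner ℝ (projP h (x : EuclideanSpace ℝ (Fin (n + 1)))) (projP h (dIncl n x η))))
        + a i * f i (b i * radial (latitude h x)) ^ 2 *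
          (1 / (1 - latitude h x) * inner ℝ (projP h (dIncl n x ξ)) (projP h (dIncl n x η))
            - 1 / (1 - latitude h x) ^ 2
              * (inner ℝ (projP h (x : EuclideanSpace ℝ (Fin (n + 1)))) (projP h (dIncl n x ξ))
            * inner ℝ (projP h (x : EuclideanSpace ℝ (Fin (n + 1)))) (projP h (dIncl n x η))))
        + a i * k i (b i * radial (latitude h x)) ^ 2 *
          (1 / latitude h x * inner ℝ (projQ h (dIncl n x ξ)) (projQ h (dIncl n x η))
            - 1 / latitude h x ^ 2
              * (inner ℝ (projP h (x : EuclideanSpace ℝ (Fin (n + 1)))) (projP h (dIncl n x ξ))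
            * inner ℝ (projP h (x : EuclideanSpace ℝ (Fin (n + 1)))) (projP h (dIncl n x η)))) := by
    intro i
    rw [(hg i).inner_eq h (hb i) hx, ambientForm_apply]
    generalize inner ℝ (projP h (x : EuclideanSpace ℝ (Fin (n + 1)))) (projP h (dIncl n x ξ)) = X₁
    generalize inner ℝ (projP h (x : EuclideanSpace ℝ (Fin (n + 1)))) (projP h (dIncl n x η)) = X₂
    generalize inner ℝ (projP h (dIncl n x ξ)) (projP h (dIncl n x η)) = X₃
    generalize inner ℝ (projQ h (dIncl n x ξ)) (projQ h (dIncl n x η)) = X₄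
    generalize latitude h x = s at *
    field_simp
    ring
  simp_rw [key, Finset.sum_add_distrib, ← Finset.sum_mul]
  rw [h0, h1, h2]
  ring

theorem IsDoublyWarped.unique {b : ℝ} (hb : 0 < b) {f k : ℝ → ℝ} {g g' : Riem n (S n)}
    (hg : IsDoublyWarped h b f k g) (hg' : IsDoublyWarped h b f k g') : g = g' := by
  refine eq_of_coordMetric_eq fun c y hy => ?_
  have := sum_coordMetric_eq_zero h ![1, -1] ![b, b] (by simp [hb]) ![f, f] ![k, k] ![g, g']
    (by simp [hg, hg']) (by simp) (by simp) (by simp) c hy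
  simpa [add_neg_eq_zero] using this

theorem IsDoublyWarped.congr {b : ℝ} {f k f' k' : ℝ → ℝ} {g : Riem n (S n)}
    (hg : IsDoublyWarped h b f k g) (hf : ∀ t ∈ Ioo 0 b, f' t = f t)
    (hk : ∀ t ∈ Ioo 0 b, k' t = k t) : IsDoublyWarped h b f' k' g := by
  intro t ht φ θ ξ η
  rw [hf t ht, hk t ht]
  exact hg t ht φ θ ξ η

theorem IsNormalizedPair.exists_riem {b : ℝ} (hb : 0 < b) {f k : ℝ → ℝ}
    (hfk : IsNormalizedPair b (fun r => f (b * r)) fun r => k (b * r)) :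
    ∃ g : Riem n (S n), IsDoublyWarped h b f k g := by
  obtain ⟨A, B, C, hA, hB, hC, hABC⟩ := hfk.exists_coefficients hb
  have hπ := Real.pi_pos
  obtain ⟨g, hg⟩ := exists_riem_ambientForm h (c := (2 * b / Real.pi) ^ 2) hA hB hC (by positivity)
    fun s hs => ⟨(hABC s hs).1, (hABC s hs).2.1, (hABC s hs).2.2.1⟩
  exact ⟨g, isDoublyWarped_of_ambientForm h hb hg fun s hs => (hABC s hs).2.2⟩

end NormalForm

/-! ### Rescaled warping functions and their convexity -/

section Profiles

open scoped Pointwise in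
theorem iteratedDerivWithin_comp_mul_Icc {c : ℝ} (hc : 0 < c) (f : ℝ → ℝ) (j : ℕ) (x : ℝ) :
    iteratedDerivWithin j (fun r => f (c * r)) (Icc 0 1) x
      = c ^ j * iteratedDerivWithin j f (Icc 0 c) (c * x) := by
  have hs : c • Icc (0 : ℝ) 1 = Icc 0 c := by
    rw [LinearOrderedField.smul_Icc hc]
    simp
  induction j generalizing x with
  | zero => simp
  | succ j ih =>
    have h1 : iteratedDerivWithin j (fun r => f (c * r)) (Icc 0 1)
        = fun x => c ^ j * (fun y => iteratedDerivWithin j f (Icc 0 c) y) (c * x) := funext ih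
    rw [iteratedDerivWithin_succ, h1, derivWithin_const_mul_field, iteratedDerivWithin_succ,
      derivWithin_comp_mul_left, hs, pow_succ]
    simp only [smul_eq_mul]
    ring

open scoped Pointwise in
theorem iteratedDerivWithin_comp_sub_Icc (c : ℝ) (f : ℝ → ℝ) (j : ℕ) (x : ℝ) :
    iteratedDerivWithin j (fun r => f (c - r)) (Icc 0 c) x
      = (-1) ^ j * iteratedDerivWithin j f (Icc 0 c) (c - x) := by
  rw [iteratedDerivWithin_comp_const_sub]
  have hs : c +ᵥ -Icc (0 : ℝ) c = Icc 0 c := by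
    ext y
    simp only [Set.mem_vadd_set_iff_neg_vadd_mem, Set.mem_neg, mem_Icc, vadd_eq_add]
    constructor <;> rintro ⟨h1, h2⟩ <;> constructor <;> linarith
  simp only [hs, smul_eq_mul]

/-- The functions on `[0, 1]` that arise from functions in `V(0, b)` by rescaling the argument. -/
structure IsProfile (b : ℝ) (f : ℝ → ℝ) : Prop where
  smooth : ContDiffOn ℝ ∞ f (Icc 0 1)
  pos : ∀ r ∈ Ioo (0 : ℝ) 1, 0 < f r
  pos_right : 0 < f 1
  odd_right : ∀ j : ℕ, Odd j → iteratedDerivWithin j f (Icc 0 1) 1 = 0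
  deriv_left : iteratedDerivWithin 1 f (Icc 0 1) 0 = b
  even_left : ∀ j : ℕ, Even j → iteratedDerivWithin j f (Icc 0 1) 0 = 0
  concave : ∀ r ∈ Icc (0 : ℝ) 1, iteratedDerivWithin 2 f (Icc 0 1) r ≤ 0
  strict : ∀ᶠ r in 𝓝[>] 0, iteratedDerivWithin 2 f (Icc 0 1) r < 0
  third : iteratedDerivWithin 3 f (Icc 0 1) 0 < 0

theorem tendsto_mul_nhdsGT_zero {c : ℝ} (hc : 0 < c) :
    Tendsto (fun r : ℝ => c * r) (𝓝[>] 0) (𝓝[>] 0) := by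
  refine tendsto_nhdsWithin_iff.2 ⟨?_, ?_⟩
  · have : Tendsto (fun r : ℝ => c * r) (𝓝 0) (𝓝 (c * 0)) := (continuous_const_mul c).tendsto 0
    rw [mul_zero] at this
    exact this.mono_left nhdsWithin_le_nhds
  · filter_upwards [self_mem_nhdsWithin] with r hr
    exact mul_pos hc hr

theorem memV_iff_isProfile {b : ℝ} (hb : 0 < b) {v : ℝ → ℝ} :
    MemV b v ↔ IsProfile b (fun r => v (b * r)) := by
  have key := iteratedDerivWithin_comp_mul_Icc hb v
  have hpow : ∀ j : ℕ, 0 < b ^ j := fun j => pow_pos hb j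
  have hmap : MapsTo (fun r : ℝ => b * r) (Icc 0 1) (Icc 0 b) := fun r hr =>
    ⟨mul_nonneg hb.le hr.1, by nlinarith [hr.2]⟩
  have hmap' : ∀ t ∈ Icc 0 b, b⁻¹ * t ∈ Icc (0 : ℝ) 1 := fun t ht =>
    ⟨mul_nonneg (inv_pos.2 hb).le ht.1, by rw [inv_mul_le_iff₀ hb, mul_one]; exact ht.2⟩
  have hinv : ∀ t : ℝ, b * (b⁻¹ * t) = t := fun t => by field_simp
  constructor
  · intro hv
    refine ⟨hv.smooth.comp (contDiff_const.mul contDiff_id).contDiffOn hmap, fun r hr => ?_, ?_,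
      fun j hj => ?_, ?_, fun j hj => ?_, fun r hr => ?_, ?_, ?_⟩
    · exact hv.pos _ ⟨mul_pos hb hr.1, by nlinarith [hr.2]⟩
    · simpa using hv.pos_right
    · rw [key, mul_one, hv.odd_right j hj, mul_zero]
    · rw [key, mul_zero, iteratedDerivWithin_one, hv.deriv_left]
      simp
    · rw [key, mul_zero, hv.even_left j hj, mul_zero]
    · rw [key]
      exact mul_nonpos_of_nonneg_of_nonpos (hpow 2).le (hv.concave _ (hmap hr))
    · filter_upwards [(tendsto_mul_nhdsGT_zero hb).eventually hv.strict] with r hr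
      rw [key]
      exact mul_neg_of_pos_of_neg (hpow 2) hr
    · rw [key, mul_zero]
      exact mul_neg_of_pos_of_neg (hpow 3) hv.third
  · intro hf
    refine ⟨?_, fun t ht => ?_, ?_, fun j hj => ?_, ?_, fun j hj => ?_, fun t ht => ?_, ?_, ?_⟩
    · have := hf.smooth.comp (t := Icc (0 : ℝ) 1) (s := Icc 0 b)
        (contDiff_const.mul contDiff_id : ContDiff ℝ ∞ fun t : ℝ => b⁻¹ * t).contDiffOn hmap'
      exact this.congr fun t _ => by simp [hinv]
    · have := hf.pos (b⁻¹ * t) ⟨mul_pos (inv_pos.2 hb) ht.1, by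
        rw [inv_mul_lt_iff₀ hb, mul_one]; exact ht.2⟩
      simpa [hinv] using this
    · simpa using hf.pos_right
    · have := hf.odd_right j hj
      rw [key, mul_one] at this
      exact (mul_eq_zero.1 this).resolve_left (hpow j).ne'
    · have := hf.deriv_left
      rw [key, mul_zero, iteratedDerivWithin_one, pow_one] at this
      exact mul_left_cancel₀ hb.ne' (this.trans (mul_one b).symm)
    · have := hf.even_left j hj
      rw [key, mul_zero] at this
      exact (mul_eq_zero.1 this).resolve_left (hpow j).ne'
    · have := hf.concave _ (hmap' t ht)
      rw [key, hinv] at this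
      exact nonpos_of_mul_nonpos_right this (hpow 2)
    · filter_upwards [(tendsto_mul_nhdsGT_zero (inv_pos.2 hb)).eventually hf.strict] with t ht
      rw [key, hinv] at ht
      exact (pos_iff_neg_of_mul_neg ht).1 (hpow 2)
    · have := hf.third
      rw [key, mul_zero] at this
      exact (pos_iff_neg_of_mul_neg this).1 (hpow 3)

theorem tendsto_const_sub_nhdsGT (b : ℝ) : Tendsto (fun t : ℝ => b - t) (𝓝[>] 0) (𝓝[<] b) := by
  refine tendsto_nhdsWithin_iff.2 ⟨?_, ?_⟩
  · have : Tendsto (fun r : ℝ => b - r) (𝓝 0) (𝓝 (b - 0)) := (continuous_const.sub continuous_id).tendsto 0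
    rw [sub_zero] at this
    exact this.mono_left nhdsWithin_le_nhds
  · filter_upwards [self_mem_nhdsWithin] with r hr
    exact sub_lt_self b hr

theorem tendsto_const_sub_nhdsLT (b : ℝ) : Tendsto (fun t : ℝ => b - t) (𝓝[<] b) (𝓝[>] 0) := by
  refine tendsto_nhdsWithin_iff.2 ⟨?_, ?_⟩
  · have : Tendsto (fun r : ℝ => b - r) (𝓝 b) (𝓝 (b - b)) := (continuous_const.sub continuous_id).tendsto b
    rw [sub_self] at this
    exact this.mono_left nhdsWithin_le_nhds
  · filter_upwards [self_mem_nhdsWithin] with r hr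
    exact sub_pos.2 (mem_Iio.1 hr)

/-- Reflection flips the sign of odd derivatives only, which accounts for the signs of the slope and
of the third derivative. Analysis of warping functions is thereby needed for V alone. -/
theorem memU_iff_memV {b : ℝ} {u : ℝ → ℝ} : MemU b u ↔ MemV b (fun t => u (b - t)) := by
  have key := iteratedDerivWithin_comp_sub_Icc b u
  have key1 : ∀ x, derivWithin (fun t => u (b - t)) (Icc 0 b) x = -derivWithin u (Icc 0 b) (b - x) := by
    intro x
    have := key 1 x
    simpa [iteratedDerivWithin_one] using this
  have hmap : ∀ t, b - t ∈ Icc 0 b ↔ t ∈ Icc 0 b := fun t => by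
    rw [mem_Icc, mem_Icc]
    constructor <;> rintro ⟨h1, h2⟩ <;> constructor <;> linarith
  have hmap' : ∀ t, t ∈ Ioo 0 b → b - t ∈ Ioo 0 b := fun t ht =>
    ⟨sub_pos.2 ht.2, sub_lt_self b ht.1⟩
  have hsub : ContDiff ℝ ∞ fun t : ℝ => b - t := contDiff_const.sub contDiff_id
  constructor
  · intro hu
    refine ⟨hu.smooth.comp hsub.contDiffOn fun t ht => (hmap t).2 ht, fun t ht => hu.pos _ (hmap' t ht),
      by simpa using hu.pos_left, fun j hj => ?_, ?_, fun j hj => ?_, fun t ht => ?_, ?_, ?_⟩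
    · rw [key, sub_self, hu.odd_left j hj, mul_zero]
    · rw [key1, sub_zero, hu.deriv_right, neg_neg]
    · rw [key, sub_zero, hu.even_right j hj, mul_zero]
    · rw [key]
      have := hu.concave _ ((hmap t).2 ht)
      simpa using this
    · filter_upwards [(tendsto_const_sub_nhdsGT b).eventually hu.strict] with t ht
      rw [key]
      simpa using ht
    · rw [key, sub_zero]
      have := hu.third
      simp only [Odd.neg_one_pow (show Odd 3 by decide)]
      linarith
  · intro hv
    refine ⟨?_, fun t ht => ?_, by simpa using hv.pos_right, fun j hj => ?_, ?_, fun j hj => ?_,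
      fun t ht => ?_, ?_, ?_⟩
    · exact (hv.smooth.comp hsub.contDiffOn fun t ht => (hmap t).2 ht).congr fun t _ => by simp
    · simpa using hv.pos _ (hmap' t ht)
    · have := hv.odd_right j hj
      rw [key, sub_self] at this
      exact (mul_eq_zero.1 this).resolve_left (by simp)
    · have := hv.deriv_left
      rw [key1, sub_zero] at this
      linarith
    · have := hv.even_left j hj
      rw [key, sub_zero] at this
      exact (mul_eq_zero.1 this).resolve_left (by simp)
    · have := hv.concave _ ((hmap t).2 ht)
      rw [key] at this
      simpa using this
    · filter_upwards [(tendsto_const_sub_nhdsLT b).eventually hv.strict] with t ht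
      rw [key] at ht
      simpa using ht
    · have := hv.third
      rw [key, sub_zero] at this
      simp only [Odd.neg_one_pow (show Odd 3 by decide)] at this
      linarith

theorem memU_iff_isProfile {b : ℝ} (hb : 0 < b) {u : ℝ → ℝ} :
    MemU b u ↔ IsProfile b (fun r => u (b * (1 - r))) := by
  rw [memU_iff_memV, memV_iff_isProfile hb]
  simp only [mul_sub, mul_one]

theorem isNormalizedPair_of_isProfile {b : ℝ} {f k : ℝ → ℝ}
    (hf : IsProfile b (fun r => f (1 - r))) (hk : IsProfile b k) : IsNormalizedPair b f k := by
  have hmap : MapsTo (fun r : ℝ => 1 - r) (Icc 0 1) (Icc 0 1) := fun r hr =>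
    ⟨sub_nonneg.2 hr.2, sub_le_self 1 hr.1⟩
  have hsub : ContDiff ℝ ∞ fun t : ℝ => 1 - t := contDiff_const.sub contDiff_id
  have hpos : ∀ {e : ℝ → ℝ}, IsProfile b e → ∀ r ∈ Ioc (0 : ℝ) 1, 0 < e r := fun he r hr => by
    rcases hr.2.eq_or_lt with h1 | h1
    · rw [h1]
      exact he.pos_right
    · exact he.pos r ⟨hr.1, h1⟩
  refine ⟨⟨(hf.smooth.comp hsub.contDiffOn hmap).congr fun r _ => by simp, fun j hj => ?_⟩,
    ⟨hk.smooth, hk.even_left⟩, ⟨hk.smooth.comp hsub.contDiffOn hmap, fun j hj => ?_⟩,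
    ⟨hf.smooth, hf.even_left⟩, fun r hr => ?_, hpos hk, ?_, ?_⟩
  · have := hf.odd_right j hj
    rw [iteratedDerivWithin_comp_sub_Icc, sub_self] at this
    exact (mul_eq_zero.1 this).resolve_left (by simp)
  · rw [iteratedDerivWithin_comp_sub_Icc, sub_zero, hk.odd_right j hj, mul_zero]
  · have := hpos hf (1 - r) ⟨sub_pos.2 hr.2, sub_le_self 1 hr.1⟩
    simpa using this
  · rw [← iteratedDerivWithin_one, hk.deriv_left]
  · rw [← iteratedDerivWithin_one, hf.deriv_left]

/-- All conditions are linear equations or inequalities cutting out convex cones. The slope is part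
of the data, so intervals of different lengths b₀ and b₁ can be combined once both are rescaled to
[0, 1]. -/
theorem IsProfile.convex_combination {b₀ b₁ a₀ a₁ : ℝ} {f₀ f₁ : ℝ → ℝ} (h₀ : IsProfile b₀ f₀)
    (h₁ : IsProfile b₁ f₁) (ha₀ : 0 ≤ a₀) (ha₁ : 0 ≤ a₁) (ha : 0 < a₀ + a₁) :
    IsProfile (a₀ * b₀ + a₁ * b₁) (fun r => a₀ * f₀ r + a₁ * f₁ r) := by
  have hI : UniqueDiffOn ℝ (Icc (0 : ℝ) 1) := uniqueDiffOn_Icc one_pos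
  have key : ∀ j : ℕ, ∀ r ∈ Icc (0 : ℝ) 1,
      iteratedDerivWithin j (fun r => a₀ * f₀ r + a₁ * f₁ r) (Icc 0 1) r
        = a₀ * iteratedDerivWithin j f₀ (Icc 0 1) r + a₁ * iteratedDerivWithin j f₁ (Icc 0 1) r := by
    intro j r hr
    have e₀ : ContDiffWithinAt ℝ j f₀ (Icc 0 1) r :=
      (h₀.smooth r hr).of_le (by exact_mod_cast le_top)
    have e₁ : ContDiffWithinAt ℝ j f₁ (Icc 0 1) r :=
      (h₁.smooth r hr).of_le (by exact_mod_cast le_top)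
    rw [iteratedDerivWithin_fun_add hr hI (contDiffWithinAt_const.mul e₀)
      (contDiffWithinAt_const.mul e₁), iteratedDerivWithin_const_mul_field,
      iteratedDerivWithin_const_mul_field]
  have hpos : ∀ {x y : ℝ}, 0 < x → 0 < y → 0 < a₀ * x + a₁ * y := by
    intro x y hx hy
    rcases ha₀.eq_or_lt with h | h
    · have : 0 < a₁ := by linarith
      have := mul_pos this hy
      rw [← h]
      linarith
    · have := mul_pos h hx
      have := mul_nonneg ha₁ hy.le
      linarith
  have hneg : ∀ {x y : ℝ}, x < 0 → y < 0 → a₀ * x + a₁ * y < 0 := by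
    intro x y hx hy
    have := hpos (neg_pos.2 hx) (neg_pos.2 hy)
    linarith
  have m0 : (0 : ℝ) ∈ Icc (0 : ℝ) 1 := by simp
  have m1 : (1 : ℝ) ∈ Icc (0 : ℝ) 1 := by simp
  refine ⟨(contDiffOn_const.mul h₀.smooth).add (contDiffOn_const.mul h₁.smooth),
    fun r hr => hpos (h₀.pos r hr) (h₁.pos r hr), hpos h₀.pos_right h₁.pos_right,
    fun j hj => ?_, ?_, fun j hj => ?_, fun r hr => ?_, ?_, ?_⟩
  · rw [key j 1 m1, h₀.odd_right j hj, h₁.odd_right j hj]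
    simp
  · rw [key 1 0 m0, h₀.deriv_left, h₁.deriv_left]
  · rw [key j 0 m0, h₀.even_left j hj, h₁.even_left j hj]
    simp
  · rw [key 2 r hr]
    have := mul_nonpos_of_nonneg_of_nonpos ha₀ (h₀.concave r hr)
    have := mul_nonpos_of_nonneg_of_nonpos ha₁ (h₁.concave r hr)
    linarith
  · filter_upwards [h₀.strict, h₁.strict, Ioc_mem_nhdsGT (zero_lt_one (α := ℝ))] with r e₀ e₁ hr
    rw [key 2 r (Ioc_subset_Icc_self hr)]
    exact hneg e₀ e₁
  · rw [key 3 0 m0]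
    exact hneg h₀.third h₁.third

/-- Pairs of profiles with initial slope `b`, in the order in which they appear in a doubly warped
product metric. -/
def IsProfilePair (b : ℝ) (f k : ℝ → ℝ) : Prop :=
  IsProfile b (fun r => f (1 - r)) ∧ IsProfile b k

theorem isProfilePair_of_mem {b : ℝ} (hb : 0 < b) {u v : ℝ → ℝ} (hu : MemU b u) (hv : MemV b v) :
    IsProfilePair b (fun r => u (b * r)) (fun r => v (b * r)) :=
  ⟨(memU_iff_isProfile hb).1 hu, (memV_iff_isProfile hb).1 hv⟩

theorem IsProfilePair.mem {b : ℝ} (hb : 0 < b) {f k : ℝ → ℝ} (h : IsProfilePair b f k) :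
    MemU b (fun t => f (t / b)) ∧ MemV b (fun t => k (t / b)) := by
  rw [memU_iff_isProfile hb, memV_iff_isProfile hb]
  have e : ∀ r, b * r / b = r := fun r => mul_div_cancel_left₀ r hb.ne'
  simp only [e]
  exact h

theorem exists_isDoublyWarped {n p q : ℕ} (h : p + q + 1 = n) {b : ℝ} (hb : 0 < b) {u v : ℝ → ℝ}
    (hu : MemU b u) (hv : MemV b v) : ∃ g : Riem n (S n), IsDoublyWarped h b u v g :=
  IsNormalizedPair.exists_riem h hb (isNormalizedPair_of_isProfile (f := fun r => u (b * r))
    (isProfilePair_of_mem hb hu hv).1 (isProfilePair_of_mem hb hu hv).2)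

end Profiles

/-! ### Paths of metrics in the C^k topology -/

section Paths

/-- Every derivative of the coordinate expression is the same combination of derivatives of fixed
smooth metrics. These are bounded on a compact set, so continuity of the coefficients yields uniform
convergence there. -/
theorem continuous_ckTopology_of_eq_sum {n : ℕ} {M : Type*} [TopologicalSpace M]
    [ChartedSpace (EuclideanSpace ℝ (Fin n)) M] [IsManifold (𝓡 n) ∞ M] {X ι : Type*}
    [TopologicalSpace X] [Fintype ι] (k : ℕ) {γ : X → Riem n M} {a : ι → X → ℝ}
    (ha : ∀ j, Continuous (a j)) (g : ι → Riem n M)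
    (hγ : ∀ s c, ∀ y ∈ (extChartAt (𝓡 n) c).target,
      coordMetric (γ s) c y = ∑ j, a j s • coordMetric (g j) c y) :
    @Continuous X (Riem n M) _ (ckTopology k) γ := by
  refine continuous_iInf_rng.2 fun c => continuous_iInf_rng.2 fun i => continuous_induced_rng.2 ?_
  refine continuous_iff_continuousAt.2 fun s₀ => ?_
  refine UniformOnFun.tendsto_iff_tendstoUniformlyOn.2 fun K hK => ?_
  obtain ⟨hKc, hKt⟩ := hK
  have ho := isOpen_extChartAt_target (I := 𝓡 n) c
  have hsm : ∀ j, ∀ y ∈ (extChartAt (𝓡 n) c).target,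
      ContDiffAt ℝ ∞ (coordMetric (g j) c) y := fun j y hy =>
    (contDiffOn_coordMetric (g j) c).contDiffAt (ho.mem_nhds hy)
  have hile : ((i : ℕ) : WithTop ℕ∞) ≤ ∞ := by exact_mod_cast le_top
  have hcont : ∀ j, ContinuousOn (iteratedFDeriv ℝ (i : ℕ) (coordMetric (g j) c)) K := by
    intro j y hy
    have h1 := ((hsm j y (hKt hy)).iteratedFDeriv_right (m := 0) (i := i)
      (by rw [zero_add]; exact hile)).continuousAt
    exact h1.continuousWithinAt
  have hbound : ∀ j, ∃ C, ∀ y ∈ K, ‖iteratedFDeriv ℝ (i : ℕ) (coordMetric (g j) c) y‖ ≤ C := fun j =>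
    hKc.exists_bound_of_continuousOn (hcont j)
  choose C hC using hbound
  have hder : ∀ s, ∀ y ∈ K, iteratedFDeriv ℝ (i : ℕ) (coordMetric (γ s) c) y
      = ∑ j, a j s • iteratedFDeriv ℝ (i : ℕ) (coordMetric (g j) c) y := by
    intro s y hy
    have h1 : coordMetric (γ s) c =ᶠ[𝓝 y] fun y => ∑ j, a j s • coordMetric (g j) c y := by
      filter_upwards [ho.mem_nhds (hKt hy)] with z hz
      exact hγ s c z hz
    have h2 : ∀ j, ContDiffAt ℝ (i : ℕ) (coordMetric (g j) c) y := fun j =>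
      (hsm j y (hKt hy)).of_le hile
    rw [(h1.iteratedFDeriv ℝ i).eq_of_nhds]
    have h3 := iteratedFDeriv_sum_apply (𝕜 := ℝ) (f := fun j => a j s • coordMetric (g j) c)
      (u := Finset.univ) (x := y) (n := i) fun j _ => (h2 j).const_smul (a j s)
    have h4 : (∑ j, a j s • coordMetric (g j) c) = fun y => ∑ j, a j s • coordMetric (g j) c y := by
      funext z
      simp
    rw [h4] at h3
    exact h3.trans (Finset.sum_congr rfl fun j _ => iteratedFDeriv_const_smul_apply (h2 j))
  refine Metric.tendstoUniformlyOn_iff.2 fun ε hε => ?_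
  have hlim : Tendsto (fun s => ∑ j, |a j s₀ - a j s| * C j) (𝓝 s₀) (𝓝 0) := by
    have h1 : Continuous fun s => ∑ j, |a j s₀ - a j s| * C j := by fun_prop
    have h2 := h1.tendsto s₀
    simpa using h2
  filter_upwards [hlim.eventually_lt_const hε] with s hs y hy
  refine lt_of_le_of_lt ?_ hs
  change dist (iteratedFDeriv ℝ (i : ℕ) (coordMetric (γ s₀) c) y)
    (iteratedFDeriv ℝ (i : ℕ) (coordMetric (γ s) c) y) ≤ _
  rw [hder s₀ y hy, hder s y hy, dist_eq_norm, ← Finset.sum_sub_distrib]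
  refine (norm_sum_le _ _).trans (Finset.sum_le_sum fun j _ => ?_)
  rw [← sub_smul, norm_smul, Real.norm_eq_abs]
  exact mul_le_mul_of_nonneg_left (hC j y hy) (abs_nonneg _)

variable {n p q : ℕ} (h : p + q + 1 = n)

/-- Two doubly warped product metrics are joined by a path of such metrics. -/
theorem exists_path {b₀ b₁ : ℝ} (hb₀ : 0 < b₀) (hb₁ : 0 < b₁) {g₀ g₁ : Riem n (S n)}
    (hg₀ : g₀ ∈ warpedMetrics h b₀) (hg₁ : g₁ ∈ warpedMetrics h b₁) (k : ℕ) :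
    ∃ γ : unitInterval → Riem n (S n), @Continuous _ _ _ (ckTopology k) γ ∧ γ 0 = g₀ ∧ γ 1 = g₁ ∧
      ∀ s : unitInterval, γ s ∈ warpedMetrics h ((1 - (s : ℝ)) * b₀ + s * b₁) := by
  obtain ⟨u₀, v₀, hu₀, hv₀, hw₀⟩ := hg₀
  obtain ⟨u₁, v₁, hu₁, hv₁, hw₁⟩ := hg₁
  obtain ⟨pu₀, pv₀⟩ := isProfilePair_of_mem hb₀ hu₀ hv₀
  obtain ⟨pu₁, pv₁⟩ := isProfilePair_of_mem hb₁ hu₁ hv₁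
  set B : ℝ → ℝ := fun s => (1 - s) * b₀ + s * b₁ with hB
  have hBpos : ∀ s : unitInterval, 0 < B s := by
    intro s
    have h0 := s.2.1
    have h1 := s.2.2
    simp only [hB]
    rcases h0.eq_or_lt with h2 | h2
    · rw [← h2]
      simpa using hb₀
    · have := mul_pos h2 hb₁
      have := mul_nonneg (sub_nonneg.2 h1) hb₀.le
      linarith
  set f : ℝ → ℝ → ℝ := fun s r => (1 - s) * u₀ (b₀ * r) + s * u₁ (b₁ * r) with hf
  set e : ℝ → ℝ → ℝ := fun s r => (1 - s) * v₀ (b₀ * r) + s * v₁ (b₁ * r) with he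
  have hpair : ∀ s : unitInterval, IsProfilePair (B s) (f s) (e s) := fun s =>
    ⟨pu₀.convex_combination pu₁ (sub_nonneg.2 s.2.2) s.2.1 (by linarith),
      pv₀.convex_combination pv₁ (sub_nonneg.2 s.2.2) s.2.1 (by linarith)⟩
  have hex : ∀ s : unitInterval, ∃ g : Riem n (S n),
      IsDoublyWarped h (B s) (fun t => f s (t / B s)) (fun t => e s (t / B s)) g := fun s =>
    exists_isDoublyWarped h (hBpos s) ((hpair s).mem (hBpos s)).1 ((hpair s).mem (hBpos s)).2
  choose γ hγ using hex
  have hcancel : ∀ (s : unitInterval) (r : ℝ), B s * r / B s = r := fun s r =>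
    mul_div_cancel_left₀ r (hBpos s).ne'
  refine ⟨γ, ?_, ?_, ?_, fun s => ⟨_, _, ((hpair s).mem (hBpos s)).1, ((hpair s).mem (hBpos s)).2, hγ s⟩⟩
  · let half : unitInterval := ⟨1 / 2, by norm_num, by norm_num⟩
    -- B, f and e are affine in s, so their squares are quadratic polynomials in s. The coefficients
    -- are the Lagrange polynomials for the nodes 0, 1/2, 1, which reproduce quadratics exactly.
    refine continuous_ckTopology_of_eq_sum k
      (a := ![fun s : unitInterval => (1 - (s : ℝ)) * (1 - 2 * s), fun s => 4 * s * (1 - s),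
        fun s => s * (2 * s - 1)]) (fun j => by fin_cases j <;> simp <;> fun_prop)
      ![γ 0, γ half, γ 1] fun s c y hy => ?_
    have hsum := sum_coordMetric_eq_zero h
      ![-1, (1 - (s : ℝ)) * (1 - 2 * s), 4 * s * (1 - s), s * (2 * s - 1)]
      ![B s, B 0, B half, B 1]
      (by
        intro i
        fin_cases i
        · exact hBpos s
        · exact hBpos 0
        · exact hBpos half
        · exact hBpos 1)
      ![fun t => f s (t / B s), fun t => f 0 (t / B 0), fun t => f half (t / B half),
        fun t => f 1 (t / B 1)]
      ![fun t => e s (t / B s), fun t => e 0 (t / B 0), fun t => e half (t / B half),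
        fun t => e 1 (t / B 1)] ![γ s, γ 0, γ half, γ 1]
      (by
        intro i
        fin_cases i
        · exact hγ s
        · exact hγ 0
        · exact hγ half
        · exact hγ 1) ?_ ?_ ?_ c hy
    · simp only [Fin.sum_univ_four, Fin.sum_univ_three, Matrix.cons_val] at hsum ⊢
      rw [neg_one_smul] at hsum
      rw [← sub_eq_zero, ← neg_eq_zero, ← hsum]
      abel
    · simp only [Fin.sum_univ_four, Matrix.cons_val, hB, half]
      ring
    · intro r _
      have e0 := hcancel 0 r
      have e1 := hcancel 1 r
      simp only [Set.Icc.coe_zero, Set.Icc.coe_one] at e0 e1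
      simp only [Fin.sum_univ_four, Matrix.cons_val, hcancel, e0, e1]
      simp only [hf, half]
      ring
    · intro r _
      have e0 := hcancel 0 r
      have e1 := hcancel 1 r
      simp only [Set.Icc.coe_zero, Set.Icc.coe_one] at e0 e1
      simp only [Fin.sum_univ_four, Matrix.cons_val, hcancel, e0, e1]
      simp only [he, half]
      ring
  · have hB0 : B (0 : unitInterval) = b₀ := by simp [hB]
    have h0 := hγ 0
    rw [hB0] at h0
    -- The metrics γ s were chosen from an existence statement; uniqueness identifies the endpoint
    -- with the given metric.
    refine IsDoublyWarped.unique h hb₀ (h0.congr h (f' := u₀) (k' := v₀) (fun t _ => ?_)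
      fun t _ => ?_) hw₀
    · simp [hf, mul_div_cancel₀ _ hb₀.ne']
    · simp [he, mul_div_cancel₀ _ hb₀.ne']
  · have hB1 : B (1 : unitInterval) = b₁ := by simp [hB]
    have h1 := hγ 1
    rw [hB1] at h1
    refine IsDoublyWarped.unique h hb₁ (h1.congr h (f' := u₁) (k' := v₁) (fun t _ => ?_)
      fun t _ => ?_) hw₁
    · simp [hf, mul_div_cancel₀ _ hb₁.ne']
    · simp [he, mul_div_cancel₀ _ hb₁.ne']

theorem joinedIn_of_warpedMetrics {b₀ b₁ : ℝ} (hb₀ : 0 < b₀) (hb₁ : 0 < b₁) {g₀ g₁ : Riem n (S n)}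
    (hg₀ : g₀ ∈ warpedMetrics h b₀) (hg₁ : g₁ ∈ warpedMetrics h b₁) (k : ℕ) {F : Set (Riem n (S n))}
    (hF : ∀ s ∈ Icc (0 : ℝ) 1, warpedMetrics h ((1 - s) * b₀ + s * b₁) ⊆ F) :
    @JoinedIn _ (ckTopology k) F g₀ g₁ := by
  obtain ⟨γ, hγ, h0, h1, hmem⟩ := exists_path h hb₀ hb₁ hg₀ hg₁ k
  let := ckTopology (n := n) (M := S n) k
  exact ⟨⟨⟨γ, hγ⟩, h0, h1⟩, fun s => hF s s.2 (hmem s)⟩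

end Paths

/-! ### Sine profiles, torpedo functions and the round metric -/

section Examples

theorem contDiff_scaledSin (δ : ℝ) : ContDiff ℝ ∞ fun t : ℝ => δ * Real.sin (t / δ) :=
  contDiff_const.mul (Real.contDiff_sin.comp (contDiff_id.div_const δ))

theorem iteratedDeriv_scaledSin (δ : ℝ) (j : ℕ) (t : ℝ) :
    iteratedDeriv j (fun t => δ * Real.sin (t / δ)) t
      = δ * (δ⁻¹ ^ j * iteratedDeriv j Real.sin (t / δ)) := by
  have h1 : (fun t : ℝ => Real.sin (t / δ)) = fun t => Real.sin (δ⁻¹ * t) := by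
    funext t
    rw [div_eq_inv_mul]
  rw [iteratedDeriv_const_mul_field, h1, iteratedDeriv_comp_const_mul Real.contDiff_sin,
    div_eq_inv_mul]

theorem iteratedDerivWithin_scaledSin {b : ℝ} (hb : 0 < b) (δ : ℝ) (j : ℕ) {t : ℝ}
    (ht : t ∈ Icc 0 b) :
    iteratedDerivWithin j (fun t => δ * Real.sin (t / δ)) (Icc 0 b) t
      = δ * (δ⁻¹ ^ j * iteratedDeriv j Real.sin (t / δ)) := by
  rw [iteratedDerivWithin_eq_iteratedDeriv (uniqueDiffOn_Icc hb)
    ((contDiff_scaledSin δ).of_le (by exact_mod_cast le_top)).contDiffAt ht,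
    iteratedDeriv_scaledSin]

theorem iteratedDeriv_sin_zero_of_even {j : ℕ} (hj : Even j) : iteratedDeriv j Real.sin 0 = 0 := by
  obtain ⟨m, rfl⟩ := hj.two_dvd
  rw [Real.iteratedDeriv_even_sin]
  simp

theorem iteratedDeriv_sin_pi_div_two_of_odd {j : ℕ} (hj : Odd j) :
    iteratedDeriv j Real.sin (Real.pi / 2) = 0 := by
  obtain ⟨m, rfl⟩ := hj
  rw [Real.iteratedDeriv_odd_sin]
  simp

theorem iteratedDeriv_two_sin (t : ℝ) : iteratedDeriv 2 Real.sin t = -Real.sin t := by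
  simp

theorem iteratedDeriv_three_sin (t : ℝ) : iteratedDeriv 3 Real.sin t = -Real.cos t := by
  simp

/-- The scale 2b/π makes [0, b] a quarter period of the sine. This shows that the spaces are
nonempty for every b, and b = π/2 gives the round metric. -/
theorem memV_scaledSin {b : ℝ} (hb : 0 < b) :
    MemV b fun t => 2 * b / Real.pi * Real.sin (t / (2 * b / Real.pi)) := by
  have hπ := Real.pi_pos
  set δ := 2 * b / Real.pi with hδ
  have hδ0 : 0 < δ := by positivity
  have hbδ : b / δ = Real.pi / 2 := by
    rw [hδ]
    field_simp
  have m0 : (0 : ℝ) ∈ Icc 0 b := ⟨le_rfl, hb.le⟩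
  have m1 : b ∈ Icc 0 b := ⟨hb.le, le_rfl⟩
  have hle : ∀ t ∈ Icc 0 b, t / δ ∈ Icc 0 Real.pi := fun t ht =>
    ⟨div_nonneg ht.1 hδ0.le, (div_le_div_of_nonneg_right ht.2 hδ0.le).trans (by rw [hbδ]; linarith)⟩
  have hlt : ∀ t ∈ Ioo 0 b, t / δ ∈ Ioo 0 Real.pi := fun t ht =>
    ⟨div_pos ht.1 hδ0, (div_lt_div_of_pos_right ht.2 hδ0).trans (by rw [hbδ]; linarith)⟩
  refine ⟨(contDiff_scaledSin δ).contDiffOn, fun t ht => ?_, ?_, fun j hj => ?_, ?_, fun j hj => ?_,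
    fun t ht => ?_, ?_, ?_⟩
  · exact mul_pos hδ0 (Real.sin_pos_of_mem_Ioo (hlt t ht))
  · rw [hbδ, Real.sin_pi_div_two, mul_one]
    exact hδ0
  · rw [iteratedDerivWithin_scaledSin hb δ j m1, hbδ, iteratedDeriv_sin_pi_div_two_of_odd hj]
    simp
  · rw [← iteratedDerivWithin_one, iteratedDerivWithin_scaledSin hb δ 1 m0]
    simp [hδ0.ne']
  · rw [iteratedDerivWithin_scaledSin hb δ j m0, zero_div, iteratedDeriv_sin_zero_of_even hj]
    simp
  · rw [iteratedDerivWithin_scaledSin hb δ 2 ht, iteratedDeriv_two_sin]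
    have := Real.sin_nonneg_of_mem_Icc (hle t ht)
    have : 0 ≤ δ * (δ⁻¹ ^ 2 * Real.sin (t / δ)) := by positivity
    linarith
  · filter_upwards [Ioo_mem_nhdsGT hb] with t ht
    rw [iteratedDerivWithin_scaledSin hb δ 2 (Ioo_subset_Icc_self ht), iteratedDeriv_two_sin]
    have := Real.sin_pos_of_mem_Ioo (hlt t ht)
    have : 0 < δ * (δ⁻¹ ^ 2 * Real.sin (t / δ)) := by positivity
    linarith
  · rw [iteratedDerivWithin_scaledSin hb δ 3 m0, iteratedDeriv_three_sin, zero_div, Real.cos_zero]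
    have : 0 < δ * (δ⁻¹ ^ 3 * 1) := by positivity
    linarith

theorem concaveOn_of_isTorpedo {δ : ℝ} {f : ℝ → ℝ} (hf : IsTorpedo δ f) : ConcaveOn ℝ (Ioi 0) f := by
  refine concaveOn_of_deriv2_nonpos (convex_Ioi 0) hf.smooth.continuousOn ?_ ?_ ?_
  · rw [interior_Ioi]
    exact hf.smooth.differentiableOn (by simp)
  · rw [interior_Ioi]
    exact ((contDiffOn_infty_iff_deriv_of_isOpen isOpen_Ioi).1 hf.smooth).2.differentiableOn (by simp)
  · rw [interior_Ioi]
    intro t ht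
    have := hf.concave t ht
    rwa [iteratedDeriv_eq_iterate] at this

/-- Near 0 the function is a scaled sine, which settles all conditions there; near b it is constant,
because b > δπ exceeds δπ/2. A torpedo function is unconstrained for t ≤ 0, so its value at 0 has to
be replaced by 0. -/
theorem memV_of_isTorpedo {δ b : ℝ} (hδ : 0 < δ) {f : ℝ → ℝ} (hf : IsTorpedo δ f)
    (hb : δ * Real.pi < b) : MemV b fun t => if t ≤ 0 then 0 else f t := by
  have hπ := Real.pi_pos
  have hb0 : 0 < b := (mul_pos hδ hπ).trans hb
  have hbt : δ * (Real.pi / 2) < b := by nlinarith [mul_pos hδ hπ]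
  set v : ℝ → ℝ := fun t => if t ≤ 0 then 0 else f t with hv
  have hvf : ∀ t, 0 < t → v =ᶠ[𝓝 t] f := fun t ht => by
    filter_upwards [lt_mem_nhds ht] with s hs
    simp only [hv, if_neg hs.not_ge]
  have hvs : v =ᶠ[𝓝[Icc 0 b] 0] fun t => δ * Real.sin (t / δ) := by
    have h1 := eventually_nhdsWithin_iff.1 hf.near_zero
    filter_upwards [nhdsWithin_le_nhds h1, self_mem_nhdsWithin] with t ht ht'
    rcases ht'.1.eq_or_lt with h0 | h0
    · simp [hv, ← h0]
    · simp only [hv, if_neg h0.not_ge]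
      exact ht h0
  have hv0 : v 0 = δ * Real.sin (0 / δ) := by simp [hv]
  have m0 : (0 : ℝ) ∈ Icc 0 b := ⟨le_rfl, hb0.le⟩
  have m1 : b ∈ Icc 0 b := ⟨hb0.le, le_rfl⟩
  have hzero : ∀ j, iteratedDerivWithin j v (Icc 0 b) 0
      = δ * (δ⁻¹ ^ j * iteratedDeriv j Real.sin 0) := fun j => by
    rw [hvs.iteratedDerivWithin_eq hv0, iteratedDerivWithin_scaledSin hb0 δ j m0, zero_div]
  have hfat : ∀ t, 0 < t → ContDiffAt ℝ ∞ f t := fun t ht =>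
    hf.smooth.contDiffAt (Ioi_mem_nhds ht)
  have hvat : ∀ t, 0 < t → ContDiffAt ℝ ∞ v t := fun t ht =>
    (hfat t ht).congr_of_eventuallyEq (hvf t ht)
  have hpos : ∀ j : ℕ, ∀ t ∈ Ioc 0 b, iteratedDerivWithin j v (Icc 0 b) t = iteratedDeriv j f t := by
    intro j t ht
    rw [iteratedDerivWithin_eq_iteratedDeriv (uniqueDiffOn_Icc hb0)
      ((hvat t ht.1).of_le (by exact_mod_cast le_top)) (Ioc_subset_Icc_self ht)]
    exact (hvf t ht.1).iteratedDeriv_eq j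
  refine ⟨fun t ht => ?_, fun t ht => ?_, ?_, fun j hj => ?_, ?_, fun j hj => ?_, fun t ht => ?_, ?_, ?_⟩
  · rcases ht.1.eq_or_lt with h0 | h0
    · rw [← h0]
      exact (contDiff_scaledSin δ).contDiffWithinAt.congr_of_eventuallyEq hvs hv0
    · exact (hvat t h0).contDiffWithinAt
  · simp only [hv, if_neg ht.1.not_ge]
    have h1 : ∀ᶠ s in 𝓝[>] 0, s < t ∧ s / δ ∈ Ioo 0 Real.pi ∧ 0 < s ∧
        f s = δ * Real.sin (s / δ) := by
      filter_upwards [hf.near_zero, Ioo_mem_nhdsGT ht.1, Ioo_mem_nhdsGT (mul_pos hδ hπ)]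
        with s h1 h2 h3
      refine ⟨h2.2, ⟨div_pos h2.1 hδ, ?_⟩, h2.1, h1⟩
      rw [div_lt_iff₀ hδ, mul_comm]
      exact h3.2
    obtain ⟨s, hs1, hs2, hs3, hs4⟩ := h1.exists
    -- A concave function on [s, b] is at least the smaller of its end values, here a positive sine
    -- value at a small s and δ at b.
    have h2 := (concaveOn_of_isTorpedo hf).min_le_of_mem_Icc (x := s) (y := b) (z := t) hs3 hb0
      ⟨hs1.le, ht.2.le⟩
    refine lt_of_lt_of_le (lt_min ?_ ?_) h2
    · rw [hs4]
      exact mul_pos hδ (Real.sin_pos_of_mem_Ioo hs2)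
    · rw [hf.tube b hbt.le]
      exact hδ
  · simp only [hv, if_neg hb0.not_ge]
    rw [hf.tube b hbt.le]
    exact hδ
  · rw [hpos j b ⟨hb0, le_rfl⟩]
    have h1 : f =ᶠ[𝓝 b] fun _ => δ := by
      filter_upwards [lt_mem_nhds hbt] with s hs
      exact hf.tube s hs.le
    rw [h1.iteratedDeriv_eq j, iteratedDeriv_const, if_neg hj.pos.ne']
  · rw [← iteratedDerivWithin_one, hzero]
    simp [hδ.ne']
  · rw [hzero, iteratedDeriv_sin_zero_of_even hj]
    simp
  · rcases ht.1.eq_or_lt with h0 | h0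
    · rw [← h0, hzero, iteratedDeriv_sin_zero_of_even even_two]
      simp
    · rw [hpos 2 t ⟨h0, ht.2⟩]
      exact hf.concave t h0
  · have h1 := eventually_eventually_nhdsWithin.2 hf.near_zero
    filter_upwards [h1, Ioo_mem_nhdsGT hb0, Ioo_mem_nhdsGT (mul_pos hδ hπ)] with t h1 h2 h3
    rw [hpos 2 t ⟨h2.1, h2.2.le⟩]
    have h4 : f =ᶠ[𝓝 t] fun t => δ * Real.sin (t / δ) := by
      rw [(isOpen_Ioi.nhdsWithin_eq h2.1)] at h1
      exact h1
    rw [h4.iteratedDeriv_eq 2, iteratedDeriv_scaledSin, iteratedDeriv_two_sin]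
    have h5 : 0 < Real.sin (t / δ) := Real.sin_pos_of_mem_Ioo ⟨div_pos h2.1 hδ, by
      rw [div_lt_iff₀ hδ, mul_comm]
      exact h3.2⟩
    have : 0 < δ * (δ⁻¹ ^ 2 * Real.sin (t / δ)) := by positivity
    linarith
  · rw [hzero, iteratedDeriv_three_sin, Real.cos_zero]
    have : 0 < δ * (δ⁻¹ ^ 3 * 1) := by positivity
    linarith

variable {n p q : ℕ} (h : p + q + 1 = n)

/-- The round metric is the ambient form with A = B = 1 and C = 0. -/
theorem isDoublyWarped_roundMetric :
    IsDoublyWarped h (Real.pi / 2) Real.cos Real.sin (roundMetric n) := by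
  have hπ := Real.pi_pos
  refine isDoublyWarped_of_ambientForm h (by positivity) (A := fun _ => 1) (B := fun _ => 1)
    (C := fun _ => 0) (fun x ξ η => ?_) fun s hs => ?_
  · rw [ambientForm_apply]
    change inner ℝ (dIncl n x ξ) (dIncl n x η) = _
    rw [← inner_proj_add h]
    ring
  · have e : Real.pi / 2 * radial s = Real.arcsin √s := by
      rw [radial]
      field_simp
    have h1 := Real.sqrt_nonneg s
    have h2 := Real.sqrt_le_one.2 hs.2
    rw [e, Real.cos_arcsin, Real.sin_arcsin (by linarith) h2, Real.sq_sqrt, Real.sq_sqrt hs.1]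
    · refine ⟨?_, by ring, by ring⟩
      field_simp
      ring
    · rw [Real.sq_sqrt hs.1]
      linarith [hs.2]

theorem roundMetric_mem_warpedMetrics : roundMetric n ∈ warpedMetrics h (Real.pi / 2) := by
  have hπ := Real.pi_pos
  have h1 := memV_scaledSin (b := Real.pi / 2) (by positivity)
  have e : 2 * (Real.pi / 2) / Real.pi = 1 := by field_simp
  simp only [e, one_mul, div_one] at h1
  refine ⟨Real.cos, Real.sin, memU_iff_memV.2 ?_, h1, isDoublyWarped_roundMetric h⟩
  simpa only [Real.cos_pi_div_two_sub] using h1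

theorem warpedMetrics_nonempty {b : ℝ} (hb : 0 < b) : (warpedMetrics h b).Nonempty := by
  have hv := memV_scaledSin hb
  have hu : MemU b fun t => 2 * b / Real.pi * Real.sin ((b - t) / (2 * b / Real.pi)) := by
    rw [memU_iff_memV]
    simpa using hv
  obtain ⟨g, hg⟩ := exists_isDoublyWarped h hb hu hv
  exact ⟨g, _, _, hu, hv, hg⟩

/-- Warping functions matter only on the open interval, so the corrected values at the endpoints do
not change the metric. -/
theorem isMixedTorpedo_iff {b : ℝ} {fε fδ : ℝ → ℝ} {g : Riem n (S n)} :
    IsMixedTorpedo h b fε fδ g ↔ IsDoublyWarped h b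
      (fun t => if b - t ≤ 0 then 0 else fε (b - t)) (fun t => if t ≤ 0 then 0 else fδ t) g := by
  have h1 : ∀ t ∈ Ioo 0 b, (if b - t ≤ 0 then 0 else fε (b - t)) = fε (b - t) := fun t ht =>
    if_neg (sub_pos.2 ht.2).not_ge
  have h2 : ∀ t ∈ Ioo 0 b, (if t ≤ 0 then 0 else fδ t) = fδ t := fun t ht => if_neg ht.1.not_ge
  exact ⟨fun hg => hg.congr h h1 h2,
    fun hg => hg.congr h (fun t ht => (h1 t ht).symm) fun t ht => (h2 t ht).symm⟩

theorem memU_of_isTorpedo {ε b : ℝ} (hε : 0 < ε) {f : ℝ → ℝ} (hf : IsTorpedo ε f)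
    (hb : ε * Real.pi < b) : MemU b fun t => if b - t ≤ 0 then 0 else f (b - t) := by
  rw [memU_iff_memV]
  simpa using memV_of_isTorpedo hε hf hb

end Examples

/-! ### Stereographic coordinates on the sphere factors -/

section Stereographic

variable {m : ℕ}

/-- A linear isometry from `ℝᵐ` onto the orthogonal complement of a point of `Sᵐ`. -/
def tangentIsometry (φ : S m) : EuclideanSpace ℝ (Fin m) →L[ℝ] EuclideanSpace ℝ (Fin (m + 1)) :=
  have := Fact.mk (@finrank_euclideanSpace_fin ℝ _ (m + 1))
  (Submodule.subtypeL (ℝ ∙ (φ : EuclideanSpace ℝ (Fin (m + 1))))ᗮ).comp ((OrthonormalBasis.fromOrthogonalSpanSingleton (𝕜 := ℝ) m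
    (ne_zero_of_mem_unit_sphere φ)).repr.symm.toContinuousLinearEquiv :
      EuclideanSpace ℝ (Fin m) →L[ℝ] (ℝ ∙ (φ : EuclideanSpace ℝ (Fin (m + 1))))ᗮ)

theorem inner_tangentIsometry (φ : S m) (ζ η : EuclideanSpace ℝ (Fin m)) :
    inner ℝ (tangentIsometry φ ζ) (tangentIsometry φ η) = inner ℝ ζ η := by
  have := Fact.mk (@finrank_euclideanSpace_fin ℝ _ (m + 1))
  exact (OrthonormalBasis.fromOrthogonalSpanSingleton (𝕜 := ℝ) m
    (ne_zero_of_mem_unit_sphere φ)).repr.symm.inner_map_map ζ η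

theorem inner_coe_tangentIsometry (φ : S m) (ζ : EuclideanSpace ℝ (Fin m)) :
    inner ℝ (φ : EuclideanSpace ℝ (Fin (m + 1))) (tangentIsometry φ ζ) = 0 := by
  have := Fact.mk (@finrank_euclideanSpace_fin ℝ _ (m + 1))
  exact Submodule.mem_orthogonal_singleton_iff_inner_right.1
    ((OrthonormalBasis.fromOrthogonalSpanSingleton (𝕜 := ℝ) m
      (ne_zero_of_mem_unit_sphere φ)).repr.symm ζ).2

/-- Inverse stereographic projection onto `Sᵐ`, sending `0` to `φ`, as a map to `ℝᵐ⁺¹`. -/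
def stereoAmbient (φ : S m) (ζ : EuclideanSpace ℝ (Fin m)) : EuclideanSpace ℝ (Fin (m + 1)) :=
  confFactor ζ • ((2 : ℝ) • (φ : EuclideanSpace ℝ (Fin (m + 1))) + tangentIsometry φ ζ) - φ

theorem confFactor_mul (ζ : EuclideanSpace ℝ (Fin m)) : confFactor ζ * (4 + ‖ζ‖ ^ 2) = 4 := by
  have : 4 + ‖ζ‖ ^ 2 ≠ 0 := by positivity
  rw [confFactor]
  field_simp

theorem norm_stereoAmbient (φ : S m) (ζ : EuclideanSpace ℝ (Fin m)) : ‖stereoAmbient φ ζ‖ = 1 := by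
  rw [← sq_eq_sq₀ (norm_nonneg _) zero_le_one, ← real_inner_self_eq_norm_sq, stereoAmbient]
  have h1 : inner ℝ (φ : EuclideanSpace ℝ (Fin (m + 1))) φ = (1 : ℝ) := by
    rw [real_inner_self_eq_norm_sq, norm_eq_of_mem_sphere]
    norm_num
  have h2 := inner_coe_tangentIsometry φ ζ
  have h3 := inner_tangentIsometry φ ζ ζ
  have h4 : inner ℝ (tangentIsometry φ ζ) (φ : EuclideanSpace ℝ (Fin (m + 1))) = 0 := by
    rw [real_inner_comm]
    exact h2
  rw [real_inner_self_eq_norm_sq] at h3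
  have h5 := confFactor_mul ζ
  simp only [inner_sub_left, inner_sub_right, inner_add_left, inner_add_right, inner_smul_left,
    inner_smul_right, RCLike.conj_to_real, h1, h2, h4, real_inner_self_eq_norm_sq] at *
  rw [h3]
  linear_combination confFactor ζ * h5

theorem contDiff_stereoAmbient (φ : S m) : ContDiff ℝ ∞ (stereoAmbient φ) :=
  (contDiff_confFactor.smul (contDiff_const.add (tangentIsometry φ).contDiff)).sub contDiff_const

theorem fderiv_stereoAmbient (φ : S m) (ζ α : EuclideanSpace ℝ (Fin m)) :
    fderiv ℝ (stereoAmbient φ) ζ α = confFactor ζ • tangentIsometry φ α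
      + (-(confFactor ζ) ^ 2 / 2 * inner ℝ ζ α) •
        ((2 : ℝ) • (φ : EuclideanSpace ℝ (Fin (m + 1))) + tangentIsometry φ ζ) := by
  have h1 := ((hasFDerivAt_confFactor ζ).smul ((tangentIsometry φ).hasFDerivAt.const_add
    ((2 : ℝ) • (φ : EuclideanSpace ℝ (Fin (m + 1)))))).sub_const
      (φ : EuclideanSpace ℝ (Fin (m + 1)))
  have h2 : HasFDerivAt (stereoAmbient φ) _ ζ := h1
  rw [h2.fderiv]
  simp

/-- Conformality of stereographic projection; after expansion it reduces to the relation between the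
conformal factor and 4 + ‖ζ‖². -/
theorem inner_fderiv_stereoAmbient (φ : S m) (ζ α β : EuclideanSpace ℝ (Fin m)) :
    inner ℝ (fderiv ℝ (stereoAmbient φ) ζ α) (fderiv ℝ (stereoAmbient φ) ζ β)
      = confFactor ζ ^ 2 * inner ℝ α β := by
  rw [fderiv_stereoAmbient, fderiv_stereoAmbient]
  have h1 : inner ℝ (φ : EuclideanSpace ℝ (Fin (m + 1))) φ = (1 : ℝ) := by
    rw [real_inner_self_eq_norm_sq, norm_eq_of_mem_sphere]
    norm_num
  have h2 := inner_coe_tangentIsometry φ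
  have h4 : ∀ ζ, inner ℝ (tangentIsometry φ ζ) (φ : EuclideanSpace ℝ (Fin (m + 1))) = 0 := by
    intro ζ
    rw [real_inner_comm]
    exact h2 ζ
  have h5 := confFactor_mul ζ
  simp only [inner_add_left, inner_add_right, inner_smul_left,
    inner_smul_right, RCLike.conj_to_real, h1, h2, h4, inner_tangentIsometry]
  rw [real_inner_self_eq_norm_sq, real_inner_comm ζ α]
  linear_combination (confFactor ζ ^ 3 / 4 * inner ℝ ζ α * inner ℝ ζ β) * h5

/-- Inverse stereographic projection onto `Sᵐ`, sending `0` to `φ`. -/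
def stereoMap (φ : S m) (ζ : EuclideanSpace ℝ (Fin m)) : S m :=
  ⟨stereoAmbient φ ζ, mem_sphere_zero_iff_norm.2 (norm_stereoAmbient φ ζ)⟩

theorem stereoMap_zero (φ : S m) : stereoMap φ 0 = φ := by
  refine Subtype.ext ?_
  simp only [stereoMap, stereoAmbient, map_zero, confFactor, norm_zero]
  norm_num
  module

theorem contMDiff_stereoMap (φ : S m) :
    ContMDiff 𝓘(ℝ, EuclideanSpace ℝ (Fin m)) (𝓡 m) ∞ (stereoMap φ) := by
  have := Fact.mk (@finrank_euclideanSpace_fin ℝ _ (m + 1))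
  exact ContMDiff.codRestrict_sphere (n := m) (contDiff_stereoAmbient φ).contMDiff
    fun ζ => (stereoMap φ ζ).2

theorem dIncl_mfderiv_stereoMap (φ : S m) (ζ α : EuclideanSpace ℝ (Fin m)) :
    dIncl m (stereoMap φ ζ) (mfderiv 𝓘(ℝ, EuclideanSpace ℝ (Fin m)) (𝓡 m) (stereoMap φ) ζ α)
      = fderiv ℝ (stereoAmbient φ) ζ α := by
  have h1 : MDifferentiableAt (𝓡 m) 𝓘(ℝ, EuclideanSpace ℝ (Fin (m + 1)))
      ((↑) : S m → EuclideanSpace ℝ (Fin (m + 1))) (stereoMap φ ζ) :=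
    (contMDiff_coeSphere m _).mdifferentiableAt (by simp)
  have h2 := (contMDiff_stereoMap φ ζ).mdifferentiableAt (by simp)
  have e1 := mfderiv_comp ζ h1 h2
  have e4 := congrArg (fun L => L α) e1
  rw [← mfderiv_eq_fderiv]
  exact e4.symm

theorem roundMetric_mfderiv_stereoMap (φ : S m) (ζ α β : EuclideanSpace ℝ (Fin m)) :
    (roundMetric m).inner (stereoMap φ ζ)
      (mfderiv 𝓘(ℝ, EuclideanSpace ℝ (Fin m)) (𝓡 m) (stereoMap φ) ζ α)
      (mfderiv 𝓘(ℝ, EuclideanSpace ℝ (Fin m)) (𝓡 m) (stereoMap φ) ζ β)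
      = confFactor ζ ^ 2 * inner ℝ α β := by
  change inner ℝ (dIncl m _ _) (dIncl m _ _) = _
  rw [dIncl_mfderiv_stereoMap, dIncl_mfderiv_stereoMap, inner_fderiv_stereoAmbient]

end Stereographic

/-! ### Scalar curvature of a doubly warped metric on the sphere -/

section WarpChart

variable {n p q : ℕ} (h : p + q + 1 = n)

/-- The product of the identity with two inverse stereographic projections. -/
def stereoProd (φ : S p) (θ : S q) (z : WarpModel p q) : ℝ × S p × S q :=
  (z.1, stereoMap φ z.2.1, stereoMap θ z.2.2)

theorem contMDiff_stereoProd (φ : S p) (θ : S q) :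
    ContMDiff 𝓘(ℝ, WarpModel p q) (𝓘(ℝ, ℝ).prod ((𝓡 p).prod (𝓡 q))) ∞ (stereoProd φ θ) := by
  have h1 : ContMDiff 𝓘(ℝ, WarpModel p q) 𝓘(ℝ, ℝ) ∞ fun z : WarpModel p q => z.1 :=
    contDiff_fst.contMDiff
  have h2 : ContMDiff 𝓘(ℝ, WarpModel p q) 𝓘(ℝ, EuclideanSpace ℝ (Fin p)) ∞
      fun z : WarpModel p q => z.2.1 := (contDiff_fst.comp contDiff_snd).contMDiff
  have h3 : ContMDiff 𝓘(ℝ, WarpModel p q) 𝓘(ℝ, EuclideanSpace ℝ (Fin q)) ∞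
      fun z : WarpModel p q => z.2.2 := (contDiff_snd.comp contDiff_snd).contMDiff
  exact h1.prodMk (((contMDiff_stereoMap φ).comp h2).prodMk ((contMDiff_stereoMap θ).comp h3))

theorem mfderiv_stereoProd (φ : S p) (θ : S q) (z ξ : WarpModel p q) :
    mfderiv 𝓘(ℝ, WarpModel p q) (𝓘(ℝ, ℝ).prod ((𝓡 p).prod (𝓡 q))) (stereoProd φ θ) z ξ
      = (ξ.1, mfderiv 𝓘(ℝ, EuclideanSpace ℝ (Fin p)) (𝓡 p) (stereoMap φ) z.2.1 ξ.2.1,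
          mfderiv 𝓘(ℝ, EuclideanSpace ℝ (Fin q)) (𝓡 q) (stereoMap θ) z.2.2 ξ.2.2) := by
  have h1 : HasMFDerivAt 𝓘(ℝ, WarpModel p q) 𝓘(ℝ, ℝ) (fun z : WarpModel p q => z.1) z
      (ContinuousLinearMap.fst ℝ ℝ (EuclideanSpace ℝ (Fin p) × EuclideanSpace ℝ (Fin q))) :=
    hasFDerivAt_fst.hasMFDerivAt
  have h2 : HasMFDerivAt 𝓘(ℝ, WarpModel p q) 𝓘(ℝ, EuclideanSpace ℝ (Fin p))
      (fun z : WarpModel p q => z.2.1) z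
      ((ContinuousLinearMap.fst ℝ (EuclideanSpace ℝ (Fin p)) (EuclideanSpace ℝ (Fin q))).comp
        (ContinuousLinearMap.snd ℝ ℝ (EuclideanSpace ℝ (Fin p) × EuclideanSpace ℝ (Fin q)))) :=
    (hasFDerivAt_fst.comp z hasFDerivAt_snd).hasMFDerivAt
  have h3 : HasMFDerivAt 𝓘(ℝ, WarpModel p q) 𝓘(ℝ, EuclideanSpace ℝ (Fin q))
      (fun z : WarpModel p q => z.2.2) z
      ((ContinuousLinearMap.snd ℝ (EuclideanSpace ℝ (Fin p)) (EuclideanSpace ℝ (Fin q))).comp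
        (ContinuousLinearMap.snd ℝ ℝ (EuclideanSpace ℝ (Fin p) × EuclideanSpace ℝ (Fin q)))) :=
    (hasFDerivAt_snd.comp z hasFDerivAt_snd).hasMFDerivAt
  have h4 := ((contMDiff_stereoMap φ z.2.1).mdifferentiableAt (by simp)).hasMFDerivAt
  have h5 := ((contMDiff_stereoMap θ z.2.2).mdifferentiableAt (by simp)).hasMFDerivAt
  have h6 := h1.prodMk ((h4.comp z h2).prodMk (h5.comp z h3))
  have h7 : HasMFDerivAt 𝓘(ℝ, WarpModel p q) (𝓘(ℝ, ℝ).prod ((𝓡 p).prod (𝓡 q)))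
    (stereoProd φ θ) z _ := h6
  rw [h7.mfderiv]
  rfl

/-- Doubly warped coordinates on `Sⁿ`. -/
def warpChart (b : ℝ) (φ : S p) (θ : S q) (z : WarpModel p q) : S n :=
  warpMap h b (stereoProd φ θ z)

theorem contMDiff_warpChart (b : ℝ) (φ : S p) (θ : S q) :
    ContMDiff 𝓘(ℝ, WarpModel p q) (𝓡 n) ∞ (warpChart h b φ θ) :=
  (contMDiff_warpMap h b).comp (contMDiff_stereoProd φ θ)

theorem IsDoublyWarped.inner_warpChart {b : ℝ} {u v : ℝ → ℝ} {g : Riem n (S n)}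
    (hg : IsDoublyWarped h b u v g) (φ : S p) (θ : S q) {z : WarpModel p q} (hz : z.1 ∈ Ioo 0 b)
    (ξ η : WarpModel p q) :
    g.inner (warpChart h b φ θ z)
      (mfderiv 𝓘(ℝ, WarpModel p q) (𝓡 n) (warpChart h b φ θ) z ξ)
      (mfderiv 𝓘(ℝ, WarpModel p q) (𝓡 n) (warpChart h b φ θ) z η) = warpForm p q u v z ξ η := by
  have h1 := mfderiv_comp z ((contMDiff_warpMap h b (stereoProd φ θ z)).mdifferentiableAt (by simp))
    ((contMDiff_stereoProd φ θ z).mdifferentiableAt (by simp))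
  have h2 : ∀ ξ : WarpModel p q,
      (mfderiv 𝓘(ℝ, WarpModel p q) (𝓡 n) (warpChart h b φ θ) z ξ : EuclideanSpace ℝ (Fin n))
      = mfderiv (𝓘(ℝ, ℝ).prod ((𝓡 p).prod (𝓡 q))) (𝓡 n) (warpMap h b) (stereoProd φ θ z)
        (ξ.1, mfderiv 𝓘(ℝ, EuclideanSpace ℝ (Fin p)) (𝓡 p) (stereoMap φ) z.2.1 ξ.2.1,
          mfderiv 𝓘(ℝ, EuclideanSpace ℝ (Fin q)) (𝓡 q) (stereoMap θ) z.2.2 ξ.2.2) :=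
    fun ξ => (congrArg (fun L => L ξ) h1).trans
      (congrArg (mfderiv (𝓘(ℝ, ℝ).prod ((𝓡 p).prod (𝓡 q))) (𝓡 n) (warpMap h b) (stereoProd φ θ z))
        (mfderiv_stereoProd φ θ z ξ))
  refine (congrArg₂ (fun α β : EuclideanSpace ℝ (Fin n) =>
    (g.inner (warpChart h b φ θ z) : EuclideanSpace ℝ (Fin n) →L[ℝ] EuclideanSpace ℝ (Fin n) →L[ℝ] ℝ)
      α β) (h2 ξ) (h2 η)).trans ?_
  refine (hg z.1 hz (stereoMap φ z.2.1) (stereoMap θ z.2.2) _ _).trans ?_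
  rw [warpForm_apply]
  have e1 := roundMetric_mfderiv_stereoMap φ z.2.1 ξ.2.1 η.2.1
  have e2 := roundMetric_mfderiv_stereoMap θ z.2.2 ξ.2.2 η.2.2
  change ξ.1 * η.1 + u z.1 ^ 2 * _ + v z.1 ^ 2 * _ = _
  rw [mul_pow, mul_pow, mul_assoc, mul_assoc, ← e1, ← e2]

/-- The chart at c need not be centred at the point considered. This generality serves the limit
argument, where c is a singular point and the regular points approaching it are seen in its chart.
The proof transports `scal_warpForm` along the change of coordinates ψ. -/
theorem IsDoublyWarped.coordScalarCurvature_eq {b : ℝ} {u v : ℝ → ℝ} {g : Riem n (S n)}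
    (hg : IsDoublyWarped h b u v g) {t : ℝ} (ht : t ∈ Ioo 0 b) (huv : IsWarpPair u v t) (φ : S p)
    (θ : S q) {c : S n} (hc : warpMap h b (t, φ, θ) ∈ (extChartAt (𝓡 n) c).source) :
    coordScalarCurvature (coordMatrix g c) (extChartAt (𝓡 n) c (warpMap h b (t, φ, θ)))
      = warpScal p q u v t := by
  set ψ : WarpModel p q → EuclideanSpace ℝ (Fin n) :=
    fun z => extChartAt (𝓡 n) c (warpChart h b φ θ z) with hψ
  have hz0 : warpChart h b φ θ (t, 0, 0) = warpMap h b (t, φ, θ) := by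
    simp [warpChart, stereoProd, stereoMap_zero]
  have hcont : Continuous (warpChart h b φ θ) := (contMDiff_warpChart h b φ θ).continuous
  have hsrc : ∀ᶠ z in 𝓝 ((t, 0, 0) : WarpModel p q),
      warpChart h b φ θ z ∈ (extChartAt (𝓡 n) c).source :=
    hcont.continuousAt.eventually_mem ((isOpen_extChartAt_source c).mem_nhds (by rwa [hz0]))
  have hsm : ∀ z, warpChart h b φ θ z ∈ (extChartAt (𝓡 n) c).source → ContDiffAt ℝ ∞ ψ z := by
    intro z hz
    have h1 : ContMDiffAt (𝓡 n) 𝓘(ℝ, EuclideanSpace ℝ (Fin n)) ∞ (extChartAt (𝓡 n) c)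
        (warpChart h b φ θ z) := contMDiffAt_extChartAt' (by simpa using hz)
    exact (h1.comp z (contMDiff_warpChart h b φ θ z)).contDiffAt
  have htgt : ∀ z, warpChart h b φ θ z ∈ (extChartAt (𝓡 n) c).source →
      ψ z ∈ (extChartAt (𝓡 n) c).target := fun z hz => (extChartAt (𝓡 n) c).map_source hz
  have hpull : IsPullbackNear (coordMetric g c) (warpForm p q u v) ψ (t, 0, 0) := by
    refine ⟨?_, ?_, isMetricNear_coordMetric g (htgt _ (by rwa [hz0])),
      isMetricNear_warpForm huv, by simp; omega⟩
    · filter_upwards [hsrc] with z hz using hsm z hz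
    · filter_upwards [hsrc.eventually_nhds, continuous_fst.continuousAt.eventually_mem
        (isOpen_Ioo.mem_nhds ht)] with z hz hzt ξ η
      have hz' := hz.self_of_nhds
      rw [← hg.inner_warpChart h φ θ hzt ξ η, coordMetric_apply]
      have h1 : (extChartAt (𝓡 n) c).symm ∘ ψ =ᶠ[𝓝 z] warpChart h b φ θ := by
        filter_upwards [hz] with y hy
        exact (extChartAt (𝓡 n) c).left_inv hy
      have h2 := mfderiv_comp z (mdifferentiableAt_chartSymm (htgt z hz'))
        ((hsm z hz').contMDiffAt.mdifferentiableAt (by simp))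
      have h3 := h1.mfderiv_eq (I := 𝓘(ℝ, WarpModel p q)) (I' := 𝓡 n)
      have h4 : ∀ ξ : WarpModel p q,
          (mfderiv 𝓘(ℝ, WarpModel p q) (𝓡 n) (warpChart h b φ θ) z ξ : EuclideanSpace ℝ (Fin n))
          = mfderiv 𝓘(ℝ, EuclideanSpace ℝ (Fin n)) (𝓡 n) (extChartAt (𝓡 n) c).symm (ψ z)
            (fderiv ℝ ψ z ξ) := by
        intro ξ
        rw [← mfderiv_eq_fderiv]
        exact (congrArg (fun L => L ξ) h3).symm.trans (congrArg (fun L => L ξ) h2)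
      -- The two base points are equal but not definitionally so; viewing all tangent spaces as ℝⁿ
      -- avoids a dependent rewrite.
      have h5 : ∀ (x x' : S n), x = x' → ∀ ξ η ξ' η' : EuclideanSpace ℝ (Fin n), ξ = ξ' → η = η' →
          (g.inner x : EuclideanSpace ℝ (Fin n) →L[ℝ] EuclideanSpace ℝ (Fin n) →L[ℝ] ℝ) ξ η
            = (g.inner x' : EuclideanSpace ℝ (Fin n) →L[ℝ] EuclideanSpace ℝ (Fin n) →L[ℝ] ℝ) ξ' η' := by
        rintro x _ rfl ξ η _ _ rfl rfl
        rfl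
      exact h5 _ _ h1.self_of_nhds.symm _ _ _ _ (h4 ξ) (h4 η)
  have h6 := scal_warpForm (p := p) (q := q) huv
  rw [hpull.scal_eq] at h6
  have h7 : ψ (t, 0, 0) = extChartAt (𝓡 n) c (warpMap h b (t, φ, θ)) := by
    rw [hψ]
    simp only [hz0]
  rw [← h6, ← h7]
  refine coordScalarCurvature_formMatrix hpull.target (by simp; omega) fun i j => ?_
  rw [← hpull.eq.self_of_nhds, warpFrame_orthonormal huv]

end WarpChart

/-! ### Continuity of scalar curvature in a chart -/

section Continuity

theorem continuousAt_coordScalarCurvature {n : ℕ}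
    {G : EuclideanSpace ℝ (Fin n) → EuclideanSpace ℝ (Fin n) →L[ℝ] EuclideanSpace ℝ (Fin n) →L[ℝ] ℝ}
    {y : EuclideanSpace ℝ (Fin n)} (h : IsMetricNear G y) :
    ContinuousAt (coordScalarCurvature (formMatrix G)) y := by
  have hG : ContinuousAt G y := h.smooth.self_of_nhds.continuousAt
  have hM : ContinuousAt (formMatrix G) y := by
    refine continuousAt_pi.2 fun i => continuousAt_pi.2 fun j => ?_
    exact (hG.clm_apply continuousAt_const).clm_apply continuousAt_const
  have hdet : (formMatrix G y).det ≠ 0 :=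
    (isUnit_det_formMatrix h.pos.self_of_nhds).ne_zero
  have hinv : ∀ i j, ContinuousAt (fun z => (formMatrix G z)⁻¹ i j) y := by
    intro i j
    have e : ∀ z, (formMatrix G z)⁻¹ i j
        = (formMatrix G z).det⁻¹ * (formMatrix G z).adjugate i j := fun z => by
      rw [Matrix.inv_def, Ring.inverse_eq_inv', Matrix.smul_apply, smul_eq_mul]
    simp only [e]
    have h1 : Continuous fun M : Matrix (Fin n) (Fin n) ℝ => M.det := continuous_id.matrix_det
    have h2 : Continuous fun M : Matrix (Fin n) (Fin n) ℝ => M.adjugate i j :=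
      continuous_id.matrix_adjugate.matrix_elem i j
    exact ((h1.continuousAt.comp hM).inv₀ hdet).mul (h2.continuousAt.comp hM)
  have hchris : ContinuousAt (chris G) y := (contDiffAt_chris h).continuousAt
  have hdchris : ContinuousAt (fderiv ℝ (chris G)) y :=
    ((contDiffAt_chris h).fderiv_right (m := 0) (by simp)).continuousAt
  have hcurv : ∀ ξ η ζ, ContinuousAt (fun z => curv G z ξ η ζ) y := by
    intro ξ η ζ
    unfold curv
    have k1 : ∀ ξ η ζ, ContinuousAt (fun z => fderiv ℝ (chris G) z ξ η ζ) y := fun ξ η ζ =>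
      ((hdchris.clm_apply continuousAt_const).clm_apply continuousAt_const).clm_apply
        continuousAt_const
    have k2 : ∀ ξ η ζ, ContinuousAt (fun z => chris G z ξ (chris G z η ζ)) y := fun ξ η ζ =>
      (hchris.clm_apply continuousAt_const).clm_apply
        ((hchris.clm_apply continuousAt_const).clm_apply continuousAt_const)
    exact ((k1 ξ η ζ).sub (k1 η ξ ζ)).add ((k2 ξ η ζ).sub (k2 η ξ ζ))
  have hricci : ∀ i j, ContinuousAt (fun z => ricci (formMatrix G) i j z) y := by
    intro i j
    have e : (fun z => ricci (formMatrix G) i j z) =ᶠ[𝓝 y] fun z => ∑ a,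
        curv G z (EuclideanSpace.single a 1) (EuclideanSpace.single i 1)
          (EuclideanSpace.single j 1) a := by
      filter_upwards [h.eventually] with z hz using ricci_formMatrix hz i j
    refine ContinuousAt.congr (tendsto_finsetSum _ fun a _ => ?_) e.symm
    exact (EuclideanSpace.proj (𝕜 := ℝ) a).continuous.continuousAt.comp (hcurv _ _ _)
  exact tendsto_finsetSum _ fun i _ => tendsto_finsetSum _ fun j _ => (hinv i j).mul (hricci i j)

end Continuity

/-! ### Estimates for the warping functions -/

section OneVariable

variable {b : ℝ} {v : ℝ → ℝ}

theorem MemV.contDiffAt (hv : MemV b v) {t : ℝ} (ht : t ∈ Ioo 0 b) : ContDiffAt ℝ ∞ v t :=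
  hv.smooth.contDiffAt (Icc_mem_nhds ht.1 ht.2)

theorem MemV.contDiffOn_derivWithin (hv : MemV b v) (hb : 0 < b) :
    ContDiffOn ℝ ∞ (derivWithin v (Icc 0 b)) (Icc 0 b) :=
  ContDiffOn.derivWithin_infty hb hv.smooth

theorem deriv_eqOn_derivWithin (b : ℝ) (v : ℝ → ℝ) :
    EqOn (deriv v) (derivWithin v (Icc 0 b)) (Ioo 0 b) := fun _ ht =>
  (derivWithin_of_mem_nhds (Icc_mem_nhds ht.1 ht.2)).symm

theorem iteratedDerivWithin_two (v : ℝ → ℝ) (s : Set ℝ) :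
    iteratedDerivWithin 2 v s = derivWithin (derivWithin v s) s := by
  funext x
  rw [iteratedDerivWithin_succ, iteratedDerivWithin_one]

theorem deriv_deriv_eq (b : ℝ) (v : ℝ → ℝ) {t : ℝ} (ht : t ∈ Ioo 0 b) :
    deriv (deriv v) t = iteratedDerivWithin 2 v (Icc 0 b) t := by
  rw [iteratedDerivWithin_two, ← deriv_eqOn_derivWithin b _ ht]
  refine EventuallyEq.deriv_eq ?_
  filter_upwards [isOpen_Ioo.mem_nhds ht] with s hs using deriv_eqOn_derivWithin b v hs

theorem deriv_derivWithin_eq (b : ℝ) (v : ℝ → ℝ) {t : ℝ} (ht : t ∈ Ioo 0 b) :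
    deriv (derivWithin v (Icc 0 b)) t = iteratedDerivWithin 2 v (Icc 0 b) t := by
  rw [← deriv_deriv_eq b v ht]
  refine EventuallyEq.deriv_eq ?_
  filter_upwards [isOpen_Ioo.mem_nhds ht] with s hs using (deriv_eqOn_derivWithin b v hs).symm

theorem MemV.antitoneOn_derivWithin (hv : MemV b v) (hb : 0 < b) :
    AntitoneOn (derivWithin v (Icc 0 b)) (Icc 0 b) := by
  have h1 := hv.contDiffOn_derivWithin hb
  refine antitoneOn_of_deriv_nonpos (convex_Icc 0 b) h1.continuousOn ?_ ?_
  · rw [interior_Icc]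
    exact (h1.differentiableOn (by simp)).mono Ioo_subset_Icc_self
  · rw [interior_Icc]
    intro t ht
    rw [deriv_derivWithin_eq b v ht]
    exact hv.concave t (Ioo_subset_Icc_self ht)

theorem MemV.derivWithin_right (hv : MemV b v) : derivWithin v (Icc 0 b) b = 0 := by
  rw [← iteratedDerivWithin_one]
  exact hv.odd_right 1 odd_one

theorem MemV.deriv_nonneg (hv : MemV b v) {t : ℝ} (ht : t ∈ Ioo 0 b) : 0 ≤ deriv v t := by
  have hb := ht.1.trans ht.2
  rw [deriv_eqOn_derivWithin b v ht]
  refine hv.derivWithin_right.ge.trans ?_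
  exact hv.antitoneOn_derivWithin hb (Ioo_subset_Icc_self ht) ⟨hb.le, le_rfl⟩ ht.2.le

/-- The slope starts at 1, decreases strictly near 0 because v'' < 0 there, and never increases
afterwards. -/
theorem MemV.deriv_lt_one (hv : MemV b v) {t : ℝ} (ht : t ∈ Ioo 0 b) : deriv v t < 1 := by
  have hb := ht.1.trans ht.2
  rw [deriv_eqOn_derivWithin b v ht]
  obtain ⟨c, hc0, hc⟩ := (mem_nhdsGT_iff_exists_Ioo_subset (a := (0 : ℝ))).1 hv.strict
  set s := min c t with hs
  have hc0' : (0 : ℝ) < c := hc0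
  have hs0 : 0 < s := lt_min hc0' ht.1
  have hsb : s < b := (min_le_right c t).trans_lt ht.2
  have h1 := hv.contDiffOn_derivWithin hb
  have h2 : StrictAntiOn (derivWithin v (Icc 0 b)) (Icc 0 s) := by
    refine strictAntiOn_of_deriv_neg (convex_Icc 0 s)
      (h1.continuousOn.mono (Icc_subset_Icc_right hsb.le)) fun r hr => ?_
    rw [interior_Icc] at hr
    rw [deriv_derivWithin_eq b v ⟨hr.1, hr.2.trans hsb⟩]
    exact hc ⟨hr.1, hr.2.trans_le (min_le_left c t)⟩
  have h3 := h2 ⟨le_rfl, hs0.le⟩ ⟨hs0.le, le_rfl⟩ hs0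
  rw [hv.deriv_left] at h3
  exact (hv.antitoneOn_derivWithin hb ⟨hs0.le, hsb.le⟩ (Ioo_subset_Icc_self ht)
    (min_le_right c t)).trans_lt h3

theorem MemV.deriv_deriv_nonpos (hv : MemV b v) {t : ℝ} (ht : t ∈ Ioo 0 b) :
    deriv (deriv v) t ≤ 0 := by
  rw [deriv_deriv_eq b v ht]
  exact hv.concave t (Ioo_subset_Icc_self ht)

theorem MemV.le_self (hv : MemV b v) {t : ℝ} (ht : t ∈ Ioo 0 b) : v t ≤ t := by
  have hb := ht.1.trans ht.2
  have h0 : v 0 = 0 := by simpa using hv.even_left 0 (by simp)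
  have h1 : AntitoneOn (fun s => v s - s) (Icc 0 b) := by
    refine antitoneOn_of_deriv_nonpos (convex_Icc 0 b)
      (hv.smooth.continuousOn.sub continuousOn_id) ?_ ?_
    · rw [interior_Icc]
      exact ((hv.smooth.differentiableOn (by simp)).mono Ioo_subset_Icc_self).sub differentiableOn_id
    · rw [interior_Icc]
      intro s hs
      have h2 := ((hv.contDiffAt hs).differentiableAt (by simp)).hasDerivAt.sub (hasDerivAt_id s)
      have h3 : HasDerivAt (fun s => v s - s) _ s := h2
      rw [h3.deriv]
      linarith [hv.deriv_lt_one hs]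
  have h2 := h1 ⟨le_rfl, hb.le⟩ (Ioo_subset_Icc_self ht) ht.1.le
  simp only [h0] at h2
  linarith

/-- Since v''(0) = 0 and v'''(0) < 0, for small t one has v''(t) < t v'''(0)/2. Together with v(t) ≤
t this bounds -v''/v below by -v'''(0)/2. -/
theorem MemV.exists_le_ratio (hv : MemV b v) (hb : 0 < b) :
    ∃ κ > 0, ∀ᶠ t in 𝓝[>] 0, κ ≤ -(deriv (deriv v) t / v t) := by
  have h1 : ContDiffOn ℝ 1 (iteratedDerivWithin 2 v (Icc 0 b)) (Icc 0 b) := by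
    have h2 := ContDiffOn.derivWithin_infty hb (hv.contDiffOn_derivWithin hb)
    rw [iteratedDerivWithin_two]
    exact h2.of_le one_le_infty
  have h2 := ((h1.differentiableOn (by simp)) 0 ⟨le_rfl, hb.le⟩).hasDerivWithinAt
  rw [← iteratedDerivWithin_succ] at h2
  have h3 : HasDerivWithinAt (iteratedDerivWithin 2 v (Icc 0 b))
      (iteratedDerivWithin 3 v (Icc 0 b) 0) (Ioi 0) 0 :=
    h2.mono_of_mem_nhdsWithin (mem_of_superset (Ioo_mem_nhdsGT hb) Ioo_subset_Icc_self)
  have h4 := (hasDerivWithinAt_iff_tendsto_slope' (by simp)).1 h3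
  have hthird := hv.third
  refine ⟨-(iteratedDerivWithin 3 v (Icc 0 b) 0 / 2), by linarith, ?_⟩
  filter_upwards [h4.eventually_lt_const (show iteratedDerivWithin 3 v (Icc 0 b) 0
    < iteratedDerivWithin 3 v (Icc 0 b) 0 / 2 by linarith), Ioo_mem_nhdsGT hb] with t h5 ht
  rw [slope_def_field, hv.even_left 2 even_two, sub_zero, sub_zero, div_lt_iff₀ ht.1] at h5
  rw [deriv_deriv_eq b v ht, ← neg_div (v t), le_div_iff₀ (hv.pos t ht)]
  have h6 := hv.le_self ht
  nlinarith

/-- Since v'(b) = 0, the quotient tends to 1/v(b)² > 0, and half the limit is a lower bound. -/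
theorem MemV.exists_le_right (hv : MemV b v) (hb : 0 < b) :
    ∃ κ > 0, ∀ᶠ t in 𝓝[<] b, κ ≤ (1 - deriv v t ^ 2) / v t ^ 2 := by
  have hI : 𝓝[<] b ≤ 𝓝[Icc 0 b] b :=
    nhdsWithin_le_of_mem (mem_of_superset (Ioo_mem_nhdsLT hb) Ioo_subset_Icc_self)
  have mb : b ∈ Icc 0 b := ⟨hb.le, le_rfl⟩
  have h1 : Tendsto (derivWithin v (Icc 0 b)) (𝓝[<] b) (𝓝 0) := by
    have := ((hv.contDiffOn_derivWithin hb).continuousOn b mb).tendsto.mono_left hI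
    rwa [hv.derivWithin_right] at this
  have h2 : Tendsto v (𝓝[<] b) (𝓝 (v b)) :=
    (hv.smooth.continuousOn b mb).tendsto.mono_left hI
  have hvb := hv.pos_right
  have h3 := ((tendsto_const_nhds (x := (1 : ℝ))).sub (h1.pow 2)).div (h2.pow 2) (by positivity)
  have h4 : 0 < (1 - (0 : ℝ) ^ 2) / v b ^ 2 := by
    simp only [ne_eq, OfNat.ofNat_ne_zero, not_false_eq_true, zero_pow, sub_zero]
    positivity
  refine ⟨(1 - (0 : ℝ) ^ 2) / v b ^ 2 / 2, by positivity, ?_⟩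
  filter_upwards [h3.eventually_const_lt (half_lt_self h4), Ioo_mem_nhdsLT hb] with t ht ht'
  rw [deriv_eqOn_derivWithin b v ht']
  exact ht.le

theorem deriv_reflect (b : ℝ) (f : ℝ → ℝ) (t : ℝ) :
    deriv (fun s => f (b - s)) t = -deriv f (b - t) := deriv_comp_const_sub ..

theorem deriv_deriv_reflect (b : ℝ) (f : ℝ → ℝ) (t : ℝ) :
    deriv (deriv fun s => f (b - s)) t = deriv (deriv f) (b - t) := by
  have h1 : (deriv fun s => f (b - s)) = fun s => -deriv f (b - s) := funext (deriv_reflect b f)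
  rw [h1, deriv.fun_neg, deriv_reflect, neg_neg]

theorem warpScal_reflect (p q : ℕ) (b : ℝ) (u v : ℝ → ℝ) (t : ℝ) :
    warpScal q p (fun s => v (b - s)) (fun s => u (b - s)) t = warpScal p q u v (b - t) := by
  simp only [warpScal, deriv_reflect, deriv_deriv_reflect]
  ring

end OneVariable

/-! ### Positivity of the scalar curvature -/

section Positivity

/-- Under these sign conditions all five summands of the scalar curvature are nonnegative, so each
alone is a lower bound; the three recorded ones are used later. -/
theorem warpScal_lower_bounds (p q : ℕ) {u v : ℝ → ℝ} {t : ℝ} (hu : 0 < u t) (hv : 0 < v t)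
    (hu1 : deriv u t ≤ 0) (hu1' : -1 < deriv u t) (hv1 : 0 ≤ deriv v t) (hv1' : deriv v t < 1)
    (hu2 : deriv (deriv u) t ≤ 0) (hv2 : deriv (deriv v) t ≤ 0) :
    2 * q * -(deriv (deriv v) t / v t) ≤ warpScal p q u v t ∧
    p * (p - 1) * ((1 - deriv u t ^ 2) / u t ^ 2) ≤ warpScal p q u v t ∧
    q * (q - 1) * ((1 - deriv v t ^ 2) / v t ^ 2) ≤ warpScal p q u v t := by
  have hnat : ∀ m : ℕ, 0 ≤ (m : ℝ) * (m - 1) := by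
    intro m
    rcases Nat.eq_zero_or_pos m with rfl | hm
    · simp
    · exact mul_nonneg (Nat.cast_nonneg m) (sub_nonneg.2 (by exact_mod_cast hm))
  have t1 : 0 ≤ 2 * p * -(deriv (deriv u) t / u t) :=
    mul_nonneg (by positivity) (neg_nonneg.2 (div_nonpos_of_nonpos_of_nonneg hu2 hu.le))
  have t2 : 0 ≤ 2 * q * -(deriv (deriv v) t / v t) :=
    mul_nonneg (by positivity) (neg_nonneg.2 (div_nonpos_of_nonpos_of_nonneg hv2 hv.le))
  have t3 : 0 ≤ p * (p - 1) * ((1 - deriv u t ^ 2) / u t ^ 2) :=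
    mul_nonneg (hnat p) (div_nonneg (by nlinarith) (sq_nonneg _))
  have t4 : 0 ≤ q * (q - 1) * ((1 - deriv v t ^ 2) / v t ^ 2) :=
    mul_nonneg (hnat q) (div_nonneg (by nlinarith) (sq_nonneg _))
  have t5 : 0 ≤ 2 * p * q * -(deriv u t * deriv v t / (u t * v t)) :=
    mul_nonneg (by positivity) (neg_nonneg.2
      (div_nonpos_of_nonpos_of_nonneg (mul_nonpos_of_nonpos_of_nonneg hu1 hv1) (mul_pos hu hv).le))
  simp only [warpScal]
  refine ⟨?_, ?_, ?_⟩ <;> linarith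

variable {b : ℝ} {u v : ℝ → ℝ}

theorem warpScal_lower_bounds_of_mem (p q : ℕ) (hu : MemU b u) (hv : MemV b v) {t : ℝ}
    (ht : t ∈ Ioo 0 b) :
    2 * q * -(deriv (deriv v) t / v t) ≤ warpScal p q u v t ∧
    p * (p - 1) * ((1 - deriv u t ^ 2) / u t ^ 2) ≤ warpScal p q u v t ∧
    q * (q - 1) * ((1 - deriv v t ^ 2) / v t ^ 2) ≤ warpScal p q u v t := by
  have hw := memU_iff_memV.1 hu
  have ht' : b - t ∈ Ioo 0 b := ⟨sub_pos.2 ht.2, sub_lt_self b ht.1⟩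
  have h1 := hw.deriv_nonneg ht'
  have h2 := hw.deriv_lt_one ht'
  have h3 := hw.deriv_deriv_nonpos ht'
  rw [deriv_reflect, sub_sub_cancel] at h1 h2
  rw [deriv_deriv_reflect, sub_sub_cancel] at h3
  exact warpScal_lower_bounds p q (hu.pos t ht) (hv.pos t ht) (by linarith) (by linarith)
    (hv.deriv_nonneg ht) (hv.deriv_lt_one ht) h3 (hv.deriv_deriv_nonpos ht)

theorem natCast_mul_pred_pos {m : ℕ} (hm : 2 ≤ m) : 0 < (m : ℝ) * (m - 1) := by
  have : (2 : ℝ) ≤ m := by exact_mod_cast hm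
  exact mul_pos (by linarith) (by linarith)

theorem warpScal_pos {p q : ℕ} (hpq : 2 ≤ p ∨ 2 ≤ q) (hu : MemU b u) (hv : MemV b v) {t : ℝ}
    (ht : t ∈ Ioo 0 b) : 0 < warpScal p q u v t := by
  obtain ⟨-, h2, h3⟩ := warpScal_lower_bounds_of_mem p q hu hv ht
  rcases hpq with h | h
  · refine lt_of_lt_of_le (mul_pos (natCast_mul_pred_pos h) (div_pos ?_ (pow_pos (hu.pos t ht) 2))) h2
    have hw := memU_iff_memV.1 hu
    have ht' : b - t ∈ Ioo 0 b := ⟨sub_pos.2 ht.2, sub_lt_self b ht.1⟩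
    have h4 := hw.deriv_nonneg ht'
    have h5 := hw.deriv_lt_one ht'
    rw [deriv_reflect, sub_sub_cancel] at h4 h5
    nlinarith
  · refine lt_of_lt_of_le (mul_pos (natCast_mul_pred_pos h) (div_pos ?_ (pow_pos (hv.pos t ht) 2))) h3
    have h4 := hv.deriv_nonneg ht
    have h5 := hv.deriv_lt_one ht
    nlinarith

theorem exists_le_warpScal_left {p q : ℕ} (hpq : 2 ≤ p ∨ 1 ≤ q) (hb : 0 < b) (hu : MemU b u)
    (hv : MemV b v) : ∃ κ > 0, ∀ᶠ t in 𝓝[>] 0, κ ≤ warpScal p q u v t := by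
  rcases hpq with h | h
  · obtain ⟨κ, hκ, hev⟩ := (memU_iff_memV.1 hu).exists_le_right hb
    refine ⟨p * (p - 1) * κ, mul_pos (natCast_mul_pred_pos h) hκ, ?_⟩
    filter_upwards [(tendsto_const_sub_nhdsGT b).eventually hev, Ioo_mem_nhdsGT hb] with t h1 ht
    refine le_trans (mul_le_mul_of_nonneg_left ?_ (natCast_mul_pred_pos h).le)
      (warpScal_lower_bounds_of_mem p q hu hv ht).2.1
    rwa [deriv_reflect, sub_sub_cancel, neg_sq] at h1
  · obtain ⟨κ, hκ, hev⟩ := hv.exists_le_ratio hb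
    have hq : (0 : ℝ) < q := by exact_mod_cast h
    refine ⟨2 * q * κ, by positivity, ?_⟩
    filter_upwards [hev, Ioo_mem_nhdsGT hb] with t h1 ht
    exact le_trans (mul_le_mul_of_nonneg_left h1 (by positivity))
      (warpScal_lower_bounds_of_mem p q hu hv ht).1

theorem exists_le_warpScal_right {p q : ℕ} (hpq : 1 ≤ p ∨ 2 ≤ q) (hb : 0 < b) (hu : MemU b u)
    (hv : MemV b v) : ∃ κ > 0, ∀ᶠ t in 𝓝[<] b, κ ≤ warpScal p q u v t := by
  have hv' : MemU b fun s => v (b - s) := by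
    rw [memU_iff_memV]
    simpa using hv
  obtain ⟨κ, hκ, hev⟩ := exists_le_warpScal_left hpq.symm hb hv' (memU_iff_memV.1 hu)
  refine ⟨κ, hκ, ?_⟩
  filter_upwards [(tendsto_const_sub_nhdsLT b).eventually hev] with t ht
  rwa [warpScal_reflect, sub_sub_cancel] at ht

variable {n p q : ℕ} (h : p + q + 1 = n)

theorem isWarpPair_of_mem (hu : MemU b u) (hv : MemV b v) {t : ℝ} (ht : t ∈ Ioo 0 b) :
    IsWarpPair u v t := by
  refine ⟨?_, ?_, hu.pos t ht, hv.pos t ht⟩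
  · filter_upwards [isOpen_Ioo.mem_nhds ht] with s hs
    exact hu.smooth.contDiffAt (Icc_mem_nhds hs.1 hs.2)
  · filter_upwards [isOpen_Ioo.mem_nhds ht] with s hs
    exact hv.contDiffAt hs

/-- A lower bound κ > 0 along points tending to x passes to x by continuity. The curvature at the
nearby points is measured in the chart at x, in which the scalar curvature at x is defined. -/
theorem scalarCurvature_pos_of_le {g : Riem n (S n)} {x : S n} {γ : ℝ → S n} {l : Filter ℝ}
    [l.NeBot] {κ : ℝ} (hγ : Tendsto γ l (𝓝 x)) (hκ : 0 < κ)
    (hle : ∀ᶠ t in l, γ t ∈ (extChartAt (𝓡 n) x).source →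
      κ ≤ coordScalarCurvature (coordMatrix g x) (extChartAt (𝓡 n) x (γ t))) :
    0 < scalarCurvature g x := by
  have h1 : ContinuousAt (coordScalarCurvature (coordMatrix g x)) (extChartAt (𝓡 n) x x) :=
    continuousAt_coordScalarCurvature (isMetricNear_coordMetric g (mem_extChartAt_target x))
  have h2 := h1.tendsto.comp ((continuousAt_extChartAt x).tendsto.comp hγ)
  refine lt_of_lt_of_le hκ (ge_of_tendsto h2 ?_)
  filter_upwards [hle, hγ.eventually (extChartAt_source_mem_nhds (I := 𝓡 n) x)] with t ht hs
  exact ht hs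

theorem IsDoublyWarped.mem_riemPos (hn : 3 ≤ n) (hne : ¬(p = 1 ∧ q = 1)) (hb : 0 < b)
    (hu : MemU b u) (hv : MemV b v) {g : Riem n (S n)} (hg : IsDoublyWarped h b u v g) :
    g ∈ RiemPos n (S n) := by
  intro x
  -- Here p + q ≥ 2 and (p, q) ≠ (1, 1) enter. The first alternative handles regular points, the
  -- other two the ends t = 0 and t = b.
  have hpq : 2 ≤ p ∨ 2 ≤ q := by omega
  have hpq₁ : 2 ≤ p ∨ 1 ≤ q := by omega
  have hpq₂ : 1 ≤ p ∨ 2 ≤ q := by omega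
  obtain ⟨φ, θ, hx⟩ := exists_warpMap_eq h hb x
  have hcont : Continuous fun t : ℝ => warpMap h b (t, φ, θ) :=
    (contMDiff_warpMap h b).continuous.comp (by fun_prop)
  have hr := radial_mem_Icc (latitude h x)
  have ht0 : 0 ≤ b * radial (latitude h x) := mul_nonneg hb.le hr.1
  have ht1 : b * radial (latitude h x) ≤ b := by nlinarith [hr.2]
  generalize b * radial (latitude h x) = t₀ at *
  have hlim : ∀ l ≤ 𝓝 t₀, Tendsto (fun t : ℝ => warpMap h b (t, φ, θ)) l (𝓝 x) := by
    intro l hl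
    have := hcont.tendsto t₀
    rw [hx] at this
    exact this.mono_left hl
  -- The values t₀ = 0 and t₀ = b are the singular subspheres, where the warped coordinates
  -- degenerate; they are approached with φ and θ fixed.
  rcases ht0.eq_or_lt with h0 | h0
  · subst h0
    obtain ⟨κ, hκ, hev⟩ := exists_le_warpScal_left hpq₁ hb hu hv
    refine scalarCurvature_pos_of_le (hlim _ (nhdsWithin_le_nhds (s := Ioi 0))) hκ ?_
    filter_upwards [hev, Ioo_mem_nhdsGT hb] with t h1 ht hs
    rwa [hg.coordScalarCurvature_eq h ht (isWarpPair_of_mem hu hv ht) φ θ hs]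
  rcases ht1.eq_or_lt with h1 | h1
  · subst h1
    obtain ⟨κ, hκ, hev⟩ := exists_le_warpScal_right hpq₂ hb hu hv
    refine scalarCurvature_pos_of_le (hlim _ (nhdsWithin_le_nhds (s := Iio t₀))) hκ ?_
    filter_upwards [hev, Ioo_mem_nhdsLT hb] with t h1 ht hs
    rwa [hg.coordScalarCurvature_eq h ht (isWarpPair_of_mem hu hv ht) φ θ hs]
  · have ht : t₀ ∈ Ioo 0 b := ⟨h0, h1⟩
    subst hx
    rw [scalarCurvature, hg.coordScalarCurvature_eq h ht (isWarpPair_of_mem hu hv ht) φ θ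
      (mem_extChartAt_source _)]
    exact warpScal_pos hpq hu hv ht

end Positivity

end WarpedSphere

end

/-! ### The main theorem -/

open WarpedSphere in
theorem mainTheorem10 (n p q k : ℕ) (hn : 3 ≤ n) (hpq : p + q + 1 = n) (hne : ¬(p = 1 ∧ q = 1))
    (hk : 2 ≤ k) :
    (∀ b : ℝ, 0 < b →
      (∀ u v : ℝ → ℝ, MemU b u → MemV b v → ∃! g : Riem n (S n), IsDoublyWarped hpq b u v g) ∧
      warpedMetrics hpq b ⊆ RiemPos n (S n) ∧
      @IsPathConnected (Riem n (S n)) (ckTopology k) (warpedMetrics hpq b)) ∧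
    @IsPathConnected (Riem n (S n)) (ckTopology k) (⋃ b ∈ Ioi (0 : ℝ), warpedMetrics hpq b) ∧
    (∀ (ε δ b : ℝ) (fε fδ : ℝ → ℝ), 0 < ε → 0 < δ → IsTorpedo ε fε → IsTorpedo δ fδ →
      max (ε * Real.pi) (δ * Real.pi) < b →
      (∃! g : Riem n (S n), IsMixedTorpedo hpq b fε fδ g) ∧
      ∀ g : Riem n (S n), IsMixedTorpedo hpq b fε fδ g → Isotopic k g (roundMetric n)) := by
  have hsub : ∀ b : ℝ, 0 < b → warpedMetrics hpq b ⊆ RiemPos n (S n) := by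
    rintro b hb g ⟨u, v, hu, hv, hg⟩
    exact hg.mem_riemPos hpq hn hne hb hu hv
  have hpos : ∀ {b₀ b₁ : ℝ}, 0 < b₀ → 0 < b₁ → ∀ s ∈ Icc (0 : ℝ) 1, 0 < (1 - s) * b₀ + s * b₁ := by
    intro b₀ b₁ hb₀ hb₁ s hs
    rcases hs.1.eq_or_lt with h | h
    · rw [← h]
      linarith
    · have := mul_pos h hb₁
      have := mul_nonneg (sub_nonneg.2 hs.2) hb₀.le
      linarith
  refine ⟨fun b hb => ⟨fun u v hu hv => ?_, hsub b hb, ?_⟩, ?_, ?_⟩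
  · obtain ⟨g, hg⟩ := exists_isDoublyWarped hpq hb hu hv
    exact ⟨g, hg, fun g' hg' => hg'.unique hpq hb hg⟩
  · refine (@isPathConnected_iff _ (ckTopology k) _).2 ⟨warpedMetrics_nonempty hpq hb,
      fun g₀ hg₀ g₁ hg₁ => joinedIn_of_warpedMetrics hpq hb hb hg₀ hg₁ k fun s _ => ?_⟩
    -- With equal end lengths the interpolated length is constantly b, so the path stays in the same
    -- space.
    rw [← add_mul, sub_add_cancel, one_mul]
  · refine (@isPathConnected_iff _ (ckTopology k) _).2 ⟨?_, fun g₀ hg₀ g₁ hg₁ => ?_⟩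
    · obtain ⟨g, hg⟩ := warpedMetrics_nonempty hpq one_pos
      exact ⟨g, mem_biUnion (mem_Ioi.2 one_pos) hg⟩
    · obtain ⟨b₀, hb₀, hg₀⟩ := mem_iUnion₂.1 hg₀
      obtain ⟨b₁, hb₁, hg₁⟩ := mem_iUnion₂.1 hg₁
      exact joinedIn_of_warpedMetrics hpq hb₀ hb₁ hg₀ hg₁ k fun s hs =>
        subset_biUnion_of_mem (u := fun b => warpedMetrics hpq b) (mem_Ioi.2 (hpos hb₀ hb₁ s hs))
  · intro ε δ b fε fδ hε hδ hfε hfδ hb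
    obtain ⟨hbε, hbδ⟩ := max_lt_iff.1 hb
    have hb0 : 0 < b := (mul_pos hε Real.pi_pos).trans hbε
    have hu := memU_of_isTorpedo hε hfε hbε
    have hv := memV_of_isTorpedo hδ hfδ hbδ
    refine ⟨?_, fun g hg => ?_⟩
    · obtain ⟨g, hg⟩ := exists_isDoublyWarped hpq hb0 hu hv
      exact ⟨g, (isMixedTorpedo_iff hpq).2 hg, fun g' hg' =>
        ((isMixedTorpedo_iff hpq).1 hg').unique hpq hb0 hg⟩
    -- The length moves from b to π/2 along this path; every intermediate space consists of metrics
    -- of positive scalar curvature.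
    · exact joinedIn_of_warpedMetrics hpq hb0 Real.pi_div_two_pos
        ⟨_, _, hu, hv, (isMixedTorpedo_iff hpq).1 hg⟩ (roundMetric_mem_warpedMetrics hpq) k
        fun s hs => hsub _ (hpos hb0 Real.pi_div_two_pos s hs)
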